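/- **Setup.** Let $V$ be a finite index set and let $(E_v,\mathcal E_v)$, $v\in V$, be standard Borel spaces with distinguished points $o_v\in E_v$. For $A\subseteq V$ put $E_A=\prod_{v\in A}E_v$ with the product $\sigma$-field, $o_A=(o_v)_{v\in A}$, $E_A^o=E_A\setminus\{o_A\}$ with the trace $\sigma$-field, and $y_A=(y_v)_{v\in A}$. For each $v$ let $L_{1,v}\subseteq L_{2,v}\subseteq\cdots$ be measurable sets with $\bigcup_h L_{h,v}=E_v\setminus\{o_v\}$; for nonempty $D\subseteq V$ put $L_{h,D}=\bigcup_{v\in D}\{y\in E_D: y_v\in L_{h,v}\}$, and call a subset of $E_D$ bounded if it is contained in some $L_{h,D}$. Let $\Lambda=\Lambda_V^o$ be a measure on $E_V^o$ that is finite on bounded measurable sets and satisfies the explosiveness condition $$\Lambda(y_A\neq o_A,\ y_B=o_B)\in\{0,\infty\}\qquad\text{for all disjoint } A,B\subseteq V \text{ with } A\neq\emptyset .$$ For $D\subseteq V$ let $\Lambda_D^o$ be the measure $G\mapsto\Lambda(y_D\in G)$ on $E_D^o$. For a measurable bounded $R\subseteq E_V$ with $\Lambda(R)>0$ let $P_R=\Lambda(\,\cdot\cap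 R)/\Lambda(R)$. Put $R_{h,v}=\{y\in E_V: y_v\in L_{h,v}\}$. A Poisson process with mean measure $\Lambda$ is a random s-finite $\{0,1,\dots,\infty\}$-valued measure $\xi$ on $E_V^o$ such that $\xi(G)$ is Poisson with mean $\Lambda(G)$ for each measurable $G$ (a.s. equal to $0$ or $\infty$ if $\Lambda(G)=0$ or $\infty$) and $\xi(G_1),\dots,\xi(G_m)$ are independent for disjoint measurable $G_1,\dots,G_m$. For $I\subseteq V$ put $\xi_I(\cdot)=\xi(y_I\in\cdot)$, a random measure on $E_I$. The $\sigma$-field on a space of measures is the one generated by the evaluations at measurable sets. Throughout, a conditional independence given $Y_C$ or $\xi_C$ with $C=\emptyset$ is understood as unconditional independence, and conditions on $y_C$ are void if $C=\emptyset$. **Theorem.** Let $A,B,C$ be pairwise disjoint subsets of $V$ with $A\ne\emptyset$ and $B\neq\emptyset$. (1) Suppose that $A\cup B\cup C=V$. The following statements are equivalent. * (a) For every $R=\prod_{v\in V}R_v$ with $R_v\in\mathcal E_v$, $R$ bounded and $\Lambda(R)>0$, one has $Y_A\perp Y_B\mid Y_C$ for $Y\sim P_R$. (This is the definition of $A\perp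 B\mid C$ for $\Lambda$.) * (b) For all $v\in V$ and all $h$ with $\Lambda(R_{h,v})>0$, one has $Y_A\perp Y_B\mid Y_C$ for $Y\sim P_{R_{h,v}}$. * (c) For all $c\in C$ and all $h$ with $\Lambda(R_{h,c})>0$, one has $Y_A\perp Y_B\mid Y_C$ for $Y\sim P_{R_{h,c}}$; and $$\Lambda(y_A\neq o_A,\ y_B\neq o_B,\ y_C=o_C)=0.\qquad(*)$$ * (d) Condition $(*)$ holds and, if $C\ne\emptyset$, then for some (equivalently, for every) probability kernel $\kappa$ from $E_C^o$ to $E_A\times E_B$ that disintegrates $\Lambda$ over $\{y_C\neq o_C\}$, i.e. $$\Lambda\big(y_C\neq o_C,\ (y_C,(y_A,y_B))\in G\big)=\int\kappa\big(\{w:(z,w)\in G\}\mid z\big)\,\Lambda_C^o(dz)\quad\text{for all measurable }G\subseteq E_C^o\times(E_A\times E_B),$$ one has $\kappa(\cdot\mid z)=\kappa_A(\cdot\mid z)\otimes\kappa_B(\cdot\mid z)$ for $\Lambda_C^o$-a.e. $z$, where $\kappa_A,\kappa_B$ are the marginal kernels of $\kappa$ on $E_A$ and $E_B$. * (e) $\xi_A\perp\xi_B\mid\xi_C$,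 where $\xi$ is a Poisson process on $E_V^o$ with mean measure $\Lambda$ (any such process on any probability space). (2) If $A\cup B\cup C$ is an arbitrary subset $D$ of $V$, the same equivalences hold when in (a)–(d) the set $V$ is replaced by $D$ and $\Lambda$ by the marginal measure $\Lambda_D^o$ (statement (a) is then the definition of $A\perp B\mid C$ for $\Lambda$), while (e) is left unchanged, with $\xi$ still the Poisson process on $E_V^o$ with mean measure $\Lambda$. -/

import Mathlib

open MeasureTheory ProbabilityTheory
open scoped ENNReal

namespace PuncturedCI

/-! ### Conditional independence of random elements -/

/-- `X ⊥ Y | Z` under `P`, for random elements of arbitrary measurable spaces on an arbitrary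
probability space: `P(X ∈ s, Y ∈ t | Z) = P(X ∈ s | Z) P(Y ∈ t | Z)` almost surely. -/
def CondIndepGiven {Ω α β γ : Type*} [MeasurableSpace Ω] [MeasurableSpace α] [MeasurableSpace β]
    [mγ : MeasurableSpace γ] (X : Ω → α) (Y : Ω → β) (Z : Ω → γ) (P : Measure Ω) : Prop :=
  ∀ s t, MeasurableSet s → MeasurableSet t →
    P⟦X ⁻¹' s ∩ Y ⁻¹' t | mγ.comap Z⟧ =ᵐ[P] P⟦X ⁻¹' s | mγ.comap Z⟧ * P⟦Y ⁻¹' t | mγ.comap Z⟧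

/-- `X ⊥ Y | Z`, where `Z` is indexed by the set `C`: unconditional independence if `C = ∅`. -/
def CondIndepIndexed {ι Ω α β γ : Type*} [MeasurableSpace Ω] [MeasurableSpace α]
    [MeasurableSpace β] [MeasurableSpace γ] (C : Finset ι)
    (X : Ω → α) (Y : Ω → β) (Z : Ω → γ) (P : Measure Ω) : Prop :=
  (C = ∅ → IndepFun X Y P) ∧ (C.Nonempty → CondIndepGiven X Y Z P)

/-! ### Point measures and Poisson processes -/

/-- An s-finite measure with values in `{0, 1, …, ∞}`. -/
def IsPointMeasure {S : Type*} [MeasurableSpace S] (μ : Measure S) : Prop :=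
  SFinite μ ∧ ∀ G, MeasurableSet G → ∃ n : ℕ∞, μ G = (n : ℝ≥0∞)

/-- `ξ` is a Poisson process with mean measure `Λ` on the probability space `(Ω, P)`. The σ-field
on `Measure S` is the one generated by the evaluations at measurable sets. -/
structure IsPoissonProcess {Ω S : Type*} [MeasurableSpace Ω] [MeasurableSpace S]
    (ξ : Ω → Measure S) (Λ : Measure S) (P : Measure Ω) : Prop where
  measurable : Measurable ξ
  isPointMeasure : ∀ ω, IsPointMeasure (ξ ω)
  law_of_finite : ∀ G, MeasurableSet G → Λ G ≠ ∞ →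
    P.map (fun ω => ξ ω G) = (poissonMeasure (Λ G).toNNReal).map (fun n : ℕ => (n : ℝ≥0∞))
  law_of_infinite : ∀ G, MeasurableSet G → Λ G = ∞ → ∀ᵐ ω ∂P, ξ ω G = ∞
  indep : ∀ (m : ℕ) (G : Fin m → Set S), (∀ i, MeasurableSet (G i)) →
    Pairwise (Function.onFun Disjoint G) → iIndepFun (fun i ω => ξ ω (G i)) P

/-! ### Punctured product spaces -/

section Product

variable {ι : Type*} {E : ι → Type*}

/-- The product space with the distinguished point `o` removed; it carries the trace of the
product σ-field. For `A : Finset ι`, the punctured space over `A` is `Punctured (A.restrict o)`. -/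
abbrev Punctured (o : ∀ i, E i) : Type _ := {y : ∀ i, E i // y ≠ o}

/-- The coordinates `y_A = (y_i)_{i ∈ A}` of a point of the punctured product space. -/
def coords (o : ∀ i, E i) (A : Finset ι) (y : Punctured o) : ∀ i : A, E i := A.restrict y.1

/-- The localizing sets of the product: `⋃ i, {y | y i ∈ L h i}`. -/
def prodLoc (L : ℕ → ∀ i, Set (E i)) (h : ℕ) : Set (∀ i, E i) := {y | ∃ i, y i ∈ L h i}

/-- A set in the product space is bounded if it lies in one of the localizing sets. -/
def IsBdd (L : ℕ → ∀ i, Set (E i)) (G : Set (∀ i, E i)) : Prop := ∃ h, G ⊆ prodLoc L h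

variable [∀ i, MeasurableSpace (E i)]

/-- The mass that a measure on the punctured space gives to `{y ∈ G, y ≠ o}`. -/
noncomputable def mass (o : ∀ i, E i) (Λ : Measure (Punctured o)) (G : Set (∀ i, E i)) : ℝ≥0∞ :=
  Λ (Subtype.val ⁻¹' G)

/-- The standing assumptions on the localizing sets and on the measure `Λ` (the spaces `E i` being
standard Borel is a type class assumption). -/
structure LocalizedExplosive (o : ∀ i, E i) (L : ℕ → ∀ i, Set (E i))
    (Λ : Measure (Punctured o)) : Prop where
  measurableSet_loc : ∀ h i, MeasurableSet (L h i)
  loc_subset_succ : ∀ h i, L h i ⊆ L (h + 1) i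
  iUnion_loc : ∀ i, ⋃ h, L h i = {o i}ᶜ
  locallyFinite : ∀ G : Set (∀ i, E i), MeasurableSet G → IsBdd L G → mass o Λ G < ∞
  explosive : ∀ A B : Finset ι, Disjoint A B → A.Nonempty →
    Λ {y | coords o A y ≠ A.restrict o ∧ coords o B y = B.restrict o} = 0 ∨
    Λ {y | coords o A y ≠ A.restrict o ∧ coords o B y = B.restrict o} = ∞

/-- The marginal measure induced by `Λ` on the punctured product space over `D`. -/
noncomputable def marginal (o : ∀ i, E i) (Λ : Measure (Punctured o)) (D : Finset ι) :
    Measure (Punctured (D.restrict o)) :=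
  (Λ.map (coords o D)).comap Subtype.val

/-- `Y_A ⊥ Y_B | Y_C` for `Y` distributed according to the normalized restriction of `Λ` to `Q`. -/
def CondIndepOn (o : ∀ i, E i) (Λ : Measure (Punctured o)) (A B C : Finset ι)
    (Q : Set (∀ i, E i)) : Prop :=
  CondIndepIndexed C (coords o A) (coords o B) (coords o C) (cond Λ (Subtype.val ⁻¹' Q))

/-- Conditional independence `A ⊥ B | C` for `Λ`, when `A, B, C` partition the index set:
conditional independence on all bounded product sets of positive mass. -/
def AdmitsCondIndep (o : ∀ i, E i) (L : ℕ → ∀ i, Set (E i)) (Λ : Measure (Punctured o))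
    (A B C : Finset ι) : Prop :=
  ∀ R : ∀ i, Set (E i), (∀ i, MeasurableSet (R i)) → 0 < mass o Λ (Set.univ.pi R) →
    IsBdd L (Set.univ.pi R) → CondIndepOn o Λ A B C (Set.univ.pi R)

/-- The reduced test sets `{y | y i ∈ L h i}`. -/
def slab (L : ℕ → ∀ i, Set (E i)) (h : ℕ) (i : ι) : Set (∀ i, E i) := {y | y i ∈ L h i}

/-- Conditional independence on all reduced test sets of positive mass with coordinate in `I`. -/
def CondIndepOnSlabs (o : ∀ i, E i) (L : ℕ → ∀ i, Set (E i)) (Λ : Measure (Punctured o))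
    (A B C I : Finset ι) : Prop :=
  ∀ i ∈ I, ∀ h, 0 < mass o Λ (slab L h i) → CondIndepOn o Λ A B C (slab L h i)

/-- `Λ(y_A ≠ o_A, y_B ≠ o_B, y_C = o_C) = 0`; if `C = ∅` the condition on `y_C` is void. -/
def NullOffC (o : ∀ i, E i) (Λ : Measure (Punctured o)) (A B C : Finset ι) : Prop :=
  Λ {y | coords o A y ≠ A.restrict o ∧ coords o B y ≠ B.restrict o ∧
    coords o C y = C.restrict o} = 0

/-- `κ` is a probability kernel that disintegrates the restriction of `Λ` to `{y_C ≠ o_C}` with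
respect to the marginal of `Λ` on the punctured space over `C`. -/
def IsDisintegration (o : ∀ i, E i) (Λ : Measure (Punctured o)) (A B C : Finset ι)
    (κ : Kernel (Punctured (C.restrict o)) ((∀ i : A, E i) × (∀ i : B, E i))) : Prop :=
  IsMarkovKernel κ ∧
  ∀ G : Set (Punctured (C.restrict o) × ((∀ i : A, E i) × (∀ i : B, E i))), MeasurableSet G →
    Λ {y | ∃ hy : coords o C y ≠ C.restrict o,
      (⟨coords o C y, hy⟩, (coords o A y, coords o B y)) ∈ G} =
    ∫⁻ z, κ z {w | (z, w) ∈ G} ∂(marginal o Λ C)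

/-- The kernel `κ` is, almost everywhere, the product of its two marginal kernels. -/
def Factorizes (o : ∀ i, E i) (Λ : Measure (Punctured o)) (A B C : Finset ι)
    (κ : Kernel (Punctured (C.restrict o)) ((∀ i : A, E i) × (∀ i : B, E i))) : Prop :=
  ∀ᵐ z ∂(marginal o Λ C), κ z = (κ.fst z).prod (κ.snd z)

/-- The projection of a point process to the (non-punctured) product space over `I`. -/
noncomputable def proj {Ω : Type*} (o : ∀ i, E i) (ξ : Ω → Measure (Punctured o)) (I : Finset ι)
    (ω : Ω) : Measure (∀ i : I, E i) := (ξ ω).map (coords o I)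

end Product

end PuncturedCI

open PuncturedCI

/-! Write `X`, `Y`, `Z` for the coordinate maps to `E_A`, `E_B`, `E_C` and `x₀`, `y₀`, `z₀` for the
base points. Every statement is compared with one pair of conditions: `Λ` has no mass on `{X ≠ x₀, Y
≠ y₀, Z = z₀}`, and a disintegration kernel `κ` of `Λ` over `{Z ≠ z₀}` is almost everywhere a
product.

Analytic side. Given the pair, split a bounded product set along `Z = z₀`. Off `z₀` the restricted
measure is a mixture of product measures. On `Z = z₀`, boundedness excludes the base point, so one
of `X`, `Y` must differ from its base value, and by the null condition the other is constant
(`Disintegrates.condIndepUnder`). Conversely, countably many slabs with a coordinate in `C` cover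
`{Z ≠ z₀}`, and conditional independence on each factorizes `κ` there
(`Disintegrates.ae_prod_of_condIndepUnder`). Slabs with a coordinate in `A` give the null condition:
as they grow, an explosive mass tends to infinity on one side of a product identity whose other side
stays bounded (`measure_eq_zero_of_condIndepUnder`).

Poisson side. Heuristically, given `ξ_C` each atom `z ≠ z₀` carries an independent mark of law `κ
z`, and the points over `z₀` are an independent Poisson process. The conditional Laplace functional
is therefore the explicit `condLaplace`. If the pair holds, it splits into a factor for `f` and a
factor for `g`, and Laplace functionals determine laws (`condIndepUnder_of_laplace`). Here
explosiveness makes the number of points over a base point almost surely `0` or `∞`, so test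
functions may be assumed to vanish there. Conversely, infinite test functions on `s` and `t` produce
void events; conditional independence equates two Laplace exponents, which after localization in `z`
yield `κ(sᶜ × tᶜ) = κ_A(sᶜ) κ_B(tᶜ)` and additivity of `Λ` on `{X ∈ s} ∪ {Y ∈ t}` over `Z = z₀`,
that is, the pair (`factor_of_void`).

For `A ∪ B ∪ C = D` the marginal measure satisfies the standing assumptions again. The Poisson
lemmas are stated for arbitrary measurable maps on the underlying space, so they apply to the
original process directly. -/

/-! ### The function `x ↦ exp (-x)` on `[0, ∞]` -/

/-- `exp (-x)` for `x ∈ [0, ∞]`. -/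
noncomputable def expNeg (x : ℝ≥0∞) : ℝ≥0∞ := EReal.exp (-(x : EReal))

/-- `-log p` for `p ∈ [0, 1]`. -/
noncomputable def negLog (p : ℝ≥0∞) : ℝ≥0∞ := (-(ENNReal.log p)).toENNReal

lemma expNeg_zero : expNeg 0 = 1 := by simp [expNeg]

lemma expNeg_top : expNeg ∞ = 0 := by simp [expNeg]

lemma expNeg_le_one (x : ℝ≥0∞) : expNeg x ≤ 1 := by
  simp [expNeg, EReal.neg_le_zero, EReal.coe_ennreal_nonneg]

lemma expNeg_add (x y : ℝ≥0∞) : expNeg (x + y) = expNeg x * expNeg y := by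
  rw [expNeg, expNeg, expNeg, ← EReal.exp_add, EReal.coe_ennreal_add, EReal.neg_add, sub_eq_add_neg]
  · left; exact EReal.coe_ennreal_ne_bot x
  · right; exact EReal.coe_ennreal_ne_bot y

lemma expNeg_strictAnti : StrictAnti expNeg := by
  intro x y hxy
  simpa [expNeg, EReal.neg_lt_neg_iff] using hxy

lemma expNeg_injective : Function.Injective expNeg := expNeg_strictAnti.injective

lemma continuous_expNeg : Continuous expNeg :=
  ENNReal.continuous_exp.comp (continuous_neg.comp continuous_coe_ennreal_ereal)

lemma measurable_expNeg : Measurable expNeg := continuous_expNeg.measurable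

lemma measurable_negLog : Measurable negLog := by
  unfold negLog
  exact ENNReal.measurable_log.neg.ereal_toENNReal

lemma expNeg_negLog {p : ℝ≥0∞} (hp : p ≤ 1) : expNeg (negLog p) = p := by
  rw [expNeg, negLog, EReal.coe_toENNReal, neg_neg, ENNReal.exp_log]
  have := ENNReal.log_le_zero_iff.2 hp
  simpa using EReal.neg_le_neg_iff.2 this

lemma negLog_expNeg (x : ℝ≥0∞) : negLog (expNeg x) = x :=
  expNeg_injective (expNeg_negLog (expNeg_le_one x))

lemma negLog_one : negLog 1 = 0 := by simp [negLog]

lemma expNeg_sum {ι : Type*} (s : Finset ι) (x : ι → ℝ≥0∞) :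
    expNeg (∑ i ∈ s, x i) = ∏ i ∈ s, expNeg (x i) := by
  classical
  induction s using Finset.induction_on with
  | empty => simp [expNeg_zero]
  | insert a s ha ih => rw [Finset.sum_insert ha, Finset.prod_insert ha, expNeg_add, ih]

lemma expNeg_mul_natCast (a : ℝ≥0∞) (n : ℕ) : expNeg (a * n) = expNeg a ^ n := by
  induction n with
  | zero => simp [expNeg_zero]
  | succ n ih => rw [Nat.cast_succ, mul_add, mul_one, expNeg_add, ih, pow_succ]

lemma expNeg_coe (x : NNReal) : expNeg x = ENNReal.ofReal (Real.exp (-x)) := by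
  have : (-(((x : ℝ≥0∞)) : EReal)) = (((-x : ℝ)) : EReal) := by
    simp; rfl
  rw [expNeg, this, EReal.exp_coe]

/-! ### Multiplicative families determine finite measures -/

section Mult

variable {M : Type*} [mM : MeasurableSpace M]

open BoundedContinuousFunction in
/-- Finite measures on a finite-dimensional unit cube with the same moments agree. -/
lemma measure_cube_ext {I : Type*} [Fintype I] {P P' : Measure (I → unitInterval)}
    [IsFiniteMeasure P] [IsFiniteMeasure P']
    (h : ∀ n : I → ℕ, ∫ x, ∏ i, ((x i : ℝ)) ^ n i ∂P = ∫ x, ∏ i, ((x i : ℝ)) ^ n i ∂P') :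
    P = P' := by
  classical
  let c : I → ((I → unitInterval) →ᵇ ℝ) := fun i =>
    BoundedContinuousFunction.mkOfCompact ⟨fun x => (x i : ℝ), by fun_prop⟩
  have hstar : ∀ a : (I → unitInterval) →ᵇ ℝ, star a = a := fun a => by ext; simp
  let A : StarSubalgebra ℝ ((I → unitInterval) →ᵇ ℝ) :=
    { Algebra.adjoin ℝ (Set.range c) with star_mem' := fun {a} ha => (hstar a).symm ▸ ha }
  refine ext_of_forall_mem_subalgebra_integral_eq_of_polish (𝕜 := ℝ) (A := A) ?_ ?_
  · intro x y hxy
    obtain ⟨i, hi⟩ := Function.ne_iff.1 hxy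
    refine ⟨c i, ⟨_, ⟨c i, Algebra.subset_adjoin ⟨i, rfl⟩, rfl⟩, rfl⟩, ?_⟩
    intro h
    exact hi (Subtype.ext h)
  · intro g hg
    have hg' : g ∈ Subalgebra.toSubmodule (Algebra.adjoin ℝ (Set.range c)) := hg
    -- The algebra generated by the coordinates separates points and is spanned by monomials, so
    -- equality of moments extends to it by linearity.
    rw [Algebra.adjoin_eq_span] at hg'
    induction hg' using Submodule.span_induction with
    | mem g hg =>
      have : ∃ n : I → ℕ, ∀ x, g x = ∏ i, ((x i : ℝ)) ^ n i := by
        clear hg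
        rename_i hg
        induction hg using Submonoid.closure_induction with
        | mem g hg =>
          obtain ⟨i, rfl⟩ := hg
          refine ⟨fun j => if j = i then 1 else 0, fun x => ?_⟩
          simp [c, pow_ite]
        | one => exact ⟨0, by simp⟩
        | mul a b _ _ ha hb =>
          obtain ⟨n, hn⟩ := ha
          obtain ⟨m, hm⟩ := hb
          exact ⟨n + m, fun x => by simp [hn, hm, pow_add, Finset.prod_mul_distrib]⟩
      obtain ⟨n, hn⟩ := this
      simp_rw [hn]
      exact h n
    | zero => simp
    | add a b ha hb iha ihb =>
      have e : ∀ f ∈ Submodule.span ℝ (↑(Submonoid.closure (Set.range c)) : Set _), f ∈ A := by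
        intro f hf
        rw [← Algebra.adjoin_eq_span] at hf
        exact hf
      simp only [BoundedContinuousFunction.coe_add, Pi.add_apply]
      rw [integral_add (a.integrable _) (b.integrable _), integral_add (a.integrable _) (b.integrable _),
        iha (e _ ha), ihb (e _ hb)]
    | smul r a ha iha =>
      have e : ∀ f ∈ Submodule.span ℝ (↑(Submonoid.closure (Set.range c)) : Set _), f ∈ A := by
        intro f hf
        rw [← Algebra.adjoin_eq_span] at hf
        exact hf
      simp only [BoundedContinuousFunction.coe_smul, smul_eq_mul]
      rw [integral_const_mul, integral_const_mul, iha (e _ ha)]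

/-- Finite measures which agree on a family of `[0,1]`-valued functions that is closed under
products agree on the generated σ-field. -/
lemma measure_ext_of_multiplicative {μ ν : Measure M} [IsFiniteMeasure μ] [IsFiniteMeasure ν]
    (K : Set (M → ℝ≥0∞)) (hm : ∀ k ∈ K, Measurable k) (h1 : ∀ k ∈ K, ∀ x, k x ≤ 1)
    (hone : (fun _ => 1) ∈ K) (hmul : ∀ k ∈ K, ∀ l ∈ K, (fun x => k x * l x) ∈ K)
    (hgen : mM ≤ MeasurableSpace.comap (fun x (k : K) => k.1 x) MeasurableSpace.pi)
    (h : ∀ k ∈ K, ∫⁻ x, k x ∂μ = ∫⁻ x, k x ∂ν) : μ = ν := by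
  classical
  let Φ : M → K → unitInterval := fun x k => ⟨(k.1 x).toReal, ENNReal.toReal_nonneg,
    ENNReal.toReal_mono ENNReal.one_ne_top (h1 _ k.2 x)⟩
  have hΦ : Measurable Φ := measurable_pi_lambda _ fun k =>
    Measurable.subtype_mk (hm _ k.2).ennreal_toReal
  have hpow : ∀ k ∈ K, ∀ n : ℕ, (fun x => k x ^ n) ∈ K := by
    intro k hk n
    induction n with
    | zero => simpa using hone
    | succ n ih => simpa [pow_succ] using hmul _ ih _ hk
  have hprod : ∀ (I : Finset K) (n : K → ℕ), (fun x => ∏ i ∈ I, (i.1 x) ^ n i) ∈ K := by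
    intro I n
    induction I using Finset.induction_on with
    | empty => simpa using hone
    | insert a s ha ih => simpa [Finset.prod_insert ha] using hmul _ (hpow _ a.2 (n a)) _ ih
  have key : μ.map Φ = ν.map Φ := by
    have : IsFiniteMeasure (μ.map Φ) := Measure.isFiniteMeasure_map _ _
    have : IsFiniteMeasure (ν.map Φ) := Measure.isFiniteMeasure_map _ _
    -- A law on the cube `[0,1]^K` is determined by its finite-dimensional marginals, and their
    -- moments are integrals of members of `K` because `K` is closed under products.
    refine IsProjectiveLimit.unique (P := fun I : Finset K => (ν.map Φ).map I.restrict) ?_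
      (fun I => rfl)
    intro I
    beta_reduce
    rw [Measure.map_map (by fun_prop) hΦ, Measure.map_map (by fun_prop) hΦ]
    have hI : Measurable (I.restrict ∘ Φ) := (by fun_prop : Measurable (I.restrict (π := fun _ : K => unitInterval))).comp hΦ
    have := Measure.isFiniteMeasure_map μ (I.restrict ∘ Φ)
    have := Measure.isFiniteMeasure_map ν (I.restrict ∘ Φ)
    apply measure_cube_ext
    intro n
    have hc : Continuous fun x : I → unitInterval => ∏ i, ((x i : ℝ)) ^ n i := by fun_prop
    rw [integral_map hI.aemeasurable hc.aestronglyMeasurable, integral_map hI.aemeasurable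
      hc.aestronglyMeasurable]
    let n' : K → ℕ := fun k => if hk : k ∈ I then n ⟨k, hk⟩ else 0
    have e : ∀ x, ∏ i, (((I.restrict ∘ Φ) x i : ℝ)) ^ n i = (∏ i ∈ I, (i.1 x) ^ n' i).toReal := by
      intro x
      rw [ENNReal.toReal_prod, ← Finset.prod_coe_sort I]
      refine Finset.prod_congr rfl fun i _ => ?_
      simp [n', Φ]
    simp_rw [e]
    have hmK := hprod I n'
    rw [integral_toReal (hm _ hmK).aemeasurable, integral_toReal (hm _ hmK).aemeasurable,
      h _ hmK] <;>
    exact Filter.Eventually.of_forall fun x => (h1 _ hmK x).trans_lt ENNReal.one_lt_top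
  ext s hs
  obtain ⟨t, ht, rfl⟩ := hgen s hs
  -- `Ψ` undoes the passage to real values, so that each set of the generated σ-field is a preimage
  -- under `Φ`.
  let Ψ : (K → unitInterval) → K → ℝ≥0∞ := fun y k => ENNReal.ofReal (y k : ℝ)
  have hΨ : Measurable Ψ := by
    refine measurable_pi_lambda _ fun k => ?_
    exact (measurable_subtype_coe.comp (measurable_pi_apply k)).ennreal_ofReal
  have e : (fun x (k : K) => k.1 x) ⁻¹' t = Φ ⁻¹' (Ψ ⁻¹' t) := by
    have : (fun x (k : K) => k.1 x) = Ψ ∘ Φ := by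
      funext x k
      simp [Ψ, Φ, ENNReal.ofReal_toReal ((h1 _ k.2 x).trans_lt ENNReal.one_lt_top).ne]
    rw [this]; rfl
  rw [e, ← Measure.map_apply hΦ (hΨ ht), ← Measure.map_apply hΦ (hΨ ht), key]

end Mult

/-! ### Laplace functionals -/

section Laplace

variable {α β : Type*} [MeasurableSpace α] [MeasurableSpace β]

/-- The joint Laplace functional determines a finite measure on pairs of measures. -/
lemma measure_pair_ext_of_laplace {μ ν : Measure (Measure α × Measure β)} [IsFiniteMeasure μ]
    [IsFiniteMeasure ν]
    (h : ∀ (f : α → ℝ≥0∞) (g : β → ℝ≥0∞), Measurable f → Measurable g →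
      ∫⁻ p, expNeg (∫⁻ x, f x ∂p.1) * expNeg (∫⁻ x, g x ∂p.2) ∂μ =
      ∫⁻ p, expNeg (∫⁻ x, f x ∂p.1) * expNeg (∫⁻ x, g x ∂p.2) ∂ν) : μ = ν := by
  let K : Set (Measure α × Measure β → ℝ≥0∞) := {k | ∃ (f : α → ℝ≥0∞) (g : β → ℝ≥0∞),
    Measurable f ∧ Measurable g ∧
      k = fun p => expNeg (∫⁻ x, f x ∂p.1) * expNeg (∫⁻ x, g x ∂p.2)}
  refine measure_ext_of_multiplicative K ?_ ?_ ?_ ?_ ?_ ?_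
  · rintro k ⟨f, g, hf, hg, rfl⟩
    exact (measurable_expNeg.comp ((Measure.measurable_lintegral hf).comp measurable_fst)).mul
      (measurable_expNeg.comp ((Measure.measurable_lintegral hg).comp measurable_snd))
  · rintro k ⟨f, g, hf, hg, rfl⟩ p
    exact mul_le_one' (expNeg_le_one _) (expNeg_le_one _)
  · exact ⟨0, 0, measurable_const, measurable_const, by simp [expNeg_zero]⟩
  · rintro k ⟨f, g, hf, hg, rfl⟩ l ⟨f', g', hf', hg', rfl⟩
    refine ⟨f + f', g + g', hf.add hf', hg.add hg', ?_⟩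
    funext p
    simp only [Pi.add_apply]
    rw [lintegral_add_left hf, lintegral_add_left hg, expNeg_add, expNeg_add]
    ring
  · set m' : MeasurableSpace (Measure α × Measure β) :=
      MeasurableSpace.comap (fun x (k : K) => k.1 x) MeasurableSpace.pi with hm'
    have hK : ∀ k ∈ K, @Measurable _ _ m' _ k := by
      intro k hk
      exact (measurable_pi_apply (X := fun _ : K => ℝ≥0∞) ⟨k, hk⟩).comp (comap_measurable _)
    have h1 : @Measurable _ _ m' _ (Prod.fst : Measure α × Measure β → Measure α) := by
      refine Measure.measurable_of_measurable_coe _ fun s hs => ?_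
      -- With the indicator of `s` as test function the member of `K` is `exp (-m s)`; `negLog`
      -- recovers the evaluation `m s`, infinite values included.
      have := hK _ ⟨s.indicator 1, 0, measurable_one.indicator hs, measurable_const, rfl⟩
      have := measurable_negLog.comp this
      convert! this using 1
      funext p
      simp [expNeg_zero, negLog_expNeg, lintegral_indicator_one hs]
    have h2 : @Measurable _ _ m' _ (Prod.snd : Measure α × Measure β → Measure β) := by
      refine Measure.measurable_of_measurable_coe _ fun s hs => ?_
      have := hK _ ⟨0, s.indicator 1, measurable_const, measurable_one.indicator hs, rfl⟩
      have := measurable_negLog.comp this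
      convert! this using 1
      funext p
      simp [expNeg_zero, negLog_expNeg, lintegral_indicator_one hs]
    exact sup_le (measurable_iff_comap_le.1 h1) (measurable_iff_comap_le.1 h2)
  · rintro k ⟨f, g, hf, hg, rfl⟩
    exact h f g hf hg

/-- The Laplace functional determines a finite measure on the space of measures. -/
lemma measure_ext_of_laplace {μ ν : Measure (Measure α)} [IsFiniteMeasure μ] [IsFiniteMeasure ν]
    (h : ∀ f : α → ℝ≥0∞, Measurable f →
      ∫⁻ m, expNeg (∫⁻ x, f x ∂m) ∂μ = ∫⁻ m, expNeg (∫⁻ x, f x ∂m) ∂ν) : μ = ν := by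
  -- Pairing with the zero measure reduces the claim to the joint functional, since the second
  -- factor becomes `1`.
  let i : Measure α → Measure α × Measure α := fun m => (m, 0)
  have hi : Measurable i := by fun_prop
  have hfst : ∀ ρ : Measure (Measure α), (ρ.map i).map Prod.fst = ρ := by
    intro ρ
    rw [Measure.map_map measurable_fst hi]
    exact Measure.map_id
  have := Measure.isFiniteMeasure_map μ i
  have := Measure.isFiniteMeasure_map ν i
  rw [← hfst μ, ← hfst ν]
  congr 1
  apply measure_pair_ext_of_laplace
  intro f g hf hg
  have hm : Measurable fun p : Measure α × Measure α =>
      expNeg (∫⁻ x, f x ∂p.1) * expNeg (∫⁻ x, g x ∂p.2) :=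
    (measurable_expNeg.comp ((Measure.measurable_lintegral hf).comp measurable_fst)).mul
      (measurable_expNeg.comp ((Measure.measurable_lintegral hg).comp measurable_snd))
  rw [lintegral_map hm hi, lintegral_map hm hi]
  simpa [i, expNeg_zero] using h f hf

end Laplace

/-! ### The Laplace functional of a Poisson process -/

lemma lintegral_pow_poissonMeasure (r : NNReal) {p : ℝ≥0∞} (hp : p ≤ 1) :
    ∫⁻ n : ℕ, p ^ n ∂(poissonMeasure r) = expNeg (r * (1 - p)) := by
  have hpt : p ≠ ∞ := (hp.trans_lt ENNReal.one_lt_top).ne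
  lift p to NNReal using hpt
  have hp' : p ≤ 1 := by exact_mod_cast hp
  rw [poissonMeasure, lintegral_sum_measure]
  simp only [lintegral_smul_measure, lintegral_dirac, smul_eq_mul]
  have e : ∀ n : ℕ, ENNReal.ofReal (Real.exp (-r) * r ^ n / n.factorial) * (p : ℝ≥0∞) ^ n =
      ENNReal.ofReal (Real.exp (-r) * ((r * p : ℝ) ^ n / n.factorial)) := by
    intro n
    rw [← ENNReal.ofReal_coe_nnreal, ← ENNReal.ofReal_pow (NNReal.coe_nonneg p), ← ENNReal.ofReal_mul (by positivity)]
    congr 1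
    rw [mul_pow]; ring
  simp_rw [e]
  have hs := (NormedSpace.expSeries_div_hasSum_exp ((r * p : ℝ))).mul_left (Real.exp (-r))
  rw [← ENNReal.ofReal_tsum_of_nonneg (fun n => by positivity) hs.summable, hs.tsum_eq,
    ← Real.exp_eq_exp_ℝ, ← Real.exp_add]
  have : (r : ℝ≥0∞) * (1 - (p : ℝ≥0∞)) = ((r * (1 - p) : NNReal) : ℝ≥0∞) := by push_cast; rfl
  rw [this, expNeg_coe]
  congr 2
  rw [NNReal.coe_mul, NNReal.coe_sub hp']
  push_cast
  ring

lemma one_sub_expNeg_eq_zero {a : ℝ≥0∞} : 1 - expNeg a = 0 ↔ a = 0 := by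
  rw [tsub_eq_zero_iff_le]
  constructor
  · intro h
    exact expNeg_injective ((le_antisymm (expNeg_le_one a) h).trans expNeg_zero.symm)
  · rintro rfl
    rw [expNeg_zero]

namespace PuncturedCI.IsPoissonProcess

variable {Ω S : Type*} [MeasurableSpace Ω] [MeasurableSpace S] {ξ : Ω → Measure S}
  {Λ : Measure S} {P : Measure Ω} [IsProbabilityMeasure P]

/-- For finite mean this is the Poisson generating function at `exp (-a)`; for infinite mean `ξ G =
∞` almost surely and both sides degenerate together. The value `a = ∞` is allowed and is needed
later for void events. -/
lemma lintegral_expNeg_mul (hξ : IsPoissonProcess ξ Λ P) (a : ℝ≥0∞) {G : Set S}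
    (hG : MeasurableSet G) :
    ∫⁻ ω, expNeg (a * ξ ω G) ∂P = expNeg ((1 - expNeg a) * Λ G) := by
  by_cases hf : Λ G = ∞
  · have : ∫⁻ ω, expNeg (a * ξ ω G) ∂P = ∫⁻ ω, expNeg (a * ∞) ∂P := by
      refine lintegral_congr_ae ?_
      filter_upwards [hξ.law_of_infinite G hG hf] with ω hω
      rw [hω]
    rw [this, hf, lintegral_const, measure_univ, mul_one]
    by_cases ha : a = 0
    · simp [ha, expNeg_zero]
    · rw [ENNReal.mul_top ha, ENNReal.mul_top (by rwa [Ne, one_sub_expNeg_eq_zero])]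
  · have hm : Measurable fun ω => ξ ω G := (Measure.measurable_coe hG).comp hξ.measurable
    have hm' : Measurable fun x : ℝ≥0∞ => expNeg (a * x) :=
      measurable_expNeg.comp (measurable_id.const_mul a)
    have : ∫⁻ ω, expNeg (a * ξ ω G) ∂P = ∫⁻ x, expNeg (a * x) ∂(P.map fun ω => ξ ω G) := by
      rw [lintegral_map hm' hm]
    rw [this, hξ.law_of_finite G hG hf, lintegral_map hm' (by fun_prop)]
    simp_rw [expNeg_mul_natCast]
    rw [lintegral_pow_poissonMeasure _ (expNeg_le_one a), ENNReal.coe_toNNReal hf, mul_comm]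

/-- The fibres of a simple function are disjoint, so the counts on them are independent and the
expectation of the product of exponentials splits. -/
lemma laplace_simpleFunc (hξ : IsPoissonProcess ξ Λ P) (u : SimpleFunc S ℝ≥0∞) :
    ∫⁻ ω, expNeg (∫⁻ x, u x ∂(ξ ω)) ∂P = expNeg (∫⁻ x, (1 - expNeg (u x)) ∂Λ) := by
  have e1 : ∀ ω, ∫⁻ x, u x ∂(ξ ω) = ∑ a ∈ u.range, a * ξ ω (u ⁻¹' {a}) := fun ω => by
    rw [SimpleFunc.lintegral_eq_lintegral]; rfl
  have e2 : ∫⁻ x, (1 - expNeg (u x)) ∂Λ = ∑ a ∈ u.range, (1 - expNeg a) * Λ (u ⁻¹' {a}) := by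
    rw [← SimpleFunc.map_lintegral, ← SimpleFunc.lintegral_eq_lintegral]; rfl
  simp_rw [e1, e2, expNeg_sum]
  let φ := u.range.equivFin
  have hind := hξ.indep _ (fun i => u ⁻¹' {(φ.symm i : ℝ≥0∞)})
    (fun i => u.measurableSet_fiber _) (by
      intro i j hij
      refine Disjoint.preimage _ ?_
      rw [Set.disjoint_singleton]
      exact fun h => hij (φ.symm.injective (Subtype.ext h)))
  have hind' := hind.comp (fun i x => expNeg ((φ.symm i : ℝ≥0∞) * x))
    (fun i => measurable_expNeg.comp (measurable_id.const_mul _))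
  have hm : ∀ G, MeasurableSet G → Measurable fun ω => ξ ω G := fun G hG =>
    (Measure.measurable_coe hG).comp hξ.measurable
  have := lintegral_prod_eq_prod_lintegral_of_indepFun Finset.univ _ hind'
    (fun i => (measurable_expNeg.comp (measurable_id.const_mul _)).comp
      (hm _ (u.measurableSet_fiber _)))
  have e3 : ∀ F : ℝ≥0∞ → ℝ≥0∞, ∏ a ∈ u.range, F a = ∏ i, F (φ.symm i) := by
    intro F
    rw [← Finset.prod_coe_sort]
    exact (Equiv.prod_comp φ.symm (fun a => F a)).symm
  simp_rw [e3]
  refine this.trans (Finset.prod_congr rfl fun i _ => ?_)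
  exact hξ.lintegral_expNeg_mul _ (u.measurableSet_fiber _)

/-- The Laplace functional of a Poisson process. -/
theorem laplace (hξ : IsPoissonProcess ξ Λ P) {u : S → ℝ≥0∞} (hu : Measurable u) :
    ∫⁻ ω, expNeg (∫⁻ x, u x ∂(ξ ω)) ∂P = expNeg (∫⁻ x, (1 - expNeg (u x)) ∂Λ) := by
  have hmono : ∀ x, Monotone fun n => SimpleFunc.eapprox u n x := fun x n m hnm =>
    SimpleFunc.monotone_eapprox u hnm x
  have hl : ∀ m : Measure S, Filter.Tendsto (fun n => ∫⁻ x, SimpleFunc.eapprox u n x ∂m)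
      Filter.atTop (nhds (∫⁻ x, u x ∂m)) := fun m =>
    lintegral_tendsto_of_tendsto_of_monotone (fun n => (SimpleFunc.measurable _).aemeasurable)
      (Filter.Eventually.of_forall hmono)
      (Filter.Eventually.of_forall fun x => SimpleFunc.tendsto_eapprox hu x)
  -- The left side converges by domination by `1`, the right side by monotone convergence, as `1 -
  -- exp (-u)` increases with `u`.
  have h1 : Filter.Tendsto (fun n => ∫⁻ ω, expNeg (∫⁻ x, SimpleFunc.eapprox u n x ∂(ξ ω)) ∂P)
      Filter.atTop (nhds (∫⁻ ω, expNeg (∫⁻ x, u x ∂(ξ ω)) ∂P)) := by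
    refine tendsto_lintegral_of_dominated_convergence (fun _ => 1) (fun n => ?_)
      (fun n => Filter.Eventually.of_forall fun ω => expNeg_le_one _) (by simp)
      (Filter.Eventually.of_forall fun ω => (continuous_expNeg.tendsto _).comp (hl _))
    exact measurable_expNeg.comp
      ((Measure.measurable_lintegral (SimpleFunc.measurable _)).comp hξ.measurable)
  have h2 : Filter.Tendsto (fun n => ∫⁻ x, (1 - expNeg (SimpleFunc.eapprox u n x)) ∂Λ)
      Filter.atTop (nhds (∫⁻ x, (1 - expNeg (u x)) ∂Λ)) := by
    refine lintegral_tendsto_of_tendsto_of_monotone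
      (fun n => (measurable_const.sub
        (measurable_expNeg.comp (SimpleFunc.measurable _))).aemeasurable)
      (Filter.Eventually.of_forall fun x n m hnm =>
        tsub_le_tsub_left (expNeg_strictAnti.antitone (hmono x hnm)) _)
      (Filter.Eventually.of_forall fun x => ?_)
    exact ENNReal.Tendsto.sub tendsto_const_nhds
      ((continuous_expNeg.tendsto _).comp (SimpleFunc.tendsto_eapprox hu x)) (by simp)
  simp_rw [hξ.laplace_simpleFunc] at h1
  exact tendsto_nhds_unique h1 ((continuous_expNeg.tendsto _).comp h2)

end PuncturedCI.IsPoissonProcess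

/-! ### Conditional independence in terms of conditional densities -/

section CI

variable {Ω α β γ : Type*} [MeasurableSpace Ω] [MeasurableSpace α] [MeasurableSpace β]
  [MeasurableSpace γ] {X : Ω → α} {Y : Ω → β} {Z : Ω → γ} {m : Measure Ω}

/-- `a ∘ Z` is a version of the conditional probability of `s` given `Z` under `m`. -/
def IsVersion (a : γ → ℝ≥0∞) (s : Set Ω) (Z : Ω → γ) (m : Measure Ω) : Prop :=
  (m.restrict s).map Z = (m.map Z).withDensity a

/-- Conditional independence of `X` and `Y` given `Z` under a finite measure. -/
def CondIndepUnder (X : Ω → α) (Y : Ω → β) (Z : Ω → γ) (m : Measure Ω) : Prop :=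
  ∀ s t, MeasurableSet s → MeasurableSet t → ∃ a b : γ → ℝ≥0∞, Measurable a ∧ Measurable b ∧
    IsVersion a (X ⁻¹' s) Z m ∧ IsVersion b (Y ⁻¹' t) Z m ∧
    IsVersion (fun z => a z * b z) (X ⁻¹' s ∩ Y ⁻¹' t) Z m

lemma isVersion_iff (hZ : Measurable Z) {a : γ → ℝ≥0∞} {s : Set Ω} :
    IsVersion a s Z m ↔
      ∀ u, MeasurableSet u → m (s ∩ Z ⁻¹' u) = ∫⁻ z in u, a z ∂(m.map Z) := by
  rw [IsVersion, Measure.ext_iff]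
  refine forall₂_congr fun u hu => ?_
  rw [Measure.map_apply hZ hu, Measure.restrict_apply (hZ hu), withDensity_apply _ hu,
    Set.inter_comm]

lemma exists_isVersion [IsFiniteMeasure m] (Z : Ω → γ) (hZ : Measurable Z) (s : Set Ω) :
    ∃ a : γ → ℝ≥0∞, Measurable a ∧ IsVersion a s Z m := by
  have hf : IsFiniteMeasure (m.map Z) := Measure.isFiniteMeasure_map _ _
  have hf' : IsFiniteMeasure ((m.restrict s).map Z) := Measure.isFiniteMeasure_map _ _
  refine ⟨((m.restrict s).map Z).rnDeriv (m.map Z), Measure.measurable_rnDeriv _ _, ?_⟩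
  rw [IsVersion, Measure.withDensity_rnDeriv_eq]
  exact (Measure.absolutelyContinuous_of_le Measure.restrict_le_self).map hZ

lemma IsVersion.ae_eq [IsFiniteMeasure m] {a b : γ → ℝ≥0∞} {s : Set Ω} (ha : Measurable a)
    (hb : Measurable b) (h : IsVersion a s Z m) (h' : IsVersion b s Z m) :
    a =ᵐ[m.map Z] b := by
  have hf : IsFiniteMeasure (m.map Z) := Measure.isFiniteMeasure_map _ _
  exact (withDensity_eq_iff_of_sigmaFinite ha.aemeasurable hb.aemeasurable).1 (h.symm.trans h')

lemma IsVersion.congr {a b : γ → ℝ≥0∞} {s : Set Ω} (h : IsVersion a s Z m)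
    (hab : a =ᵐ[m.map Z] b) : IsVersion b s Z m := by
  rw [IsVersion, ← withDensity_congr_ae hab]
  exact h

/-- Versions are almost everywhere unique, so the product formula holds for any chosen versions and
not only for those provided by the definition. -/
lemma CondIndepUnder.isVersion_mul [IsFiniteMeasure m] (h : CondIndepUnder X Y Z m)
    {s : Set α} {t : Set β} (hs : MeasurableSet s) (ht : MeasurableSet t) {a b : γ → ℝ≥0∞}
    (ha : Measurable a) (hb : Measurable b) (hav : IsVersion a (X ⁻¹' s) Z m)
    (hbv : IsVersion b (Y ⁻¹' t) Z m) :
    IsVersion (fun z => a z * b z) (X ⁻¹' s ∩ Y ⁻¹' t) Z m := by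
  obtain ⟨a', b', ha', hb', hav', hbv', h'⟩ := h s t hs ht
  refine h'.congr ?_
  filter_upwards [hav.ae_eq ha ha' hav', hbv.ae_eq hb hb' hbv'] with z h1 h2
  rw [h1, h2]

lemma IsVersion.le_one [IsFiniteMeasure m] (hZ : Measurable Z) {a : γ → ℝ≥0∞} {s : Set Ω}
    (h : IsVersion a s Z m) (ha : Measurable a) : ∀ᵐ z ∂(m.map Z), a z ≤ 1 := by
  have hf : IsFiniteMeasure (m.map Z) := Measure.isFiniteMeasure_map _ _
  refine ae_le_of_forall_setLIntegral_le_of_sigmaFinite ha fun u hu _ => ?_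
  rw [← (isVersion_iff hZ).1 h u hu]
  simp only [lintegral_const, one_mul, Measure.restrict_apply MeasurableSet.univ, Set.univ_inter]
  rw [Measure.map_apply hZ hu]
  exact measure_mono Set.inter_subset_right

/-- This links densities in `[0, ∞]` to real conditional expectations. A version is at most `1`
almost everywhere, so `toReal` loses nothing. -/
lemma IsVersion.condExp [IsFiniteMeasure m] (hZ : Measurable Z) {a : γ → ℝ≥0∞} {s : Set Ω}
    (hs : MeasurableSet s) (h : IsVersion a s Z m) (ha : Measurable a) :
    m⟦s | MeasurableSpace.comap Z inferInstance⟧ =ᵐ[m] fun ω => (a (Z ω)).toReal := by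
  have hle := h.le_one hZ ha
  have hle' : ∀ᵐ ω ∂m, a (Z ω) ≤ 1 := ae_of_ae_map hZ.aemeasurable hle
  have hm : Measurable[MeasurableSpace.comap Z inferInstance] fun ω => (a (Z ω)).toReal :=
    ha.ennreal_toReal.comp (comap_measurable Z)
  have hint : Integrable (fun ω => (a (Z ω)).toReal) m := by
    refine Integrable.of_bound (hm.mono hZ.comap_le le_rfl).aestronglyMeasurable 1 ?_
    filter_upwards [hle'] with ω hω
    rw [Real.norm_of_nonneg ENNReal.toReal_nonneg]
    exact ENNReal.toReal_mono ENNReal.one_ne_top hω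
  symm
  refine ae_eq_condExp_of_forall_setIntegral_eq hZ.comap_le
    ((integrable_const (1 : ℝ)).indicator hs) (fun _ _ _ => hint.integrableOn) ?_
    hm.stronglyMeasurable.aestronglyMeasurable
  rintro _ ⟨u, hu, rfl⟩ _
  rw [integral_toReal (f := fun ω => a (Z ω)) (ha.comp hZ).aemeasurable
    ((ae_restrict_of_ae hle').mono fun ω hω => hω.trans_lt ENNReal.one_lt_top),
    integral_indicator hs, Measure.restrict_restrict hs]
  have e : ∫⁻ ω in Z ⁻¹' u, a (Z ω) ∂m = m (s ∩ Z ⁻¹' u) := by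
    rw [(isVersion_iff hZ).1 h u hu, setLIntegral_map hu ha hZ]
  rw [e]
  simp [Measure.real]

lemma condIndepGiven_iff [IsFiniteMeasure m] (hX : Measurable X) (hY : Measurable Y)
    (hZ : Measurable Z) : CondIndepGiven X Y Z m ↔ CondIndepUnder X Y Z m := by
  constructor
  · intro h s t hs ht
    obtain ⟨a, ha, hav⟩ := exists_isVersion (m := m) Z hZ (X ⁻¹' s)
    obtain ⟨b, hb, hbv⟩ := exists_isVersion (m := m) Z hZ (Y ⁻¹' t)
    obtain ⟨c, hc, hcv⟩ := exists_isVersion (m := m) Z hZ (X ⁻¹' s ∩ Y ⁻¹' t)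
    refine ⟨a, b, ha, hb, hav, hbv, hcv.congr ?_⟩
    have h1 := (hav.condExp hZ (hX hs) ha).symm
    have h2 := (hbv.condExp hZ (hY ht) hb).symm
    have h3 := (hcv.condExp hZ ((hX hs).inter (hY ht)) hc).symm
    have h4 := h3.trans ((h s t hs ht).trans (h1.symm.mul h2.symm))
    have e : ∀ᵐ ω ∂m, c (Z ω) = a (Z ω) * b (Z ω) := by
      filter_upwards [h4, ae_of_ae_map hZ.aemeasurable (hav.le_one hZ ha),
        ae_of_ae_map hZ.aemeasurable (hbv.le_one hZ hb),
        ae_of_ae_map hZ.aemeasurable (hcv.le_one hZ hc)] with ω hω ha1 hb1 hc1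
      have hab : a (Z ω) * b (Z ω) ≤ 1 := mul_le_one' ha1 hb1
      rw [← ENNReal.toReal_eq_toReal_iff' (hc1.trans_lt ENNReal.one_lt_top).ne
        (hab.trans_lt ENNReal.one_lt_top).ne, ENNReal.toReal_mul]
      exact hω
    exact (ae_map_iff hZ.aemeasurable (measurableSet_eq_fun hc (ha.mul hb))).2 e
  · intro h s t hs ht
    obtain ⟨a, b, ha, hb, hav, hbv, hv⟩ := h s t hs ht
    have h1 := hav.condExp hZ (hX hs) ha
    have h2 := hbv.condExp hZ (hY ht) hb
    have h3 := hv.condExp hZ ((hX hs).inter (hY ht)) (ha.mul hb)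
    refine h3.trans (Filter.EventuallyEq.trans ?_ (h1.mul h2).symm)
    exact Filter.Eventually.of_forall fun ω => ENNReal.toReal_mul

lemma CondIndepUnder.symm (h : CondIndepUnder X Y Z m) : CondIndepUnder Y X Z m := by
  intro s t hs ht
  obtain ⟨a, b, ha, hb, hav, hbv, hv⟩ := h t s ht hs
  refine ⟨b, a, hb, ha, hbv, hav, ?_⟩
  rw [Set.inter_comm]
  simpa only [mul_comm] using hv

lemma IsVersion.smul {a : γ → ℝ≥0∞} {s : Set Ω} (h : IsVersion a s Z m) (c : ℝ≥0∞) :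
    IsVersion a s Z (c • m) := by
  rw [IsVersion, Measure.restrict_smul, Measure.map_smul, Measure.map_smul, withDensity_smul_measure,
    h]

lemma CondIndepUnder.smul (h : CondIndepUnder X Y Z m) (c : ℝ≥0∞) :
    CondIndepUnder X Y Z (c • m) := by
  intro s t hs ht
  obtain ⟨a, b, ha, hb, hav, hbv, hv⟩ := h s t hs ht
  exact ⟨a, b, ha, hb, hav.smul c, hbv.smul c, hv.smul c⟩

/-- Versions are unaffected by scaling the measure, so the normalization of the conditioned measure
can be dropped. -/
lemma condIndepGiven_cond_iff {R : Set Ω} (hR : m R ≠ 0) (hR' : m R ≠ ∞) (hX : Measurable X)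
    (hY : Measurable Y) (hZ : Measurable Z) :
    CondIndepGiven X Y Z (cond m R) ↔ CondIndepUnder X Y Z (m.restrict R) := by
  have hp := cond_isProbabilityMeasure_of_finite hR hR'
  rw [condIndepGiven_iff hX hY hZ]
  constructor
  · intro h
    have := h.smul (m R)
    rwa [ProbabilityTheory.cond, smul_smul, ENNReal.mul_inv_cancel hR hR', one_smul] at this
  · intro h
    exact h.smul _

open Classical in
lemma IsVersion.piecewise (hZ : Measurable Z) {a b : γ → ℝ≥0∞} {s : Set Ω}
    {U : Set γ} (hU : MeasurableSet U)
    (h : IsVersion a s Z (m.restrict (Z ⁻¹' U))) (h' : IsVersion b s Z (m.restrict (Z ⁻¹' Uᶜ))) :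
    IsVersion (U.piecewise a b) s Z m := by
  rw [isVersion_iff hZ] at h h' ⊢
  intro u hu
  have h1 := h u hu
  have h2 := h' u hu
  rw [Measure.restrict_apply' (hZ hU), ← Measure.restrict_map hZ hU,
    Measure.restrict_restrict hu] at h1
  rw [Measure.restrict_apply' (hZ hU.compl), ← Measure.restrict_map hZ hU.compl,
    Measure.restrict_restrict hu] at h2
  rw [← measure_inter_add_sdiff (s ∩ Z ⁻¹' u) (hZ hU), ← lintegral_inter_add_sdiff _ _ hU,
    Set.sdiff_eq, ← Set.preimage_compl, h1, h2]
  congr 1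
  · exact setLIntegral_congr_fun (hu.inter hU) fun z hz => (Set.piecewise_eq_of_mem _ _ _ hz.2).symm
  · exact setLIntegral_congr_fun (hu.inter hU.compl)
      fun z hz => (Set.piecewise_eq_of_notMem _ _ _ hz.2).symm

open Classical in
/-- Conditional independence given `Z` may be checked separately on the two parts of a
`Z`-measurable partition. -/
lemma CondIndepUnder.of_restrict (hZ : Measurable Z) {U : Set γ} (hU : MeasurableSet U)
    (h : CondIndepUnder X Y Z (m.restrict (Z ⁻¹' U)))
    (h' : CondIndepUnder X Y Z (m.restrict (Z ⁻¹' Uᶜ))) : CondIndepUnder X Y Z m := by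
  intro s t hs ht
  obtain ⟨a, b, ha, hb, hav, hbv, hv⟩ := h s t hs ht
  obtain ⟨a', b', ha', hb', hav', hbv', hv'⟩ := h' s t hs ht
  refine ⟨U.piecewise a a', U.piecewise b b', ha.piecewise hU ha', hb.piecewise hU hb',
    hav.piecewise hZ hU hav', hbv.piecewise hZ hU hbv', ?_⟩
  convert! hv.piecewise hZ hU hv' using 1
  funext z
  by_cases hz : z ∈ U <;> simp [hz]

/-- When `Y` is almost surely constant, every event `{Y ∈ t}` is null or of full measure, with
version `0` or `1`. -/
lemma CondIndepUnder.of_ae_const_right [IsFiniteMeasure m] (hZ : Measurable Z) {y₀ : β}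
    (h : ∀ᵐ ω ∂m, Y ω = y₀) : CondIndepUnder X Y Z m := by
  intro s t hs ht
  obtain ⟨a, ha, hav⟩ := exists_isVersion (m := m) Z hZ (X ⁻¹' s)
  by_cases hy : y₀ ∈ t
  · have e1 : Y ⁻¹' t =ᵐ[m] Set.univ :=
      Filter.eventuallyEq_set.2 (h.mono fun ω hω => by simp [hω, hy])
    have e2 : (X ⁻¹' s ∩ Y ⁻¹' t : Set Ω) =ᵐ[m] X ⁻¹' s :=
      Filter.eventuallyEq_set.2 (h.mono fun ω hω => by simp [hω, hy])
    refine ⟨a, fun _ => 1, ha, measurable_const, hav, ?_, ?_⟩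
    · rw [IsVersion, Measure.restrict_congr_set e1, Measure.restrict_univ]
      exact withDensity_one.symm
    · simp only [mul_one]
      rw [IsVersion, Measure.restrict_congr_set e2]
      exact hav
  · have e1 : Y ⁻¹' t =ᵐ[m] (∅ : Set Ω) :=
      Filter.eventuallyEq_set.2 (h.mono fun ω hω => by simp [hω, hy])
    have e2 : (X ⁻¹' s ∩ Y ⁻¹' t : Set Ω) =ᵐ[m] (∅ : Set Ω) :=
      Filter.eventuallyEq_set.2 (h.mono fun ω hω => by simp [hω, hy])
    refine ⟨a, fun _ => 0, ha, measurable_const, hav, ?_, ?_⟩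
    · rw [IsVersion, Measure.restrict_congr_set e1, Measure.restrict_empty, Measure.map_zero]
      exact withDensity_zero.symm
    · rw [IsVersion, Measure.restrict_congr_set e2, Measure.restrict_empty, Measure.map_zero]
      simp only [mul_zero]
      exact withDensity_zero.symm

lemma isVersion_of_withDensity (hZ : Measurable Z) {ν : Measure γ} {w a : γ → ℝ≥0∞} {s : Set Ω}
    (hw : Measurable w) (ha : Measurable a) (hm : m.map Z = ν.withDensity w)
    (h : ∀ u, MeasurableSet u → m (s ∩ Z ⁻¹' u) = ∫⁻ z in u, w z * a z ∂ν) :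
    IsVersion a s Z m := by
  rw [isVersion_iff hZ, hm]
  intro u hu
  rw [h u hu, setLIntegral_withDensity_eq_setLIntegral_mul _ hw ha hu]
  rfl

/-- Conditional independence for a mixture of product measures. -/
lemma CondIndepUnder.of_mixture (hZ : Measurable Z)
    (ν : Measure γ) (κ : Kernel γ α) (η : Kernel γ β) [IsFiniteKernel κ] [IsFiniteKernel η]
    (h : ∀ s t u, MeasurableSet s → MeasurableSet t → MeasurableSet u →
      m (X ⁻¹' s ∩ Y ⁻¹' t ∩ Z ⁻¹' u) = ∫⁻ z in u, κ z s * η z t ∂ν) :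
    CondIndepUnder X Y Z m := by
  intro s t hs ht
  have k1 : Measurable fun z => κ z Set.univ := κ.measurable_coe MeasurableSet.univ
  have k2 : Measurable fun z => η z Set.univ := η.measurable_coe MeasurableSet.univ
  have k3 : Measurable fun z => κ z s := κ.measurable_coe hs
  have k4 : Measurable fun z => η z t := η.measurable_coe ht
  have hmap : m.map Z = ν.withDensity fun z => κ z Set.univ * η z Set.univ := by
    ext u hu
    rw [Measure.map_apply hZ hu, withDensity_apply _ hu, ← h _ _ _ MeasurableSet.univ
      MeasurableSet.univ hu]
    simp
  -- The law of `Z` has density `κ z univ * η z univ`, so conditional probabilities are ratios; the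
  -- division is harmless because a vanishing total mass forces the numerator to vanish.
  have e1 : ∀ z, κ z Set.univ * (κ z s / κ z Set.univ) = κ z s := fun z =>
    ENNReal.mul_div_cancel' (fun h0 => measure_mono_null (Set.subset_univ s) h0)
      (fun ht => absurd ht (measure_ne_top _ _))
  have e2 : ∀ z, η z Set.univ * (η z t / η z Set.univ) = η z t := fun z =>
    ENNReal.mul_div_cancel' (fun h0 => measure_mono_null (Set.subset_univ t) h0)
      (fun ht => absurd ht (measure_ne_top _ _))
  refine ⟨fun z => κ z s / κ z Set.univ, fun z => η z t / η z Set.univ, k3.div k1, k4.div k2,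
    ?_, ?_, ?_⟩
  · refine isVersion_of_withDensity hZ (k1.mul k2) (k3.div k1) hmap fun u hu => ?_
    have := h s Set.univ u hs MeasurableSet.univ hu
    rw [Set.preimage_univ, Set.inter_univ] at this
    rw [this]
    refine lintegral_congr fun z => ?_
    simp only [Pi.mul_apply]
    rw [mul_right_comm, e1]
  · refine isVersion_of_withDensity hZ (k1.mul k2) (k4.div k2) hmap fun u hu => ?_
    have := h Set.univ t u MeasurableSet.univ ht hu
    rw [Set.preimage_univ, Set.univ_inter] at this
    rw [this]
    refine lintegral_congr fun z => ?_
    simp only [Pi.mul_apply]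
    rw [mul_assoc, e2]
  · refine isVersion_of_withDensity hZ (k1.mul k2) ((k3.div k1).mul (k4.div k2)) hmap
      fun u hu => ?_
    rw [h s t u hs ht hu]
    refine lintegral_congr fun z => ?_
    simp only [Pi.mul_apply]
    rw [mul_mul_mul_comm, e1, e2]

lemma isVersion_const_of_ae_const [IsProbabilityMeasure m] (hZ : Measurable Z) {z₀ : γ}
    (h : ∀ᵐ ω ∂m, Z ω = z₀) (s : Set Ω) : IsVersion (fun _ => m s) s Z m := by
  rw [isVersion_iff hZ]
  intro u hu
  rw [setLIntegral_const, Measure.map_apply hZ hu]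
  by_cases hz : z₀ ∈ u
  · have e : Z ⁻¹' u =ᵐ[m] Set.univ :=
      Filter.eventuallyEq_set.2 (h.mono fun ω hω => by simp [hω, hz])
    have e' : (s ∩ Z ⁻¹' u : Set Ω) =ᵐ[m] s :=
      Filter.eventuallyEq_set.2 (h.mono fun ω hω => by simp [hω, hz])
    rw [measure_congr e, measure_congr e', measure_univ, mul_one]
  · have e : Z ⁻¹' u =ᵐ[m] (∅ : Set Ω) :=
      Filter.eventuallyEq_set.2 (h.mono fun ω hω => by simp [hω, hz])
    have e' : (s ∩ Z ⁻¹' u : Set Ω) =ᵐ[m] (∅ : Set Ω) :=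
      Filter.eventuallyEq_set.2 (h.mono fun ω hω => by simp [hω, hz])
    rw [measure_congr e, measure_congr e', measure_empty, mul_zero]

/-- Conditional independence given a degenerate random element is independence. -/
lemma condIndepUnder_iff_indepFun [IsProbabilityMeasure m] (hZ : Measurable Z) {z₀ : γ}
    (h : ∀ᵐ ω ∂m, Z ω = z₀) : CondIndepUnder X Y Z m ↔ IndepFun X Y m := by
  rw [indepFun_iff_measure_inter_preimage_eq_mul]
  constructor
  · intro hc s t hs ht
    have := hc.isVersion_mul hs ht measurable_const measurable_const
      (isVersion_const_of_ae_const hZ h (X ⁻¹' s)) (isVersion_const_of_ae_const hZ h (Y ⁻¹' t))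
    have := (isVersion_iff hZ).1 this Set.univ MeasurableSet.univ
    simpa [Measure.map_apply hZ MeasurableSet.univ] using this
  · intro hi s t hs ht
    refine ⟨_, _, measurable_const, measurable_const,
      isVersion_const_of_ae_const hZ h (X ⁻¹' s), isVersion_const_of_ae_const hZ h (Y ⁻¹' t), ?_⟩
    rw [← hi s t hs ht]
    exact isVersion_const_of_ae_const hZ h _

/-- `Y_A ⊥ Y_B | Y_C` in the form that is uniform in the conditioning set. -/
lemma condIndepIndexed_iff {ι : Type*} {C : Finset ι} [IsProbabilityMeasure m] (hX : Measurable X)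
    (hY : Measurable Y) (hZ : Measurable Z) (hC : C = ∅ → ∃ z₀, ∀ᵐ ω ∂m, Z ω = z₀) :
    CondIndepIndexed C X Y Z m ↔ CondIndepUnder X Y Z m := by
  rcases C.eq_empty_or_nonempty with h | h
  · obtain ⟨z₀, hz⟩ := hC h
    rw [condIndepUnder_iff_indepFun hZ hz]
    simp [CondIndepIndexed, h]
  · rw [← condIndepGiven_iff hX hY hZ]
    simp [CondIndepIndexed, h, h.ne_empty]

end CI

/-! ### Disintegration away from a point -/

section Disintegration

variable {S α β γ : Type*} [MeasurableSpace S] [MeasurableSpace α] [MeasurableSpace β]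
  [MeasurableSpace γ] [MeasurableSingletonClass γ] {X : S → α} {Y : S → β} {Z : S → γ}
  {Λ : Measure S} {x₀ : α} {y₀ : β} {z₀ : γ} {κ : Kernel γ (α × β)}

/-- `κ` disintegrates `Λ` over the values `z ≠ z₀` of `Z`. -/
def Disintegrates (Λ : Measure S) (X : S → α) (Y : S → β) (Z : S → γ) (z₀ : γ)
    (κ : Kernel γ (α × β)) : Prop :=
  ∀ Φ : γ × α × β → ℝ≥0∞, Measurable Φ →
    ∫⁻ s in Z ⁻¹' {z₀}ᶜ, Φ (Z s, X s, Y s) ∂Λ =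
      ∫⁻ z in {z₀}ᶜ, ∫⁻ w, Φ (z, w) ∂(κ z) ∂(Λ.map Z)

/-- The increasing sets `T h` exhaust the complement of `x₀` and have finite measure. -/
structure Exhausts (T : ℕ → Set α) (x₀ : α) (μ : Measure α) : Prop where
  measurableSet : ∀ h, MeasurableSet (T h)
  mono : Monotone T
  iUnion : ⋃ h, T h = {x₀}ᶜ
  lt_top : ∀ h, μ (T h) < ∞

/-- Adjoining the base point to each `T n` gives a cover of the whole space, at no cost in mass
after restriction. -/
lemma Exhausts.sigmaFinite {T : ℕ → Set γ} {μ : Measure γ} (h : Exhausts T z₀ μ) :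
    SigmaFinite (μ.restrict {z₀}ᶜ) := by
  refine ⟨⟨⟨fun n => T n ∪ {z₀}, fun _ => trivial, fun n => ?_, ?_⟩⟩⟩
  · rw [Measure.restrict_apply ((h.measurableSet n).union (measurableSet_singleton _))]
    refine lt_of_le_of_lt (measure_mono ?_) (h.lt_top n)
    rintro z ⟨hz | hz, hz'⟩
    · exact hz
    · exact absurd hz hz'
  · rw [← Set.iUnion_union, h.iUnion, Set.compl_union_self]

lemma Exhausts.notMem {T : ℕ → Set α} {μ : Measure α} (h : Exhausts T x₀ μ) (n : ℕ) :
    x₀ ∉ T n := fun hx => by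
  have : x₀ ∈ ⋃ n, T n := Set.mem_iUnion.2 ⟨n, hx⟩
  rw [h.iUnion] at this
  exact this rfl

lemma Disintegrates.measure_inter (hD : Disintegrates Λ X Y Z z₀ κ) (hX : Measurable X)
    (hY : Measurable Y) (hZ : Measurable Z) {s : Set α} {t : Set β} {u : Set γ}
    (hs : MeasurableSet s) (ht : MeasurableSet t) (hu : MeasurableSet u) (hzu : z₀ ∉ u) :
    Λ (X ⁻¹' s ∩ Y ⁻¹' t ∩ Z ⁻¹' u) = ∫⁻ z in u, κ z (s ×ˢ t) ∂(Λ.map Z) := by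
  have hG : MeasurableSet (u ×ˢ s ×ˢ t) := hu.prod (hs.prod ht)
  have h := hD ((u ×ˢ s ×ˢ t).indicator 1) (measurable_one.indicator hG)
  have hsub : u ⊆ {z₀}ᶜ := fun z hz hz' => hzu (by rwa [← Set.mem_singleton_iff.1 hz'])
  have e1 : ∀ s', (u ×ˢ s ×ˢ t).indicator (1 : γ × α × β → ℝ≥0∞) (Z s', X s', Y s') =
      (X ⁻¹' s ∩ Y ⁻¹' t ∩ Z ⁻¹' u).indicator 1 s' := by
    intro s'
    simp only [Set.indicator]
    congr 1
    exact propext ⟨fun h => ⟨⟨h.2.1, h.2.2⟩, h.1⟩, fun h => ⟨h.2, h.1.1, h.1.2⟩⟩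
  have hm : MeasurableSet (X ⁻¹' s ∩ Y ⁻¹' t ∩ Z ⁻¹' u) := ((hX hs).inter (hY ht)).inter (hZ hu)
  simp_rw [e1] at h
  rw [lintegral_indicator_one hm, Measure.restrict_apply hm, Set.inter_eq_left.2] at h
  · rw [h, ← lintegral_indicator hu, ← lintegral_indicator (measurableSet_singleton _).compl]
    refine lintegral_congr fun z => ?_
    by_cases hz : z ∈ u
    · rw [Set.indicator_of_mem hz, Set.indicator_of_mem (hsub hz)]
      rw [← lintegral_indicator_one (hs.prod ht)]
      refine lintegral_congr fun w => ?_
      simp only [Set.indicator]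
      congr 1
      exact propext ⟨fun h => h.2, fun h => ⟨hz, h⟩⟩
    · rw [Set.indicator_of_notMem hz]
      by_cases hz' : z ∈ ({z₀}ᶜ : Set γ)
      · rw [Set.indicator_of_mem hz', ← lintegral_zero (μ := κ z)]
        refine lintegral_congr fun w => ?_
        exact Set.indicator_of_notMem (fun h => hz h.1) _
      · rw [Set.indicator_of_notMem hz']
  · exact fun s' hs' => hsub hs'.2

/-- A factorizing disintegration gives conditional independence on product sets. -/
lemma Disintegrates.condIndepUnder [IsMarkovKernel κ] (hD : Disintegrates Λ X Y Z z₀ κ)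
    (hX : Measurable X) (hY : Measurable Y) (hZ : Measurable Z)
    (hnull : Λ {s | X s ≠ x₀ ∧ Y s ≠ y₀ ∧ Z s = z₀} = 0)
    (hfac : ∀ᵐ z ∂(Λ.map Z).restrict {z₀}ᶜ, κ z = (κ.fst z).prod (κ.snd z))
    {s : Set α} {t : Set β} {u : Set γ} (hs : MeasurableSet s) (ht : MeasurableSet t)
    (hu : MeasurableSet u) (h0 : ¬ (x₀ ∈ s ∧ y₀ ∈ t ∧ z₀ ∈ u))
    (hfin : Λ (X ⁻¹' s ∩ Y ⁻¹' t ∩ Z ⁻¹' u) ≠ ∞) :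
    CondIndepUnder X Y Z (Λ.restrict (X ⁻¹' s ∩ Y ⁻¹' t ∩ Z ⁻¹' u)) := by
  set R := X ⁻¹' s ∩ Y ⁻¹' t ∩ Z ⁻¹' u with hR
  have hRm : MeasurableSet R := ((hX hs).inter (hY ht)).inter (hZ hu)
  have : IsFiniteMeasure (Λ.restrict R) := isFiniteMeasure_restrict.2 hfin
  -- Over `Z = z₀` one of `X`, `Y` is almost surely constant or the piece is empty; away from `z₀`
  -- the measure is a mixture of products.
  refine CondIndepUnder.of_restrict hZ (measurableSet_singleton z₀) ?_ ?_
  · rw [Measure.restrict_restrict (hZ (measurableSet_singleton z₀))]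
    have hm : MeasurableSet (Z ⁻¹' {z₀} ∩ R) := (hZ (measurableSet_singleton z₀)).inter hRm
    have : IsFiniteMeasure (Λ.restrict (Z ⁻¹' {z₀} ∩ R)) := isFiniteMeasure_restrict.2
      ((measure_mono Set.inter_subset_right).trans_lt hfin.lt_top).ne
    have hn : ∀ᵐ ω ∂Λ, ¬ (X ω ≠ x₀ ∧ Y ω ≠ y₀ ∧ Z ω = z₀) := measure_eq_zero_iff_ae_notMem.1 hnull
    by_cases h1 : x₀ ∈ s
    · by_cases h2 : y₀ ∈ t
      · refine CondIndepUnder.of_ae_const_right (y₀ := y₀) hZ ?_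
        rw [ae_restrict_iff' hm]
        refine Filter.Eventually.of_forall fun ω hω => ?_
        exact absurd ⟨h1, h2, by rw [← show Z ω = z₀ from hω.1]; exact hω.2.2⟩ h0
      · refine (CondIndepUnder.of_ae_const_right (y₀ := x₀) hZ ?_).symm
        rw [ae_restrict_iff' hm]
        filter_upwards [hn] with ω hω hω'
        by_contra hx
        exact hω ⟨hx, fun hy => h2 (hy ▸ hω'.2.1.2), hω'.1⟩
    · refine CondIndepUnder.of_ae_const_right (y₀ := y₀) hZ ?_
      rw [ae_restrict_iff' hm]
      filter_upwards [hn] with ω hω hω'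
      by_contra hy
      exact hω ⟨fun hx => h1 (hx ▸ hω'.2.1.1), hy, hω'.1⟩
  · have hc : MeasurableSet ({z₀}ᶜ : Set γ) := (measurableSet_singleton z₀).compl
    rw [Measure.restrict_restrict (hZ hc)]
    -- The marginal kernels are cut down to `s` and `t` and so are finite but no longer Markov.
    refine CondIndepUnder.of_mixture hZ ((Λ.map Z).restrict ({z₀}ᶜ ∩ u)) (κ.fst.restrict hs)
      (κ.snd.restrict ht) fun s' t' u' hs' ht' hu' => ?_
    rw [Measure.restrict_apply (((hX hs').inter (hY ht')).inter (hZ hu'))]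
    have e : X ⁻¹' s' ∩ Y ⁻¹' t' ∩ Z ⁻¹' u' ∩ (Z ⁻¹' {z₀}ᶜ ∩ R) =
        X ⁻¹' (s' ∩ s) ∩ Y ⁻¹' (t' ∩ t) ∩ Z ⁻¹' (u' ∩ ({z₀}ᶜ ∩ u)) := by
      ext ω
      simp only [hR, Set.mem_inter_iff, Set.mem_preimage]
      tauto
    rw [e, hD.measure_inter hX hY hZ (hs'.inter hs) (ht'.inter ht) (hu'.inter (hc.inter hu))
      (by simp), Measure.restrict_restrict hu']
    have hfac' : ∀ᵐ z ∂(Λ.map Z).restrict (u' ∩ ({z₀}ᶜ ∩ u)),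
        κ z = (κ.fst z).prod (κ.snd z) :=
      ae_mono (Measure.restrict_mono (fun z hz => hz.2.1) le_rfl) hfac
    refine lintegral_congr_ae ?_
    filter_upwards [hfac'] with z hz
    rw [hz, Measure.prod_prod, Kernel.restrict_apply, Kernel.restrict_apply,
      Measure.restrict_apply hs', Measure.restrict_apply ht']

/-- Conditional independence on `{Z ∈ u}` factorizes the disintegration over `u`. -/
lemma Disintegrates.ae_prod_of_condIndepUnder [IsMarkovKernel κ]
    (hD : Disintegrates Λ X Y Z z₀ κ)
    (hX : Measurable X) (hY : Measurable Y) (hZ : Measurable Z) {u : Set γ}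
    (hu : MeasurableSet u) (hzu : z₀ ∉ u) (hfin : Λ (Z ⁻¹' u) ≠ ∞)
    (hCI : CondIndepUnder X Y Z (Λ.restrict (Z ⁻¹' u))) {s : Set α} {t : Set β}
    (hs : MeasurableSet s) (ht : MeasurableSet t) :
    ∀ᵐ z ∂(Λ.map Z).restrict u, κ z (s ×ˢ t) = κ.fst z s * κ.snd z t := by
  have hf : IsFiniteMeasure (Λ.restrict (Z ⁻¹' u)) := isFiniteMeasure_restrict.2 hfin
  have hmap : (Λ.restrict (Z ⁻¹' u)).map Z = (Λ.map Z).restrict u :=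
    (Measure.restrict_map hZ hu).symm
  -- The disintegration itself supplies versions; taking one side to be the whole space gives those
  -- for `X` and `Y` alone.
  have key : ∀ (s : Set α) (t : Set β), MeasurableSet s → MeasurableSet t →
      IsVersion (fun z => κ z (s ×ˢ t)) (X ⁻¹' s ∩ Y ⁻¹' t) Z (Λ.restrict (Z ⁻¹' u)) := by
    intro s t hs ht
    rw [isVersion_iff hZ]
    intro v hv
    rw [hmap, Measure.restrict_restrict hv, ← hD.measure_inter hX hY hZ hs ht (hv.inter hu)
      (fun h => hzu h.2), Measure.restrict_apply (((hX hs).inter (hY ht)).inter (hZ hv)),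
      Set.preimage_inter, Set.inter_assoc]
  have h1 := key s Set.univ hs MeasurableSet.univ
  have h2 := key Set.univ t MeasurableSet.univ ht
  rw [Set.preimage_univ, Set.inter_univ] at h1
  rw [Set.preimage_univ, Set.univ_inter] at h2
  have h3 := hCI.isVersion_mul hs ht (κ.measurable_coe (hs.prod MeasurableSet.univ))
    (κ.measurable_coe (MeasurableSet.univ.prod ht)) h1 h2
  have h4 := (key s t hs ht).ae_eq (κ.measurable_coe (hs.prod ht))
    ((κ.measurable_coe (hs.prod MeasurableSet.univ)).mul
      (κ.measurable_coe (MeasurableSet.univ.prod ht))) h3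
  rw [hmap] at h4
  filter_upwards [h4] with z hz
  rw [hz, Kernel.fst_apply' _ _ hs, Kernel.snd_apply' _ _ ht, Set.prod_univ, Set.univ_prod]
  rfl

omit [MeasurableSingletonClass γ] in
/-- Factorization on measurable rectangles suffices. -/
lemma ae_eq_prod_of_rectangles [MeasurableSpace.CountablyGenerated α]
    [MeasurableSpace.CountablyGenerated β] [IsMarkovKernel κ] {μ : Measure γ}
    {T : ℕ → Set γ} (hT : Exhausts T z₀ μ)
    (h : ∀ (s : Set α) (t : Set β), MeasurableSet s → MeasurableSet t →
      ∀ᵐ z ∂μ.restrict {z₀}ᶜ, κ z (s ×ˢ t) = κ.fst z s * κ.snd z t) :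
    ∀ᵐ z ∂μ.restrict {z₀}ᶜ, κ z = (κ.fst z).prod (κ.snd z) := by
  have : MeasurableSpace.CountablyGenerated (α × β) := inferInstance
  rw [← hT.iUnion, ae_restrict_iUnion_iff]
  intro n
  have hf : IsFiniteMeasure (μ.restrict (T n)) := isFiniteMeasure_restrict.2 (hT.lt_top n).ne
  have hsub : T n ⊆ {z₀}ᶜ := hT.iUnion ▸ Set.subset_iUnion T n
  -- The exceptional null set depends on the rectangle. Comparing the two measures on the product
  -- avoids this, and countable generation then gives a single null set.
  have e : μ.restrict (T n) ⊗ₘ κ = μ.restrict (T n) ⊗ₘ (κ.fst ×ₖ κ.snd) := by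
    refine Measure.ext_prod₃ fun {u s t} hu hs ht => ?_
    rw [Measure.compProd_apply_prod hu (hs.prod ht), Measure.compProd_apply_prod hu (hs.prod ht)]
    refine lintegral_congr_ae (ae_restrict_of_ae ?_)
    filter_upwards [ae_mono (Measure.restrict_mono hsub le_rfl) (h s t hs ht)] with z hz
    rw [hz, Kernel.prod_apply, Measure.prod_prod]
  filter_upwards [Kernel.ae_eq_of_compProd_eq e] with z hz
  rw [hz, Kernel.prod_apply]

/-- Conditional independence on the sets `{X ∈ T h}` together with explosiveness forces the mass
on `{X ≠ x₀, Y ∈ t, Z = z₀}` to vanish. -/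
lemma measure_eq_zero_of_condIndepUnder (hX : Measurable X) (hY : Measurable Y)
    (hZ : Measurable Z) {T : ℕ → Set α} (hT : ∀ h, MeasurableSet (T h)) (hmono : Monotone T)
    (hfin : ∀ h, Λ (X ⁻¹' T h) ≠ ∞)
    (hCI : ∀ h, CondIndepUnder X Y Z (Λ.restrict (X ⁻¹' T h)))
    (hexp : Λ (X ⁻¹' (⋃ h, T h) ∩ Z ⁻¹' {z₀}) = 0 ∨ Λ (X ⁻¹' (⋃ h, T h) ∩ Z ⁻¹' {z₀}) = ∞)
    {t : Set β} (ht : MeasurableSet t) (htf : Λ (Y ⁻¹' t) ≠ ∞) :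
    Λ (X ⁻¹' (⋃ h, T h) ∩ Y ⁻¹' t ∩ Z ⁻¹' {z₀}) = 0 := by
  have hz : MeasurableSet ({z₀} : Set γ) := measurableSet_singleton z₀
  rcases hexp with h0 | h1
  · refine measure_mono_null ?_ h0
    exact fun ω hω => ⟨hω.1.1, hω.2⟩
  -- Evaluate the versions of conditional independence at the atom `z₀` and eliminate `a z₀` and `b
  -- z₀` between the three identities.
  have hprod : ∀ k h, k ≤ h → Λ (X ⁻¹' T k ∩ Y ⁻¹' t ∩ Z ⁻¹' {z₀}) * Λ (X ⁻¹' T h ∩ Z ⁻¹' {z₀}) =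
      Λ (X ⁻¹' T k ∩ Z ⁻¹' {z₀}) * Λ (X ⁻¹' T h ∩ Y ⁻¹' t ∩ Z ⁻¹' {z₀}) := by
    intro k h hkh
    have hf : IsFiniteMeasure (Λ.restrict (X ⁻¹' T h)) := isFiniteMeasure_restrict.2 (hfin h)
    obtain ⟨a, b, ha, hb, hav, hbv, hv⟩ := hCI h (T k) t (hT k) ht
    have f1 := (isVersion_iff hZ).1 hav {z₀} hz
    have f2 := (isVersion_iff hZ).1 hbv {z₀} hz
    have f3 := (isVersion_iff hZ).1 hv {z₀} hz
    have hsub : T k ⊆ T h := hmono hkh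
    rw [lintegral_singleton, Measure.map_apply hZ hz] at f1 f2 f3
    rw [Measure.restrict_apply ((hX (hT k)).inter (hZ hz)),
      Measure.restrict_apply (hZ hz)] at f1
    rw [Measure.restrict_apply ((hY ht).inter (hZ hz)),
      Measure.restrict_apply (hZ hz)] at f2
    rw [Measure.restrict_apply (((hX (hT k)).inter (hY ht)).inter (hZ hz)),
      Measure.restrict_apply (hZ hz)] at f3
    have e1 : X ⁻¹' T k ∩ Z ⁻¹' {z₀} ∩ X ⁻¹' T h = X ⁻¹' T k ∩ Z ⁻¹' {z₀} :=
      Set.inter_eq_left.2 fun ω hω => hsub hω.1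
    have e2 : Y ⁻¹' t ∩ Z ⁻¹' {z₀} ∩ X ⁻¹' T h = X ⁻¹' T h ∩ Y ⁻¹' t ∩ Z ⁻¹' {z₀} := by
      rw [Set.inter_comm, Set.inter_assoc]
    have e3 : X ⁻¹' T k ∩ Y ⁻¹' t ∩ Z ⁻¹' {z₀} ∩ X ⁻¹' T h = X ⁻¹' T k ∩ Y ⁻¹' t ∩ Z ⁻¹' {z₀} :=
      Set.inter_eq_left.2 fun ω hω => hsub hω.1.1
    have e4 : Z ⁻¹' {z₀} ∩ X ⁻¹' T h = X ⁻¹' T h ∩ Z ⁻¹' {z₀} := Set.inter_comm _ _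
    rw [e1, e4] at f1
    rw [e2, e4] at f2
    rw [e3, e4] at f3
    rw [f1, f2, f3]
    ring
  rw [Set.preimage_iUnion, Set.iUnion_inter, Set.iUnion_inter, measure_iUnion_null_iff]
  intro k
  by_contra hne
  have hmono1 : Monotone fun h => X ⁻¹' T h ∩ Z ⁻¹' {z₀} := fun a b hab =>
    Set.inter_subset_inter_left _ (Set.preimage_mono (hmono hab))
  have lim1 := tendsto_measure_iUnion_atTop (μ := Λ) hmono1
  rw [← Set.iUnion_inter, ← Set.preimage_iUnion, h1] at lim1
  -- A nonzero fixed factor times an exploding mass tends to infinity, whereas `hprod` bounds the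
  -- product by `Λ (X ⁻¹' T k) * Λ (Y ⁻¹' t)`, which is finite.
  have lim2 : Filter.Tendsto (fun h => Λ (X ⁻¹' T k ∩ Y ⁻¹' t ∩ Z ⁻¹' {z₀}) *
      Λ (X ⁻¹' T h ∩ Z ⁻¹' {z₀})) Filter.atTop (nhds ∞) := by
    have := ENNReal.Tendsto.const_mul (a := Λ (X ⁻¹' T k ∩ Y ⁻¹' t ∩ Z ⁻¹' {z₀})) lim1
      (Or.inl (by simp))
    rwa [ENNReal.mul_top hne] at this
  have hbd : ∀ᶠ h in Filter.atTop, Λ (X ⁻¹' T k ∩ Y ⁻¹' t ∩ Z ⁻¹' {z₀}) *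
      Λ (X ⁻¹' T h ∩ Z ⁻¹' {z₀}) ≤ Λ (X ⁻¹' T k) * Λ (Y ⁻¹' t) := by
    filter_upwards [Filter.eventually_ge_atTop k] with h hkh
    rw [hprod k h hkh]
    exact mul_le_mul' (measure_mono Set.inter_subset_left)
      (measure_mono fun ω hω => hω.1.2)
  have := le_of_tendsto lim2 hbd
  exact ENNReal.mul_ne_top (hfin k) htf (top_le_iff.1 this)

end Disintegration

/-! ### Projections of a Poisson process -/

section PoissonProjection

variable {Ω S α β γ : Type*} [MeasurableSpace Ω] [MeasurableSpace S] [MeasurableSpace α]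
  [MeasurableSpace β] [MeasurableSpace γ] [MeasurableSingletonClass γ]
  {ξ : Ω → Measure S} {P : Measure Ω} [IsProbabilityMeasure P]
  {X : S → α} {Y : S → β} {Z : S → γ}
  {Λ : Measure S} {x₀ : α} {y₀ : β} {z₀ : γ} {κ : Kernel γ (α × β)}

/-- The conditional Laplace transform of the marks at `z`. -/
noncomputable def markLaplace (κ : Kernel γ (α × β)) (f : α → ℝ≥0∞) (g : β → ℝ≥0∞) (z : γ) :
    ℝ≥0∞ := ∫⁻ w, expNeg (f w.1) * expNeg (g w.2) ∂(κ z)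

/-- The contribution of the points with `Z = z₀` to the Laplace functional. -/
noncomputable def offExponent (Λ : Measure S) (X : S → α) (Y : S → β) (Z : S → γ) (z₀ : γ)
    (f : α → ℝ≥0∞) (g : β → ℝ≥0∞) : ℝ≥0∞ :=
  ∫⁻ s in Z ⁻¹' {z₀}, (1 - expNeg (f (X s)) * expNeg (g (Y s))) ∂Λ

open Classical in
/-- The exponent `-log` of `markLaplace`, put to `0` at `z₀`. -/
noncomputable def markExponent (κ : Kernel γ (α × β)) (z₀ : γ) (f : α → ℝ≥0∞) (g : β → ℝ≥0∞) :
    γ → ℝ≥0∞ := ({z₀}ᶜ : Set γ).indicator fun z => negLog (markLaplace κ f g z)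

/-- The conditional joint Laplace functional of the projections of the Poisson process, given
its projection under `Z`. -/
noncomputable def condLaplace (Λ : Measure S) (X : S → α) (Y : S → β) (Z : S → γ) (z₀ : γ)
    (κ : Kernel γ (α × β)) (f : α → ℝ≥0∞) (g : β → ℝ≥0∞) (m : Measure γ) : ℝ≥0∞ :=
  expNeg (offExponent Λ X Y Z z₀ f g) * expNeg (∫⁻ z, markExponent κ z₀ f g z ∂m)

omit [MeasurableSingletonClass γ] in
lemma measurable_markLaplace [IsMarkovKernel κ] {f : α → ℝ≥0∞} {g : β → ℝ≥0∞} (hf : Measurable f)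
    (hg : Measurable g) : Measurable (markLaplace κ f g) :=
  Measurable.lintegral_kernel ((measurable_expNeg.comp (hf.comp measurable_fst)).mul
      (measurable_expNeg.comp (hg.comp measurable_snd)))

omit [MeasurableSingletonClass γ] in
lemma markLaplace_le_one [IsMarkovKernel κ] (f : α → ℝ≥0∞) (g : β → ℝ≥0∞) (z : γ) :
    markLaplace κ f g z ≤ 1 := by
  calc markLaplace κ f g z ≤ ∫⁻ _, 1 ∂(κ z) :=
        lintegral_mono fun w => mul_le_one' (expNeg_le_one _) (expNeg_le_one _)
    _ = 1 := by simp

lemma measurable_markExponent [IsMarkovKernel κ] {f : α → ℝ≥0∞} {g : β → ℝ≥0∞}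
    (hf : Measurable f) (hg : Measurable g) : Measurable (markExponent κ z₀ f g) :=
  (measurable_negLog.comp (measurable_markLaplace hf hg)).indicator
    (measurableSet_singleton _).compl

omit [MeasurableSingletonClass γ] in
lemma expNeg_markExponent [IsMarkovKernel κ] (f : α → ℝ≥0∞) (g : β → ℝ≥0∞) {z : γ}
    (hz : z ∈ ({z₀}ᶜ : Set γ)) : expNeg (markExponent κ z₀ f g z) = markLaplace κ f g z := by
  rw [markExponent, Set.indicator_of_mem hz, expNeg_negLog (markLaplace_le_one f g z)]

omit [MeasurableSingletonClass γ] in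
lemma markExponent_self (f : α → ℝ≥0∞) (g : β → ℝ≥0∞) : markExponent κ z₀ f g z₀ = 0 := by
  simp [markExponent]

lemma measurable_condLaplace [IsMarkovKernel κ] {f : α → ℝ≥0∞} {g : β → ℝ≥0∞}
    (hf : Measurable f) (hg : Measurable g) : Measurable (condLaplace Λ X Y Z z₀ κ f g) :=
  (measurable_expNeg.comp
    (Measure.measurable_lintegral (measurable_markExponent hf hg))).const_mul _

omit [MeasurableSpace γ] [MeasurableSingletonClass γ] [MeasurableSpace β] in
lemma measurable_expNeg_lintegral {f : α → ℝ≥0∞} (hf : Measurable f) :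
    Measurable fun m : Measure α => expNeg (∫⁻ x, f x ∂m) :=
  measurable_expNeg.comp (Measure.measurable_lintegral hf)

namespace PuncturedCI.IsPoissonProcess

omit [IsProbabilityMeasure P] in
lemma measurable_map (hξ : IsPoissonProcess ξ Λ P) (hX : Measurable X) :
    Measurable fun ω => (ξ ω).map X := (Measure.measurable_map X hX).comp hξ.measurable

/-- The Laplace transform of `ξ G` at `1` equals `1`, its maximal value, so `exp (-ξ G) = 1` almost
surely. -/
lemma ae_eq_zero (hξ : IsPoissonProcess ξ Λ P) {G : Set S} (hG : MeasurableSet G) (h : Λ G = 0) :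
    ∀ᵐ ω ∂P, ξ ω G = 0 := by
  have h1 := hξ.lintegral_expNeg_mul 1 hG
  rw [h, mul_zero, expNeg_zero] at h1
  have hm : Measurable fun ω => expNeg (1 * ξ ω G) :=
    measurable_expNeg.comp (((Measure.measurable_coe hG).comp hξ.measurable).const_mul 1)
  have h2 := ae_eq_of_ae_le_of_lintegral_le (μ := P) (f := fun ω => expNeg (1 * ξ ω G))
    (g := fun _ => 1) (Filter.Eventually.of_forall fun ω => expNeg_le_one _) (by rw [h1]; simp)
    aemeasurable_const (by rw [h1]; simp)
  filter_upwards [h2] with ω hω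
  have := expNeg_injective (hω.trans expNeg_zero.symm)
  simpa using this

/-- If the mass of `{X = x₀}` is `0` or `∞`, then the value of a test function at `x₀` contributes
a deterministic factor. -/
lemma ae_expNeg_eq [MeasurableSingletonClass α] (hξ : IsPoissonProcess ξ Λ P) (hX : Measurable X)
    (h : Λ (X ⁻¹' {x₀}) = 0 ∨ Λ (X ⁻¹' {x₀}) = ∞) (f : α → ℝ≥0∞) :
    ∃ ε : ℝ≥0∞, ∀ᵐ ω ∂P, expNeg (∫⁻ x, f x ∂(ξ ω).map X) =
      ε * expNeg (∫⁻ x, ({x₀}ᶜ : Set α).indicator f x ∂(ξ ω).map X) := by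
  have hs : MeasurableSet ({x₀} : Set α) := measurableSet_singleton x₀
  have hc : ∃ c : ℝ≥0∞, ∀ᵐ ω ∂P, ξ ω (X ⁻¹' {x₀}) = c := by
    rcases h with h | h
    · exact ⟨0, hξ.ae_eq_zero (hX hs) h⟩
    · exact ⟨∞, hξ.law_of_infinite _ (hX hs) h⟩
  obtain ⟨c, hc⟩ := hc
  refine ⟨expNeg (f x₀ * c), ?_⟩
  filter_upwards [hc] with ω hω
  rw [← expNeg_add, ← lintegral_add_compl f hs, lintegral_singleton, Measure.map_apply hX hs, hω,
    lintegral_indicator hs.compl]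

/-- A test function vanishing at `z₀` ignores the points over `z₀`, whose mean number may be
infinite. -/
lemma laplace_map (hξ : IsPoissonProcess ξ Λ P) (hZ : Measurable Z) {φ : γ → ℝ≥0∞}
    (hφ : Measurable φ) (h0 : φ z₀ = 0) :
    ∫⁻ ω, expNeg (∫⁻ z, φ z ∂(ξ ω).map Z) ∂P =
      expNeg (∫⁻ z in {z₀}ᶜ, (1 - expNeg (φ z)) ∂(Λ.map Z)) := by
  have hm : Measurable fun z => 1 - expNeg (φ z) := (measurable_expNeg.comp hφ).const_sub 1
  simp_rw [lintegral_map hφ hZ]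
  have hφZ : Measurable fun s => φ (Z s) := hφ.comp hZ
  rw [hξ.laplace hφZ, ← lintegral_map hm hZ,
    ← lintegral_add_compl _ (measurableSet_singleton z₀), lintegral_singleton]
  simp [h0, expNeg_zero]

/-- The joint Laplace functional of the three projections. -/
lemma laplace_joint [IsMarkovKernel κ] (hξ : IsPoissonProcess ξ Λ P)
    (hD : Disintegrates Λ X Y Z z₀ κ) (hX : Measurable X)
    (hY : Measurable Y) (hZ : Measurable Z) {f : α → ℝ≥0∞} {g : β → ℝ≥0∞} {h : γ → ℝ≥0∞}
    (hf : Measurable f) (hg : Measurable g) (hh : Measurable h) (h0 : h z₀ = 0) :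
    ∫⁻ ω, expNeg (∫⁻ x, f x ∂(ξ ω).map X) * expNeg (∫⁻ y, g y ∂(ξ ω).map Y) *
        expNeg (∫⁻ z, h z ∂(ξ ω).map Z) ∂P =
      expNeg (offExponent Λ X Y Z z₀ f g) *
        expNeg (∫⁻ z in {z₀}ᶜ, (1 - markLaplace κ f g z * expNeg (h z)) ∂(Λ.map Z)) := by
  have hfX : Measurable fun s => f (X s) := hf.comp hX
  have hgY : Measurable fun s => g (Y s) := hg.comp hY
  have hhZ : Measurable fun s => h (Z s) := hh.comp hZ
  have hfg : Measurable fun s => f (X s) + g (Y s) := hfX.add hgY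
  have hfgh : Measurable fun s => f (X s) + g (Y s) + h (Z s) := hfg.add hhZ
  have e1 : ∀ ω, expNeg (∫⁻ x, f x ∂(ξ ω).map X) * expNeg (∫⁻ y, g y ∂(ξ ω).map Y) *
        expNeg (∫⁻ z, h z ∂(ξ ω).map Z) =
      expNeg (∫⁻ s, (f (X s) + g (Y s) + h (Z s)) ∂(ξ ω)) := by
    intro ω
    rw [lintegral_map hf hX, lintegral_map hg hY, lintegral_map hh hZ, ← expNeg_add, ← expNeg_add,
      lintegral_add_left hfg, lintegral_add_left hfX]
  simp_rw [e1]
  -- Split the exponent at `Z = z₀`: there `h` drops out and the off-exponent remains; the rest is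
  -- integrated through the disintegration.
  rw [hξ.laplace hfgh, ← expNeg_add,
    ← lintegral_add_compl _ (hZ (measurableSet_singleton z₀))]
  congr 2
  · refine setLIntegral_congr_fun (hZ (measurableSet_singleton z₀)) fun s hs => ?_
    have : Z s = z₀ := hs
    simp only [expNeg_add, this, h0, expNeg_zero, mul_one]
  · have hΦ : Measurable fun p : γ × α × β =>
        1 - expNeg (f p.2.1) * expNeg (g p.2.2) * expNeg (h p.1) := by
      refine Measurable.const_sub ?_ 1
      exact ((measurable_expNeg.comp (hf.comp (measurable_fst.comp measurable_snd))).mul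
        (measurable_expNeg.comp (hg.comp (measurable_snd.comp measurable_snd)))).mul
        (measurable_expNeg.comp (hh.comp measurable_fst))
    have := hD _ hΦ
    simp only [expNeg_add]
    rw [← Set.preimage_compl]
    rw [this]
    refine lintegral_congr fun z => ?_
    have hm : Measurable fun w : α × β => expNeg (f w.1) * expNeg (g w.2) :=
      (measurable_expNeg.comp (hf.comp measurable_fst)).mul
        (measurable_expNeg.comp (hg.comp measurable_snd))
    have hmh : Measurable fun w : α × β => expNeg (f w.1) * expNeg (g w.2) * expNeg (h z) :=
      hm.mul_const _
    dsimp only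
    rw [lintegral_sub hmh]
    · rw [lintegral_mul_const _ hm]
      simp [markLaplace]
    · refine ne_top_of_le_ne_top ENNReal.one_ne_top ?_
      calc ∫⁻ w : α × β, expNeg (f w.1) * expNeg (g w.2) * expNeg (h z) ∂(κ z)
          ≤ ∫⁻ _, 1 ∂(κ z) := lintegral_mono fun w =>
            mul_le_one' (mul_le_one' (expNeg_le_one _) (expNeg_le_one _)) (expNeg_le_one _)
        _ = 1 := by simp
    · exact Filter.Eventually.of_forall fun w =>
        mul_le_one' (mul_le_one' (expNeg_le_one _) (expNeg_le_one _)) (expNeg_le_one _)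

/-- Two weights with the same conditional Laplace functional given the projection under `Z` have
the same conditional expectation. -/
lemma lintegral_mul_eq_of_laplace (hξ : IsPoissonProcess ξ Λ P) (hZ : Measurable Z)
    (hz₀ : Λ (Z ⁻¹' {z₀}) = 0 ∨ Λ (Z ⁻¹' {z₀}) = ∞) {W W' : Ω → ℝ≥0∞} (hW : Measurable W)
    (hW' : Measurable W') (hfin : ∫⁻ ω, W ω ∂P ≠ ∞)
    (h : ∀ h : γ → ℝ≥0∞, Measurable h → h z₀ = 0 →
      ∫⁻ ω, W ω * expNeg (∫⁻ z, h z ∂(ξ ω).map Z) ∂P =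
      ∫⁻ ω, W' ω * expNeg (∫⁻ z, h z ∂(ξ ω).map Z) ∂P)
    {φ : Measure γ → ℝ≥0∞} (hφ : Measurable φ) :
    ∫⁻ ω, W ω * φ ((ξ ω).map Z) ∂P = ∫⁻ ω, W' ω * φ ((ξ ω).map Z) ∂P := by
  have hζ := hξ.measurable_map hZ
  have hfin' : ∫⁻ ω, W' ω ∂P ≠ ∞ := by
    have := h 0 measurable_const rfl
    simp only [Pi.zero_apply, lintegral_zero, expNeg_zero, mul_one] at this
    rwa [← this]
  have : IsFiniteMeasure (P.withDensity W) := isFiniteMeasure_withDensity hfin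
  have : IsFiniteMeasure (P.withDensity W') := isFiniteMeasure_withDensity hfin'
  have := Measure.isFiniteMeasure_map (P.withDensity W) fun ω => (ξ ω).map Z
  have := Measure.isFiniteMeasure_map (P.withDensity W') fun ω => (ξ ω).map Z
  have key : ∀ ψ : Measure γ → ℝ≥0∞, Measurable ψ → ∀ V : Ω → ℝ≥0∞, Measurable V →
      ∫⁻ m, ψ m ∂((P.withDensity V).map fun ω => (ξ ω).map Z) =
        ∫⁻ ω, V ω * ψ ((ξ ω).map Z) ∂P := by
    intro ψ hψ V hV
    have hψζ : Measurable fun ω => ψ ((ξ ω).map Z) := hψ.comp hζ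
    rw [lintegral_map hψ hζ, lintegral_withDensity_eq_lintegral_mul _ hV hψζ]
    rfl
  have e : (P.withDensity W).map (fun ω => (ξ ω).map Z) =
      (P.withDensity W').map fun ω => (ξ ω).map Z := by
    refine measure_ext_of_laplace fun u hu => ?_
    rw [key _ (measurable_expNeg_lintegral hu) _ hW, key _ (measurable_expNeg_lintegral hu) _ hW']
    -- The number of points over `z₀` is almost surely constant, so the value `u z₀` contributes the
    -- same factor to both sides and `u` may be replaced by a function vanishing at `z₀`.
    obtain ⟨ε, hε⟩ := hξ.ae_expNeg_eq hZ hz₀ u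
    have e1 : ∀ V : Ω → ℝ≥0∞, Measurable V →
        ∫⁻ ω, V ω * expNeg (∫⁻ z, u z ∂(ξ ω).map Z) ∂P =
        ε * ∫⁻ ω, V ω * expNeg (∫⁻ z, ({z₀}ᶜ : Set γ).indicator u z ∂(ξ ω).map Z) ∂P := by
      intro V hV
      have hu' : Measurable (({z₀}ᶜ : Set γ).indicator u) :=
        hu.indicator (measurableSet_singleton _).compl
      have hm : Measurable fun ω =>
          V ω * expNeg (∫⁻ z, ({z₀}ᶜ : Set γ).indicator u z ∂(ξ ω).map Z) :=
        hV.mul ((measurable_expNeg_lintegral hu').comp hζ)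
      rw [← lintegral_const_mul _ hm]
      refine lintegral_congr_ae ?_
      filter_upwards [hε] with ω hω
      rw [hω]
      ring
    rw [e1 _ hW, e1 _ hW', h _ (hu.indicator (measurableSet_singleton _).compl) (by simp)]
  rw [← key _ hφ _ hW, ← key _ hφ _ hW', e]

/-- The conditional Laplace functional given the projection under `Z`. -/
lemma lintegral_condLaplace [IsMarkovKernel κ] (hξ : IsPoissonProcess ξ Λ P)
    (hD : Disintegrates Λ X Y Z z₀ κ) (hX : Measurable X)
    (hY : Measurable Y) (hZ : Measurable Z)
    (hz₀ : Λ (Z ⁻¹' {z₀}) = 0 ∨ Λ (Z ⁻¹' {z₀}) = ∞) {f : α → ℝ≥0∞} {g : β → ℝ≥0∞}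
    (hf : Measurable f) (hg : Measurable g) {φ : Measure γ → ℝ≥0∞} (hφ : Measurable φ) :
    ∫⁻ ω, expNeg (∫⁻ x, f x ∂(ξ ω).map X) * expNeg (∫⁻ y, g y ∂(ξ ω).map Y) *
        φ ((ξ ω).map Z) ∂P =
      ∫⁻ ω, condLaplace Λ X Y Z z₀ κ f g ((ξ ω).map Z) * φ ((ξ ω).map Z) ∂P := by
  have hζ := hξ.measurable_map hZ
  refine hξ.lintegral_mul_eq_of_laplace (z₀ := z₀) hZ hz₀
    (((measurable_expNeg_lintegral hf).comp (hξ.measurable_map hX)).mul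
      ((measurable_expNeg_lintegral hg).comp (hξ.measurable_map hY)))
    ((measurable_condLaplace hf hg).comp hζ) ?_ ?_ hφ
  · refine ne_top_of_le_ne_top ENNReal.one_ne_top ?_
    calc _ ≤ ∫⁻ _, 1 ∂P := lintegral_mono fun ω =>
            mul_le_one' (expNeg_le_one _) (expNeg_le_one _)
        _ = 1 := by simp
  · intro h hh h0
    refine (hξ.laplace_joint hD hX hY hZ hf hg hh h0).trans ?_
    have hm := measurable_markExponent (κ := κ) (z₀ := z₀) hf hg
    -- Multiplying by a test functional only adds `h` to the mark exponent, so the right side is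
    -- again a Laplace functional of the projection under `Z`.
    have e1 : ∀ ω, condLaplace Λ X Y Z z₀ κ f g ((ξ ω).map Z) *
        expNeg (∫⁻ z, h z ∂(ξ ω).map Z) = expNeg (offExponent Λ X Y Z z₀ f g) *
          expNeg (∫⁻ z, (markExponent κ z₀ f g z + h z) ∂(ξ ω).map Z) := by
      intro ω
      rw [condLaplace, mul_assoc, ← expNeg_add (∫⁻ z, _ ∂_), lintegral_add_left hm]
    simp_rw [Function.comp_def, e1]
    have hm' : Measurable fun ω =>
        expNeg (∫⁻ z, (markExponent κ z₀ f g z + h z) ∂(ξ ω).map Z) :=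
      (measurable_expNeg_lintegral (hm.add hh)).comp hζ
    rw [lintegral_const_mul _ hm']
    congr 1
    refine Eq.trans ?_ (hξ.laplace_map (z₀ := z₀) hZ (hm.add hh)
      (by simp [markExponent_self, h0])).symm
    congr 1
    refine setLIntegral_congr_fun (measurableSet_singleton z₀).compl fun z hz => ?_
    simp only [Pi.add_apply]
    rw [expNeg_add, expNeg_markExponent _ _ hz]

end PuncturedCI.IsPoissonProcess

end PoissonProjection

/-! ### Conditional independence of random measures -/

lemma lintegral_map_withDensity {Ω γ : Type*} [MeasurableSpace Ω] [MeasurableSpace γ]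
    {P : Measure Ω} {Z : Ω → γ} (hZ : Measurable Z) {V : Ω → ℝ≥0∞} (hV : Measurable V)
    {ψ : γ → ℝ≥0∞} (hψ : Measurable ψ) :
    ∫⁻ z, ψ z ∂((P.withDensity V).map Z) = ∫⁻ ω, V ω * ψ (Z ω) ∂P := by
  have hψZ : Measurable fun ω => ψ (Z ω) := hψ.comp hZ
  rw [lintegral_map hψ hZ, lintegral_withDensity_eq_lintegral_mul _ hV hψZ]
  rfl

lemma IsVersion.lintegral_mul {Ω γ : Type*} [MeasurableSpace Ω] [MeasurableSpace γ]
    {m : Measure Ω} {Z : Ω → γ} {a : γ → ℝ≥0∞} {s : Set Ω} (h : IsVersion a s Z m)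
    (hZ : Measurable Z) (hs : MeasurableSet s) (ha : Measurable a) {ψ : γ → ℝ≥0∞}
    (hψ : Measurable ψ) :
    ∫⁻ ω, s.indicator 1 ω * ψ (Z ω) ∂m = ∫⁻ ω, a (Z ω) * ψ (Z ω) ∂m := by
  rw [← lintegral_map_withDensity hZ (measurable_one.indicator hs) hψ,
    withDensity_indicator_one hs, h, lintegral_withDensity_eq_lintegral_mul _ ha hψ,
    lintegral_map (ha.mul hψ) hZ]
  rfl

lemma indicator_one_le_one {δ : Type*} (v : Set δ) (x : δ) : v.indicator (1 : δ → ℝ≥0∞) x ≤ 1 :=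
  Set.indicator_le_self' (fun _ _ => zero_le) x

section RandomMeasure

variable {Ω α β γ : Type*} [MeasurableSpace Ω] [MeasurableSpace α] [MeasurableSpace β]
  [MeasurableSpace γ] {P : Measure Ω} [IsProbabilityMeasure P]
  {ξ : Ω → Measure α} {η : Ω → Measure β} {ζ : Ω → Measure γ}

/-- Conditional independence of random measures in terms of conditional Laplace functionals. -/
lemma condIndepUnder_of_laplace (hξ : Measurable ξ) (hη : Measurable η) (hζ : Measurable ζ)
    (F : (α → ℝ≥0∞) → Measure γ → ℝ≥0∞) (G : (β → ℝ≥0∞) → Measure γ → ℝ≥0∞)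
    (hF : ∀ f, Measurable f → Measurable (F f))
    (h1 : ∀ f, Measurable f → ∀ φ : Measure γ → ℝ≥0∞, Measurable φ →
      ∫⁻ ω, expNeg (∫⁻ x, f x ∂(ξ ω)) * φ (ζ ω) ∂P = ∫⁻ ω, F f (ζ ω) * φ (ζ ω) ∂P)
    (h2 : ∀ g, Measurable g → ∀ φ : Measure γ → ℝ≥0∞, Measurable φ →
      ∫⁻ ω, expNeg (∫⁻ y, g y ∂(η ω)) * φ (ζ ω) ∂P = ∫⁻ ω, G g (ζ ω) * φ (ζ ω) ∂P)
    (h3 : ∀ f g, Measurable f → Measurable g → ∀ φ : Measure γ → ℝ≥0∞, Measurable φ →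
      ∫⁻ ω, expNeg (∫⁻ x, f x ∂(ξ ω)) * expNeg (∫⁻ y, g y ∂(η ω)) * φ (ζ ω) ∂P =
        ∫⁻ ω, F f (ζ ω) * G g (ζ ω) * φ (ζ ω) ∂P) :
    CondIndepUnder ξ η ζ P := by
  have hle : ∀ V : Ω → ℝ≥0∞, (∀ ω, V ω ≤ 1) → ∫⁻ ω, V ω ∂P ≠ ∞ := fun V hV =>
    ne_top_of_le_ne_top ENNReal.one_ne_top
      ((lintegral_mono hV).trans (by simp))
  have mf : ∀ f : α → ℝ≥0∞, Measurable f → Measurable fun ω => expNeg (∫⁻ x, f x ∂(ξ ω)) :=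
    fun f hf => (measurable_expNeg_lintegral hf).comp hξ
  have mg : ∀ g : β → ℝ≥0∞, Measurable g → Measurable fun ω => expNeg (∫⁻ x, g x ∂(η ω)) :=
    fun f hf => (measurable_expNeg_lintegral hf).comp hη
  -- Two passes through uniqueness of Laplace functionals. This first one replaces the functional of
  -- `ξ` by `F f ζ` when integrated against arbitrary functions of `(η, ζ)`.
  have step1 : ∀ f, Measurable f → ∀ θ : Measure β × Measure γ → ℝ≥0∞, Measurable θ →
      ∫⁻ ω, expNeg (∫⁻ x, f x ∂(ξ ω)) * θ (η ω, ζ ω) ∂P =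
        ∫⁻ ω, F f (ζ ω) * θ (η ω, ζ ω) ∂P := by
    intro f hf θ hθ
    have hp : Measurable fun ω => (η ω, ζ ω) := hη.prodMk hζ
    have hFm : Measurable fun ω => F f (ζ ω) := (hF f hf).comp hζ
    have hfin : ∫⁻ ω, F f (ζ ω) ∂P ≠ ∞ := by
      have := h1 f hf (fun _ => 1) measurable_const
      simp only [mul_one] at this
      rw [← this]
      exact hle _ fun ω => expNeg_le_one _
    have := isFiniteMeasure_withDensity (hle _ fun ω => expNeg_le_one (∫⁻ x, f x ∂(ξ ω)))
    have := isFiniteMeasure_withDensity hfin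
    have := Measure.isFiniteMeasure_map
      (P.withDensity fun ω => expNeg (∫⁻ x, f x ∂(ξ ω))) fun ω => (η ω, ζ ω)
    have := Measure.isFiniteMeasure_map (P.withDensity fun ω => F f (ζ ω)) fun ω => (η ω, ζ ω)
    have e : (P.withDensity fun ω => expNeg (∫⁻ x, f x ∂(ξ ω))).map (fun ω => (η ω, ζ ω)) =
        (P.withDensity fun ω => F f (ζ ω)).map fun ω => (η ω, ζ ω) := by
      refine measure_pair_ext_of_laplace fun g h hg hh => ?_
      have hgh : Measurable fun p : Measure β × Measure γ =>
          expNeg (∫⁻ x, g x ∂p.1) * expNeg (∫⁻ x, h x ∂p.2) :=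
        ((measurable_expNeg_lintegral hg).comp measurable_fst).mul
          ((measurable_expNeg_lintegral hh).comp measurable_snd)
      rw [lintegral_map_withDensity hp (mf f hf) hgh, lintegral_map_withDensity hp hFm hgh]
      have a1 := h3 f g hf hg _ (measurable_expNeg_lintegral hh)
      have a2 := h2 g hg _ ((hF f hf).mul (measurable_expNeg_lintegral hh))
      simp only [Pi.mul_apply] at a2
      calc _ = _ := by simp only [← mul_assoc]
        _ = _ := a1
        _ = _ := lintegral_congr fun ω => by ring
        _ = _ := a2.symm
        _ = _ := lintegral_congr fun ω => by ring
    rw [← lintegral_map_withDensity hp (mf f hf) hθ, e, lintegral_map_withDensity hp hFm hθ]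
  intro s t hs ht
  obtain ⟨a, ha, hav⟩ := exists_isVersion (m := P) ζ hζ (ξ ⁻¹' s)
  obtain ⟨b, hb, hbv⟩ := exists_isVersion (m := P) ζ hζ (η ⁻¹' t)
  refine ⟨a, b, ha, hb, hav, hbv, ?_⟩
  rw [isVersion_iff hζ]
  intro u hu
  have hb1 : ∀ᵐ ω ∂P, b (ζ ω) ≤ 1 := ae_of_ae_map hζ.aemeasurable (hbv.le_one hζ hb)
  have mu : Measurable (u.indicator (1 : Measure γ → ℝ≥0∞)) := measurable_one.indicator hu
  have mt : Measurable ((η ⁻¹' t).indicator (1 : Ω → ℝ≥0∞)) := measurable_one.indicator (hη ht)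
  have ms : Measurable (s.indicator (1 : Measure α → ℝ≥0∞)) := measurable_one.indicator hs
  have muζ : Measurable fun ω => u.indicator (1 : Measure γ → ℝ≥0∞) (ζ ω) := mu.comp hζ
  have mV : Measurable fun ω => (η ⁻¹' t).indicator 1 ω * u.indicator (1 : Measure γ → ℝ≥0∞) (ζ ω) :=
    mt.mul muζ
  have mV' : Measurable fun ω => b (ζ ω) * u.indicator (1 : Measure γ → ℝ≥0∞) (ζ ω) :=
    (hb.comp hζ).mul muζ
  have hVfin : ∫⁻ ω, (η ⁻¹' t).indicator 1 ω * u.indicator (1 : Measure γ → ℝ≥0∞) (ζ ω) ∂P ≠ ∞ :=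
    hle _ fun ω => mul_le_one' (indicator_one_le_one _ _) (indicator_one_le_one _ _)
  have hVfin' : ∫⁻ ω, b (ζ ω) * u.indicator (1 : Measure γ → ℝ≥0∞) (ζ ω) ∂P ≠ ∞ := by
    refine ne_top_of_le_ne_top ENNReal.one_ne_top
      ((lintegral_mono_ae (hb1.mono fun ω hω => mul_le_one' hω (indicator_one_le_one u (ζ ω)))).trans (by simp))
  have i1 := isFiniteMeasure_withDensity hVfin
  have i2 := isFiniteMeasure_withDensity hVfin'
  have i3 := Measure.isFiniteMeasure_map (P.withDensity fun ω =>
    (η ⁻¹' t).indicator 1 ω * u.indicator (1 : Measure γ → ℝ≥0∞) (ζ ω)) ξ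
  have i4 := Measure.isFiniteMeasure_map (P.withDensity fun ω =>
    b (ζ ω) * u.indicator (1 : Measure γ → ℝ≥0∞) (ζ ω)) ξ
  -- In the second pass the indicator of `{η ∈ t}` and its conditional version `b ζ` are used as
  -- weights; by `step1` they give `ξ` the same weighted law on `{ζ ∈ u}`.
  have e : (P.withDensity fun ω =>
      (η ⁻¹' t).indicator 1 ω * u.indicator (1 : Measure γ → ℝ≥0∞) (ζ ω)).map ξ =
      (P.withDensity fun ω => b (ζ ω) * u.indicator (1 : Measure γ → ℝ≥0∞) (ζ ω)).map ξ := by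
    refine measure_ext_of_laplace fun f hf => ?_
    rw [lintegral_map_withDensity hξ mV (measurable_expNeg_lintegral hf),
      lintegral_map_withDensity hξ mV' (measurable_expNeg_lintegral hf)]
    have a1 := step1 f hf (fun p => t.indicator 1 p.1 * u.indicator 1 p.2)
      (((measurable_one.indicator ht).comp measurable_fst).mul (mu.comp measurable_snd))
    have a2 := hbv.lintegral_mul hζ (hη ht) hb ((hF f hf).mul mu)
    have a3 := h1 f hf _ (hb.mul mu)
    simp only [Pi.mul_apply] at a2 a3
    calc _ = _ := lintegral_congr fun ω => mul_comm _ _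
      _ = _ := a1
      _ = _ := lintegral_congr fun ω => by
        rw [mul_left_comm]; rfl
      _ = _ := a2
      _ = _ := lintegral_congr fun ω => by ring
      _ = _ := a3.symm
      _ = _ := lintegral_congr fun ω => mul_comm _ _
  have e' : ∫⁻ ω, (η ⁻¹' t).indicator 1 ω * u.indicator (1 : Measure γ → ℝ≥0∞) (ζ ω) *
      s.indicator 1 (ξ ω) ∂P =
      ∫⁻ ω, b (ζ ω) * u.indicator (1 : Measure γ → ℝ≥0∞) (ζ ω) * s.indicator 1 (ξ ω) ∂P := by
    rw [← lintegral_map_withDensity hξ mV ms, e, lintegral_map_withDensity hξ mV' ms]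
  have a4 := hav.lintegral_mul hζ (hξ hs) ha (hb.mul mu)
  simp only [Pi.mul_apply] at a4
  have hm : MeasurableSet (ξ ⁻¹' s ∩ η ⁻¹' t ∩ ζ ⁻¹' u) := ((hξ hs).inter (hη ht)).inter (hζ hu)
  have mab : Measurable (u.indicator fun z => a z * b z) := (ha.mul hb).indicator hu
  rw [← lintegral_indicator_one hm, ← lintegral_indicator hu,
    lintegral_map mab hζ]
  calc _ = ∫⁻ ω, (η ⁻¹' t).indicator 1 ω * u.indicator (1 : Measure γ → ℝ≥0∞) (ζ ω) *
      s.indicator 1 (ξ ω) ∂P := lintegral_congr fun ω => by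
        rw [Set.inter_indicator_one, Set.inter_indicator_one]
        simp only [Pi.mul_apply]
        rw [mul_comm ((ξ ⁻¹' s).indicator 1 ω), mul_right_comm]
        rfl
    _ = _ := e'
    _ = _ := lintegral_congr fun ω => mul_comm _ _
    _ = _ := a4
    _ = _ := lintegral_congr fun ω => by
      by_cases hω : ζ ω ∈ u <;> simp [hω]

end RandomMeasure

/-! ### Conditional independence of Poisson projections from factorization -/

section PoissonProjection

variable {Ω S α β γ : Type*} [MeasurableSpace Ω] [MeasurableSpace S] [MeasurableSpace α]
  [MeasurableSpace β] [MeasurableSpace γ] [MeasurableSingletonClass α]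
  [MeasurableSingletonClass β] [MeasurableSingletonClass γ]
  {ξ : Ω → Measure S} {P : Measure Ω} [IsProbabilityMeasure P]
  {X : S → α} {Y : S → β} {Z : S → γ}
  {Λ : Measure S} {x₀ : α} {y₀ : β} {z₀ : γ} {κ : Kernel γ (α × β)}

-- The mark exponents of the two conditional functionals add up, so their product is, up to
-- constants, again a Laplace functional of the projection under `Z`.
omit [MeasurableSingletonClass α] [MeasurableSingletonClass β] in
lemma PuncturedCI.IsPoissonProcess.lintegral_condLaplace_mul [IsMarkovKernel κ]
    (hξ : IsPoissonProcess ξ Λ P) (hZ : Measurable Z) {f : α → ℝ≥0∞} {g : β → ℝ≥0∞}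
    {h : γ → ℝ≥0∞} (hf : Measurable f) (hg : Measurable g) (hh : Measurable h) (h0 : h z₀ = 0) :
    ∫⁻ ω, condLaplace Λ X Y Z z₀ κ f 0 ((ξ ω).map Z) *
        condLaplace Λ X Y Z z₀ κ 0 g ((ξ ω).map Z) * expNeg (∫⁻ z, h z ∂(ξ ω).map Z) ∂P =
      expNeg (offExponent Λ X Y Z z₀ f 0) * expNeg (offExponent Λ X Y Z z₀ 0 g) *
        expNeg (∫⁻ z in {z₀}ᶜ, (1 - markLaplace κ f 0 z * markLaplace κ 0 g z * expNeg (h z))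
          ∂(Λ.map Z)) := by
  have hξZ := hξ.measurable_map hZ
  have mα₀ : Measurable (0 : α → ℝ≥0∞) := measurable_const
  have mβ₀ : Measurable (0 : β → ℝ≥0∞) := measurable_const
  have m1 := measurable_markExponent (κ := κ) (z₀ := z₀) hf mβ₀
  have m2 := measurable_markExponent (κ := κ) (z₀ := z₀) mα₀ hg
  have e1 : ∀ ω, condLaplace Λ X Y Z z₀ κ f 0 ((ξ ω).map Z) *
      condLaplace Λ X Y Z z₀ κ 0 g ((ξ ω).map Z) * expNeg (∫⁻ z, h z ∂(ξ ω).map Z) =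
      (expNeg (offExponent Λ X Y Z z₀ f 0) * expNeg (offExponent Λ X Y Z z₀ 0 g)) *
      expNeg (∫⁻ z, (markExponent κ z₀ f 0 z + markExponent κ z₀ 0 g z + h z)
        ∂(ξ ω).map Z) := by
    intro ω
    have m12 : Measurable fun z => markExponent κ z₀ f 0 z + markExponent κ z₀ 0 g z :=
      m1.add m2
    rw [condLaplace, condLaplace, lintegral_add_left m12, lintegral_add_left m1, expNeg_add,
      expNeg_add]
    ring
  simp only [e1]
  have m3 : Measurable fun z => markExponent κ z₀ f 0 z + markExponent κ z₀ 0 g z + h z :=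
    (m1.add m2).add hh
  have m4 : Measurable fun ω =>
      expNeg (∫⁻ z, (markExponent κ z₀ f 0 z + markExponent κ z₀ 0 g z + h z)
        ∂(ξ ω).map Z) := (measurable_expNeg_lintegral m3).comp hξZ
  rw [lintegral_const_mul _ m4,
    hξ.laplace_map (z₀ := z₀) hZ m3 (by simp [markExponent_self, h0])]
  congr 2
  refine setLIntegral_congr_fun (measurableSet_singleton z₀).compl fun z hz => ?_
  rw [expNeg_add, expNeg_add, expNeg_markExponent _ _ hz, expNeg_markExponent _ _ hz]

lemma one_sub_mul_of_eq_one {p q : ℝ≥0∞} (hp : p ≤ 1) (hq : q ≤ 1) (h : p = 1 ∨ q = 1) :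
    1 - p * q = (1 - p * 1) + (1 - 1 * q) := by
  rcases h with rfl | rfl <;> simp

/-- If the disintegration factorizes and no point has `X ≠ x₀`, `Y ≠ y₀`, `Z = z₀`, then the
projections of the Poisson process are conditionally independent. -/
theorem PuncturedCI.IsPoissonProcess.condIndepUnder [IsMarkovKernel κ]
    (hξ : IsPoissonProcess ξ Λ P)
    (hD : Disintegrates Λ X Y Z z₀ κ) (hX : Measurable X) (hY : Measurable Y) (hZ : Measurable Z)
    (hx₀ : Λ (X ⁻¹' {x₀}) = 0 ∨ Λ (X ⁻¹' {x₀}) = ∞)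
    (hy₀ : Λ (Y ⁻¹' {y₀}) = 0 ∨ Λ (Y ⁻¹' {y₀}) = ∞)
    (hz₀ : Λ (Z ⁻¹' {z₀}) = 0 ∨ Λ (Z ⁻¹' {z₀}) = ∞)
    (hnull : Λ {s | X s ≠ x₀ ∧ Y s ≠ y₀ ∧ Z s = z₀} = 0)
    (hfac : ∀ᵐ z ∂(Λ.map Z).restrict {z₀}ᶜ, κ z = (κ.fst z).prod (κ.snd z)) :
    CondIndepUnder (fun ω => (ξ ω).map X) (fun ω => (ξ ω).map Y) (fun ω => (ξ ω).map Z) P := by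
  have hξX := hξ.measurable_map hX
  have hξY := hξ.measurable_map hY
  have hξZ := hξ.measurable_map hZ
  -- These factors carry the values of test functions at `x₀` and `y₀`, so the product formula is
  -- needed only for functions vanishing there.
  choose ε hε using hξ.ae_expNeg_eq hX hx₀
  choose δ hδ using hξ.ae_expNeg_eq hY hy₀
  have mα : ∀ f : α → ℝ≥0∞, Measurable f → Measurable (({x₀}ᶜ : Set α).indicator f) :=
    fun f hf => hf.indicator (measurableSet_singleton _).compl
  have mβ : ∀ f : β → ℝ≥0∞, Measurable f → Measurable (({y₀}ᶜ : Set β).indicator f) :=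
    fun f hf => hf.indicator (measurableSet_singleton _).compl
  have mα₀ : Measurable (0 : α → ℝ≥0∞) := measurable_const
  have mβ₀ : Measurable (0 : β → ℝ≥0∞) := measurable_const
  have mf : ∀ f : α → ℝ≥0∞, Measurable f →
      Measurable fun ω => expNeg (∫⁻ x, f x ∂(ξ ω).map X) :=
    fun f hf => (measurable_expNeg_lintegral hf).comp hξX
  have mg : ∀ f : β → ℝ≥0∞, Measurable f →
      Measurable fun ω => expNeg (∫⁻ x, f x ∂(ξ ω).map Y) :=
    fun f hf => (measurable_expNeg_lintegral hf).comp hξY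
  -- the product formula for test functions vanishing at the base points
  have core : ∀ f g, Measurable f → Measurable g → f x₀ = 0 → g y₀ = 0 →
      ∀ φ : Measure γ → ℝ≥0∞, Measurable φ →
      ∫⁻ ω, expNeg (∫⁻ x, f x ∂(ξ ω).map X) * expNeg (∫⁻ y, g y ∂(ξ ω).map Y) *
          φ ((ξ ω).map Z) ∂P =
        ∫⁻ ω, condLaplace Λ X Y Z z₀ κ f 0 ((ξ ω).map Z) *
          condLaplace Λ X Y Z z₀ κ 0 g ((ξ ω).map Z) * φ ((ξ ω).map Z) ∂P := by
    intro f g hf hg f0 g0 φ hφ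
    refine hξ.lintegral_mul_eq_of_laplace (z₀ := z₀) hZ hz₀ ((mf f hf).mul (mg g hg))
      (((measurable_condLaplace hf mβ₀).comp hξZ).mul ((measurable_condLaplace mα₀ hg).comp hξZ))
      ?_ ?_ hφ
    · refine ne_top_of_le_ne_top ENNReal.one_ne_top ?_
      calc _ ≤ ∫⁻ _, 1 ∂P := lintegral_mono fun ω =>
              mul_le_one' (expNeg_le_one _) (expNeg_le_one _)
          _ = 1 := by simp
    · intro h hh h0
      refine (hξ.laplace_joint hD hX hY hZ hf hg hh h0).trans ?_
      have e1 := hξ.lintegral_condLaplace_mul (Λ := Λ) (X := X) (Y := Y) (κ := κ) hZ hf hg hh h0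
      simp only [Function.comp_apply, Pi.mul_apply, e1]
      rw [← expNeg_add (offExponent Λ X Y Z z₀ f 0)]
      congr 2
      -- Over `Z = z₀` almost every point has `X = x₀` or `Y = y₀`, so one of the two exponentials
      -- is `1` and the off-exponent is additive in `f` and `g`.
      · have me : Measurable fun s => 1 - expNeg (f (X s)) * expNeg ((0 : β → ℝ≥0∞) (Y s)) :=
          ((measurable_expNeg.comp (hf.comp hX)).mul
            (measurable_expNeg.comp (mβ₀.comp hY))).const_sub 1
        rw [offExponent, offExponent, offExponent, ← lintegral_add_left me]
        refine lintegral_congr_ae ?_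
        have hn : ∀ᵐ ω ∂Λ, ¬ (X ω ≠ x₀ ∧ Y ω ≠ y₀ ∧ Z ω = z₀) :=
          measure_eq_zero_iff_ae_notMem.1 hnull
        rw [Filter.EventuallyEq, ae_restrict_iff' (hZ (measurableSet_singleton z₀))]
        filter_upwards [hn] with s hs hsz
        simp only [Pi.zero_apply, expNeg_zero]
        refine one_sub_mul_of_eq_one (expNeg_le_one _) (expNeg_le_one _) ?_
        by_contra hcon
        push Not at hcon
        refine hs ⟨fun hx => hcon.1 ?_, fun hy => hcon.2 ?_, hsz⟩
        · rw [hx, f0, expNeg_zero]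
        · rw [hy, g0, expNeg_zero]
      · refine lintegral_congr_ae ?_
        filter_upwards [hfac] with z hz
        congr 2
        have mf' : Measurable fun x => expNeg (f x) := measurable_expNeg.comp hf
        have mg' : Measurable fun y => expNeg (g y) := measurable_expNeg.comp hg
        simp only [markLaplace, Pi.zero_apply, expNeg_zero, mul_one, one_mul]
        rw [hz, lintegral_prod_mul mf'.aemeasurable mg'.aemeasurable,
          Kernel.lintegral_fst _ _ mf', Kernel.lintegral_snd _ _ mg', ← hz]
  have hone : ∀ m, condLaplace Λ X Y Z z₀ κ 0 0 m = 1 := by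
    intro m
    have : ∀ z, markExponent κ z₀ 0 0 z = 0 := fun z => by
      simp [markExponent, markLaplace, expNeg_zero, negLog_one, Set.indicator]
    simp [condLaplace, this, offExponent, expNeg_zero]
  refine condIndepUnder_of_laplace hξX hξY hξZ
    (fun f m => ε f * condLaplace Λ X Y Z z₀ κ (({x₀}ᶜ : Set α).indicator f) 0 m)
    (fun g m => δ g * condLaplace Λ X Y Z z₀ κ 0 (({y₀}ᶜ : Set β).indicator g) m)
    (fun f hf => (measurable_condLaplace (mα f hf) mβ₀).const_mul _)
    ?_ ?_ ?_
  · intro f hf φ hφ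
    -- The one-sided formula is the joint one with the other test function zero; the second
    -- conditional functional is then `1`.
    have e := core _ 0 (mα f hf) mβ₀ (by simp) rfl φ hφ
    have mm : Measurable fun ω => expNeg (∫⁻ x, ({x₀}ᶜ : Set α).indicator f x ∂(ξ ω).map X) *
        φ ((ξ ω).map Z) := (mf _ (mα f hf)).mul (hφ.comp hξZ)
    have mm' : Measurable fun ω => condLaplace Λ X Y Z z₀ κ (({x₀}ᶜ : Set α).indicator f) 0
        ((ξ ω).map Z) * φ ((ξ ω).map Z) :=
      ((measurable_condLaplace (mα f hf) mβ₀).comp hξZ).mul (hφ.comp hξZ)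
    simp only [Pi.zero_apply, lintegral_zero, expNeg_zero, mul_one, hone] at e
    simp only [mul_assoc]
    rw [lintegral_const_mul _ mm', ← e, ← lintegral_const_mul _ mm]
    refine lintegral_congr_ae ((hε f).mono fun ω hω => ?_)
    simp only [hω, mul_assoc]
  · intro g hg φ hφ
    have e := core 0 _ mα₀ (mβ g hg) rfl (by simp) φ hφ
    have mm : Measurable fun ω => expNeg (∫⁻ x, ({y₀}ᶜ : Set β).indicator g x ∂(ξ ω).map Y) *
        φ ((ξ ω).map Z) := (mg _ (mβ g hg)).mul (hφ.comp hξZ)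
    have mm' : Measurable fun ω => condLaplace Λ X Y Z z₀ κ 0 (({y₀}ᶜ : Set β).indicator g)
        ((ξ ω).map Z) * φ ((ξ ω).map Z) :=
      ((measurable_condLaplace mα₀ (mβ g hg)).comp hξZ).mul (hφ.comp hξZ)
    simp only [Pi.zero_apply, lintegral_zero, expNeg_zero, one_mul, hone] at e
    simp only [mul_assoc]
    rw [lintegral_const_mul _ mm', ← e, ← lintegral_const_mul _ mm]
    refine lintegral_congr_ae ((hδ g).mono fun ω hω => ?_)
    simp only [hω, mul_assoc]
  · intro f g hf hg φ hφ
    have e := core _ _ (mα f hf) (mβ g hg) (by simp) (by simp) φ hφ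
    have mm : Measurable fun ω => expNeg (∫⁻ x, ({x₀}ᶜ : Set α).indicator f x ∂(ξ ω).map X) *
        expNeg (∫⁻ x, ({y₀}ᶜ : Set β).indicator g x ∂(ξ ω).map Y) * φ ((ξ ω).map Z) :=
      ((mf _ (mα f hf)).mul (mg _ (mβ g hg))).mul (hφ.comp hξZ)
    have mm' : Measurable fun ω =>
        condLaplace Λ X Y Z z₀ κ (({x₀}ᶜ : Set α).indicator f) 0 ((ξ ω).map Z) *
        condLaplace Λ X Y Z z₀ κ 0 (({y₀}ᶜ : Set β).indicator g) ((ξ ω).map Z) *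
          φ ((ξ ω).map Z) :=
      (((measurable_condLaplace (mα f hf) mβ₀).comp hξZ).mul
        ((measurable_condLaplace mα₀ (mβ g hg)).comp hξZ)).mul (hφ.comp hξZ)
    have e2 : ∀ p q r s t : ℝ≥0∞, p * q * (r * s) * t = p * r * (q * s * t) := by
      intros; ring
    simp only [e2]
    rw [lintegral_const_mul _ mm', ← e, ← lintegral_const_mul _ mm]
    refine lintegral_congr_ae ?_
    filter_upwards [hε f, hδ g] with ω h1 h2
    rw [h1, h2]
    ring

end PoissonProjection

/-! ### From conditionally independent projections to factorization -/

lemma indepSet_compl_left {Ω : Type*} [MeasurableSpace Ω] {μ : Measure Ω} {s t : Set Ω}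
    (h : IndepSet s t μ) : IndepSet sᶜ t μ := by
  rw [IndepSet_iff_Indep] at h ⊢
  refine indep_of_indep_of_le_left h (MeasurableSpace.generateFrom_le ?_)
  rintro _ rfl
  exact (MeasurableSpace.measurableSet_generateFrom (Set.mem_singleton s)).compl

lemma indepSet_of_compl {Ω : Type*} [MeasurableSpace Ω] {μ : Measure Ω} {s t : Set Ω}
    (h : IndepSet sᶜ tᶜ μ) : IndepSet s t μ := by
  have := indepSet_compl_left (indepSet_compl_left h.symm).symm
  rwa [compl_compl, compl_compl] at this

/-- Phrasing the rectangle identity as independence of two events makes it stable under complements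
of `s` and of `t`. -/
lemma indepSet_fst_snd_iff {γ α β : Type*} [MeasurableSpace γ] [MeasurableSpace α]
    [MeasurableSpace β] {κ : Kernel γ (α × β)} [IsMarkovKernel κ] {s : Set α} {t : Set β}
    (hs : MeasurableSet s) (ht : MeasurableSet t) (z : γ) :
    IndepSet (Prod.fst ⁻¹' s) (Prod.snd ⁻¹' t) (κ z) ↔
      κ z (s ×ˢ t) = κ.fst z s * κ.snd z t := by
  have h1 : MeasurableSet (Prod.fst ⁻¹' s : Set (α × β)) := measurable_fst hs
  have h2 : MeasurableSet (Prod.snd ⁻¹' t : Set (α × β)) := measurable_snd ht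
  refine (indepSet_iff_measure_inter_eq_mul h1 h2 (κ z)).trans ?_
  rw [Kernel.fst_apply' _ _ hs, Kernel.snd_apply' _ _ ht]
  rfl

/-- An integral identity that can be localized to sets of finite measure determines the
integrand. -/
lemma ae_eq_of_localized_identity {γ : Type*} [MeasurableSpace γ] {ν : Measure γ} [SigmaFinite ν]
    {k k' : γ → ℝ≥0∞} (hk : Measurable k) (hk' : Measurable k') (h1 : ∀ z, k z ≤ 1)
    (h1' : ∀ z, k' z ≤ 1) {I I' : ℝ≥0∞} (hI : I ≠ ∞)
    (hfin : ∫⁻ z, (1 - k z) ∂ν ≠ ∞)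
    (h : ∀ u, MeasurableSet u → I + (ν u + ∫⁻ z in uᶜ, (1 - k z) ∂ν) =
      I' + (ν u + ∫⁻ z in uᶜ, (1 - k' z) ∂ν)) : k =ᵐ[ν] k' ∧ I = I' := by
  have mk : Measurable fun z => 1 - k z := hk.const_sub 1
  have mk' : Measurable fun z => 1 - k' z := hk'.const_sub 1
  have h0 := h ∅ MeasurableSet.empty
  simp only [measure_empty, zero_add, Set.compl_empty, Measure.restrict_univ] at h0
  have hae : (fun z => 1 - k z) =ᵐ[ν] fun z => 1 - k' z := by
    refine ae_eq_of_forall_setLIntegral_eq_of_sigmaFinite mk mk' fun u hu huf => ?_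
    have h2 := h u hu
    -- Cancel the finite `ν u`, then compare with the identity for the empty set: what remains is
    -- equality of the integrals over `u`.
    rw [add_left_comm, add_left_comm I'] at h2
    have h3 := (ENNReal.add_right_inj huf.ne).1 h2
    rw [← lintegral_add_compl (fun z => 1 - k z) hu, ← lintegral_add_compl (fun z => 1 - k' z) hu,
      add_left_comm, add_left_comm I', ← h3] at h0
    refine (ENNReal.add_left_inj ?_).1 h0
    exact ENNReal.add_ne_top.2 ⟨hI, ne_top_of_le_ne_top hfin (setLIntegral_le_lintegral _ _)⟩
  constructor
  · filter_upwards [hae] with z hz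
    rw [← ENNReal.sub_sub_cancel ENNReal.one_ne_top (h1 z), hz,
      ENNReal.sub_sub_cancel ENNReal.one_ne_top (h1' z)]
  · rw [lintegral_congr_ae hae] at h0 hfin
    exact (ENNReal.add_left_inj hfin).1 h0

section PoissonProjection

variable {Ω S α β γ : Type*} [MeasurableSpace Ω] [MeasurableSpace S] [MeasurableSpace α]
  [MeasurableSpace β] [MeasurableSpace γ] [MeasurableSingletonClass γ]
  {ξ : Ω → Measure S} {P : Measure Ω} [IsProbabilityMeasure P]
  {X : S → α} {Y : S → β} {Z : S → γ}
  {Λ : Measure S} {x₀ : α} {y₀ : β} {z₀ : γ} {κ : Kernel γ (α × β)}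

lemma expNeg_indicator_top {δ : Type*} (s : Set δ) (x : δ) :
    expNeg (s.indicator (fun _ => ∞) x) = sᶜ.indicator 1 x := by
  by_cases h : x ∈ s <;> simp [h, expNeg_zero, expNeg_top]

lemma expNeg_lintegral_indicator_top {δ : Type*} [MeasurableSpace δ] {s : Set δ}
    (hs : MeasurableSet s) (m : Measure δ) :
    expNeg (∫⁻ x, s.indicator (fun _ => ∞) x ∂m) =
      ({m | m s = 0} : Set (Measure δ)).indicator 1 m := by
  rw [lintegral_indicator hs, setLIntegral_const]
  by_cases h : m s = 0
  · simp [h, expNeg_zero]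
  · simp [h, ENNReal.top_mul, expNeg_top]

lemma measurableSet_measure_eq_zero {δ : Type*} [MeasurableSpace δ] {s : Set δ}
    (hs : MeasurableSet s) : MeasurableSet {m : Measure δ | m s = 0} :=
  (Measure.measurable_coe hs) (measurableSet_singleton 0)

/-- The consequence of conditional independence for the events that no point is projected to
given sets of finite mean measure. -/
lemma PuncturedCI.IsPoissonProcess.factor_of_void [IsMarkovKernel κ]
    (hξ : IsPoissonProcess ξ Λ P)
    (hD : Disintegrates Λ X Y Z z₀ κ) (hX : Measurable X) (hY : Measurable Y) (hZ : Measurable Z)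
    (hz₀ : Λ (Z ⁻¹' {z₀}) = 0 ∨ Λ (Z ⁻¹' {z₀}) = ∞)
    {T : ℕ → Set γ} (hT : Exhausts T z₀ (Λ.map Z))
    (hCI : CondIndepUnder (fun ω => (ξ ω).map X) (fun ω => (ξ ω).map Y) (fun ω => (ξ ω).map Z) P)
    {s : Set α} {t : Set β} (hs : MeasurableSet s) (ht : MeasurableSet t)
    (hsf : Λ (X ⁻¹' s) ≠ ∞) (htf : Λ (Y ⁻¹' t) ≠ ∞) :
    Λ (X ⁻¹' s ∩ Y ⁻¹' t ∩ Z ⁻¹' {z₀}) = 0 ∧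
      ∀ᵐ z ∂(Λ.map Z).restrict {z₀}ᶜ, κ z (s ×ˢ t) = κ.fst z s * κ.snd z t := by
  have hξX := hξ.measurable_map hX
  have hξY := hξ.measurable_map hY
  have hξZ := hξ.measurable_map hZ
  have hz : MeasurableSet ({z₀} : Set γ) := measurableSet_singleton z₀
  have hσ : SigmaFinite ((Λ.map Z).restrict {z₀}ᶜ) := hT.sigmaFinite
  -- With value `∞` on `s`, the exponential of the integral is the indicator of the event that no
  -- point projects into `s`.
  set f : α → ℝ≥0∞ := s.indicator fun _ => ∞ with hf_def
  set g : β → ℝ≥0∞ := t.indicator fun _ => ∞ with hg_def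
  have hf : Measurable f := measurable_const.indicator hs
  have hg : Measurable g := measurable_const.indicator ht
  have mα₀ : Measurable (0 : α → ℝ≥0∞) := measurable_const
  have mβ₀ : Measurable (0 : β → ℝ≥0∞) := measurable_const
  have hE : MeasurableSet {m : Measure α | m s = 0} := measurableSet_measure_eq_zero hs
  have hE' : MeasurableSet {m : Measure β | m t = 0} := measurableSet_measure_eq_zero ht
  have ef : ∀ ω, expNeg (∫⁻ x, f x ∂(ξ ω).map X) =
      ((fun ω => (ξ ω).map X) ⁻¹' {m | m s = 0}).indicator 1 ω := fun ω =>
    expNeg_lintegral_indicator_top hs _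
  have eg : ∀ ω, expNeg (∫⁻ x, g x ∂(ξ ω).map Y) =
      ((fun ω => (ξ ω).map Y) ⁻¹' {m | m t = 0}).indicator 1 ω := fun ω =>
    expNeg_lintegral_indicator_top ht _
  have v1 : IsVersion (condLaplace Λ X Y Z z₀ κ f 0)
      ((fun ω => (ξ ω).map X) ⁻¹' {m | m s = 0}) (fun ω => (ξ ω).map Z) P := by
    rw [isVersion_iff hξZ]
    intro u hu
    have := hξ.lintegral_condLaplace hD hX hY hZ hz₀ hf mβ₀ (measurable_one.indicator hu)
    simp only [Pi.zero_apply, lintegral_zero, expNeg_zero, mul_one, ef] at this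
    have hcm : Measurable (u.indicator (condLaplace Λ X Y Z z₀ κ f 0)) :=
      (measurable_condLaplace hf mβ₀).indicator hu
    rw [← lintegral_indicator_one ((hξX hE).inter (hξZ hu)), ← lintegral_indicator hu,
      lintegral_map hcm hξZ]
    calc _ = _ := lintegral_congr fun ω => by
            rw [Set.inter_indicator_one]; rfl
      _ = _ := this
      _ = _ := lintegral_congr fun ω => by
        by_cases hω : (ξ ω).map Z ∈ u <;> simp [hω]
  have v2 : IsVersion (condLaplace Λ X Y Z z₀ κ 0 g)
      ((fun ω => (ξ ω).map Y) ⁻¹' {m | m t = 0}) (fun ω => (ξ ω).map Z) P := by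
    rw [isVersion_iff hξZ]
    intro u hu
    have := hξ.lintegral_condLaplace hD hX hY hZ hz₀ mα₀ hg (measurable_one.indicator hu)
    simp only [Pi.zero_apply, lintegral_zero, expNeg_zero, one_mul, eg] at this
    have hcm : Measurable (u.indicator (condLaplace Λ X Y Z z₀ κ 0 g)) :=
      (measurable_condLaplace mα₀ hg).indicator hu
    rw [← lintegral_indicator_one ((hξY hE').inter (hξZ hu)), ← lintegral_indicator hu,
      lintegral_map hcm hξZ]
    calc _ = _ := lintegral_congr fun ω => by
            rw [Set.inter_indicator_one]; rfl
      _ = _ := this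
      _ = _ := lintegral_congr fun ω => by
        by_cases hω : (ξ ω).map Z ∈ u <;> simp [hω]
  have m1 := measurable_condLaplace (Λ := Λ) (X := X) (Y := Y) (Z := Z) (z₀ := z₀) (κ := κ) hf mβ₀
  have m2 := measurable_condLaplace (Λ := Λ) (X := X) (Y := Y) (Z := Z) (z₀ := z₀) (κ := κ) mα₀ hg
  have v := hCI.isVersion_mul hE hE' m1 m2 v1 v2
  -- the identity of Laplace functionals
  have key : ∀ h : γ → ℝ≥0∞, Measurable h → h z₀ = 0 →
      offExponent Λ X Y Z z₀ f g +
        ∫⁻ z in {z₀}ᶜ, (1 - markLaplace κ f g z * expNeg (h z)) ∂(Λ.map Z) =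
      (offExponent Λ X Y Z z₀ f 0 + offExponent Λ X Y Z z₀ 0 g) +
        ∫⁻ z in {z₀}ᶜ, (1 - markLaplace κ f 0 z * markLaplace κ 0 g z * expNeg (h z))
          ∂(Λ.map Z) := by
    intro h hh h0
    apply expNeg_injective
    rw [expNeg_add, expNeg_add _ (∫⁻ _ in _, _ ∂_), expNeg_add,
      ← hξ.laplace_joint hD hX hY hZ hf hg hh h0,
      ← hξ.lintegral_condLaplace_mul (Λ := Λ) (X := X) (Y := Y) (κ := κ) hZ hf hg hh h0]
    have := v.lintegral_mul hξZ ((hξX hE).inter (hξY hE')) (m1.mul m2)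
      (measurable_expNeg_lintegral hh)
    refine Eq.trans (lintegral_congr fun ω => ?_) this
    rw [Set.inter_indicator_one, ef, eg]
    rfl
  -- the ingredients in terms of measures
  have k1 : ∀ z, markLaplace κ f g z = κ z (sᶜ ×ˢ tᶜ) := by
    intro z
    rw [← lintegral_indicator_one (hs.compl.prod ht.compl)]
    refine lintegral_congr fun w => ?_
    rw [expNeg_indicator_top, expNeg_indicator_top]
    by_cases hw1 : w.1 ∈ s <;> by_cases hw2 : w.2 ∈ t <;> simp [Set.indicator, hw1, hw2, Set.mem_prod]
  have k2 : ∀ z, markLaplace κ f 0 z = κ.fst z sᶜ := by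
    intro z
    have e : κ.fst z sᶜ = κ z (Prod.fst ⁻¹' sᶜ) := Kernel.fst_apply' _ _ hs.compl
    rw [e, ← lintegral_indicator_one (measurable_fst hs.compl)]
    refine lintegral_congr fun w => ?_
    rw [expNeg_indicator_top, Pi.zero_apply, expNeg_zero, mul_one]
    rfl
  have k3 : ∀ z, markLaplace κ 0 g z = κ.snd z tᶜ := by
    intro z
    have e : κ.snd z tᶜ = κ z (Prod.snd ⁻¹' tᶜ) := Kernel.snd_apply' _ _ ht.compl
    rw [e, ← lintegral_indicator_one (measurable_snd ht.compl)]
    refine lintegral_congr fun w => ?_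
    rw [expNeg_indicator_top, Pi.zero_apply, expNeg_zero, one_mul]
    rfl
  have o1 : offExponent Λ X Y Z z₀ f g = Λ.restrict (Z ⁻¹' {z₀}) (X ⁻¹' s ∪ Y ⁻¹' t) := by
    rw [offExponent, ← lintegral_indicator_one ((hX hs).union (hY ht))]
    refine lintegral_congr fun w => ?_
    rw [expNeg_indicator_top, expNeg_indicator_top]
    by_cases hw1 : X w ∈ s <;> by_cases hw2 : Y w ∈ t <;> simp [Set.indicator, hw1, hw2]
  have o2 : offExponent Λ X Y Z z₀ f 0 = Λ.restrict (Z ⁻¹' {z₀}) (X ⁻¹' s) := by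
    rw [offExponent, ← lintegral_indicator_one (hX hs)]
    refine lintegral_congr fun w => ?_
    rw [expNeg_indicator_top, Pi.zero_apply, expNeg_zero]
    by_cases hw1 : X w ∈ s <;> simp [Set.indicator, hw1]
  have o3 : offExponent Λ X Y Z z₀ 0 g = Λ.restrict (Z ⁻¹' {z₀}) (Y ⁻¹' t) := by
    rw [offExponent, ← lintegral_indicator_one (hY ht)]
    refine lintegral_congr fun w => ?_
    rw [expNeg_indicator_top, Pi.zero_apply, expNeg_zero]
    by_cases hw1 : Y w ∈ t <;> simp [Set.indicator, hw1]
  have f1 : Λ.restrict (Z ⁻¹' {z₀}) (X ⁻¹' s) ≠ ∞ :=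
    ne_top_of_le_ne_top hsf (Measure.restrict_apply_le _ _)
  have f2 : Λ.restrict (Z ⁻¹' {z₀}) (Y ⁻¹' t) ≠ ∞ :=
    ne_top_of_le_ne_top htf (Measure.restrict_apply_le _ _)
  have f3 : Λ.restrict (Z ⁻¹' {z₀}) (X ⁻¹' s ∪ Y ⁻¹' t) ≠ ∞ :=
    ne_top_of_le_ne_top (ENNReal.add_ne_top.2 ⟨f1, f2⟩) (measure_union_le _ _)
  have hfin : ∫⁻ z in {z₀}ᶜ, (1 - markLaplace κ f g z) ∂(Λ.map Z) ≠ ∞ := by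
    have hle : ∀ z, 1 - markLaplace κ f g z ≤ κ z (s ×ˢ Set.univ) + κ z (Set.univ ×ˢ t) := by
      intro z
      rw [k1, tsub_le_iff_right, ← measure_univ (μ := κ z)]
      refine (measure_mono ?_).trans ((measure_union_le _ _).trans
        (add_le_add_left (measure_union_le _ _) _))
      intro w _
      by_cases hw1 : w.1 ∈ s <;> by_cases hw2 : w.2 ∈ t <;> simp [hw1, hw2]
    refine ne_top_of_le_ne_top ?_ (lintegral_mono hle)
    rw [lintegral_add_left (κ.measurable_coe (hs.prod MeasurableSet.univ)),
      ← hD.measure_inter hX hY hZ hs MeasurableSet.univ hz.compl (by simp),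
      ← hD.measure_inter hX hY hZ MeasurableSet.univ ht hz.compl (by simp)]
    exact ENNReal.add_ne_top.2 ⟨ne_top_of_le_ne_top hsf (measure_mono fun ω hω => hω.1.1),
      ne_top_of_le_ne_top htf (measure_mono fun ω hω => hω.1.2)⟩
  -- Taking `h` infinite on `u` away from `z₀` replaces the integrand by `1` on `u`, so the identity
  -- can be localized.
  have loc : ∀ k : γ → ℝ≥0∞, Measurable k → ∀ u, MeasurableSet u →
      ∫⁻ z in {z₀}ᶜ, (1 - k z * expNeg ((u ∩ {z₀}ᶜ).indicator (fun _ => ∞) z)) ∂(Λ.map Z) =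
      (Λ.map Z).restrict {z₀}ᶜ u + ∫⁻ z in uᶜ, (1 - k z) ∂(Λ.map Z).restrict {z₀}ᶜ := by
    intro k hk u hu
    rw [← lintegral_add_compl _ hu, ← setLIntegral_one]
    congr 1
    · rw [Measure.restrict_restrict hu]
      refine setLIntegral_congr_fun (hu.inter hz.compl) fun z hz' => ?_
      rw [expNeg_indicator_top]
      simp [hz'.1, show z ≠ z₀ from hz'.2]
    · refine setLIntegral_congr_fun hu.compl fun z hz' => ?_
      have : z ∉ u := hz'
      rw [expNeg_indicator_top]
      simp [this]
  have mk1 := measurable_markLaplace (κ := κ) hf hg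
  have mk2 : Measurable fun z => markLaplace κ f 0 z * markLaplace κ 0 g z :=
    (measurable_markLaplace (κ := κ) hf mβ₀).mul (measurable_markLaplace (κ := κ) mα₀ hg)
  obtain ⟨r1, r2⟩ := ae_eq_of_localized_identity mk1 mk2 (markLaplace_le_one f g)
    (fun z => mul_le_one' (markLaplace_le_one f 0 z) (markLaplace_le_one 0 g z))
    (I := offExponent Λ X Y Z z₀ f g)
    (I' := offExponent Λ X Y Z z₀ f 0 + offExponent Λ X Y Z z₀ 0 g)
    (by rw [o1]; exact f3) hfin
    (fun u hu => by
      have := key ((u ∩ {z₀}ᶜ).indicator fun _ => ∞)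
        (measurable_const.indicator (hu.inter hz.compl)) (by simp)
      rwa [loc _ mk1 u hu, loc _ mk2 u hu] at this)
  constructor
  · rw [o1, o2, o3] at r2
    -- The off-exponents say that the mass of the union is the sum of the masses; since it is
    -- finite, the intersection is null.
    have := measure_union_add_inter (μ := Λ.restrict (Z ⁻¹' {z₀})) (X ⁻¹' s) (hY ht)
    rw [← r2] at this
    have h0 : Λ.restrict (Z ⁻¹' {z₀}) (X ⁻¹' s ∩ Y ⁻¹' t) = 0 :=
      (ENNReal.add_right_inj f3).1 (this.trans (add_zero _).symm)
    rwa [Measure.restrict_apply ((hX hs).inter (hY ht))] at h0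
  · filter_upwards [r1] with z hz'
    rw [k1, k2, k3] at hz'
    rw [← indepSet_fst_snd_iff hs ht]
    exact indepSet_of_compl ((indepSet_fst_snd_iff hs.compl ht.compl z).2 hz')

/-- If the projections of the Poisson process are conditionally independent, then no point has
`X ≠ x₀`, `Y ≠ y₀`, `Z = z₀`, and the disintegration factorizes. -/
theorem PuncturedCI.IsPoissonProcess.factor_of_condIndepUnder
    [MeasurableSpace.CountablyGenerated α] [MeasurableSpace.CountablyGenerated β]
    [IsMarkovKernel κ] (hξ : IsPoissonProcess ξ Λ P)
    (hD : Disintegrates Λ X Y Z z₀ κ) (hX : Measurable X) (hY : Measurable Y) (hZ : Measurable Z)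
    (hz₀ : Λ (Z ⁻¹' {z₀}) = 0 ∨ Λ (Z ⁻¹' {z₀}) = ∞)
    {T : ℕ → Set γ} (hT : Exhausts T z₀ (Λ.map Z)) {TX : ℕ → Set α}
    (hTX : Exhausts TX x₀ (Λ.map X)) {TY : ℕ → Set β} (hTY : Exhausts TY y₀ (Λ.map Y))
    (hCI : CondIndepUnder (fun ω => (ξ ω).map X) (fun ω => (ξ ω).map Y)
      (fun ω => (ξ ω).map Z) P) :
    Λ {s | X s ≠ x₀ ∧ Y s ≠ y₀ ∧ Z s = z₀} = 0 ∧
      ∀ᵐ z ∂(Λ.map Z).restrict {z₀}ᶜ, κ z = (κ.fst z).prod (κ.snd z) := by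
  have fX : ∀ n, Λ (X ⁻¹' TX n) < ∞ := fun n => by
    rw [← Measure.map_apply hX (hTX.measurableSet n)]; exact hTX.lt_top n
  have fY : ∀ n, Λ (Y ⁻¹' TY n) < ∞ := fun n => by
    rw [← Measure.map_apply hY (hTY.measurableSet n)]; exact hTY.lt_top n
  -- The void argument requires sets of finite mean measure, hence the intersections with the
  -- exhausting sets.
  have main : ∀ (s : Set α) (t : Set β), MeasurableSet s → MeasurableSet t → ∀ n,
      Λ (X ⁻¹' (s ∩ TX n) ∩ Y ⁻¹' (t ∩ TY n) ∩ Z ⁻¹' {z₀}) = 0 ∧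
      ∀ᵐ z ∂(Λ.map Z).restrict {z₀}ᶜ, κ z ((s ∩ TX n) ×ˢ (t ∩ TY n)) =
        κ.fst z (s ∩ TX n) * κ.snd z (t ∩ TY n) := fun s t hs ht n =>
    hξ.factor_of_void hD hX hY hZ hz₀ hT hCI (hs.inter (hTX.measurableSet n))
      (ht.inter (hTY.measurableSet n))
      ((measure_mono (Set.preimage_mono Set.inter_subset_right)).trans_lt (fX n)).ne
      ((measure_mono (Set.preimage_mono Set.inter_subset_right)).trans_lt (fY n)).ne
  constructor
  · have hsub : {s | X s ≠ x₀ ∧ Y s ≠ y₀ ∧ Z s = z₀} ⊆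
        ⋃ n, X ⁻¹' (Set.univ ∩ TX n) ∩ Y ⁻¹' (Set.univ ∩ TY n) ∩ Z ⁻¹' {z₀} := by
      rintro w ⟨h1, h2, h3⟩
      have h1' : X w ∈ ⋃ n, TX n := by rw [hTX.iUnion]; exact h1
      have h2' : Y w ∈ ⋃ n, TY n := by rw [hTY.iUnion]; exact h2
      obtain ⟨n, hn⟩ := Set.mem_iUnion.1 h1'
      obtain ⟨m, hm⟩ := Set.mem_iUnion.1 h2'
      exact Set.mem_iUnion.2 ⟨max n m, ⟨⟨trivial, hTX.mono (le_max_left _ _) hn⟩,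
        ⟨trivial, hTY.mono (le_max_right _ _) hm⟩⟩, h3⟩
    exact measure_mono_null hsub (measure_iUnion_null fun n =>
      (main Set.univ Set.univ MeasurableSet.univ MeasurableSet.univ n).1)
  · refine ae_eq_prod_of_rectangles hT ?_
    have off : ∀ (s : Set α) (t : Set β), MeasurableSet s → MeasurableSet t → x₀ ∉ s → y₀ ∉ t →
        ∀ᵐ z ∂(Λ.map Z).restrict {z₀}ᶜ, κ z (s ×ˢ t) = κ.fst z s * κ.snd z t := by
      intro s t hs ht hxs hyt
      have us : ⋃ n, s ∩ TX n = s := by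
        rw [← Set.inter_iUnion, hTX.iUnion]
        exact Set.inter_eq_left.2 fun x hx hx' => hxs (Set.mem_singleton_iff.1 hx' ▸ hx)
      have ut : ⋃ n, t ∩ TY n = t := by
        rw [← Set.inter_iUnion, hTY.iUnion]
        exact Set.inter_eq_left.2 fun x hx hx' => hyt (Set.mem_singleton_iff.1 hx' ▸ hx)
      have ms : Monotone fun n => s ∩ TX n := fun a b hab =>
        Set.inter_subset_inter_right _ (hTX.mono hab)
      have mt : Monotone fun n => t ∩ TY n := fun a b hab =>
        Set.inter_subset_inter_right _ (hTY.mono hab)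
      have mst : Monotone fun n => (s ∩ TX n) ×ˢ (t ∩ TY n) := fun a b hab =>
        Set.prod_mono (ms hab) (mt hab)
      have ust : ⋃ n, (s ∩ TX n) ×ˢ (t ∩ TY n) = s ×ˢ t := by
        rw [Set.iUnion_prod_of_monotone ms mt, us, ut]
      have hall := ae_all_iff.2 fun n => (main s t hs ht n).2
      filter_upwards [hall] with z hz
      have l1 := tendsto_measure_iUnion_atTop (μ := κ z) mst
      have l2 := tendsto_measure_iUnion_atTop (μ := κ.fst z) ms
      have l3 := tendsto_measure_iUnion_atTop (μ := κ.snd z) mt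
      rw [ust] at l1
      rw [us] at l2
      rw [ut] at l3
      refine tendsto_nhds_unique (l1.congr fun n => hz n)
        (ENNReal.Tendsto.mul l2 (Or.inr (measure_ne_top _ _)) l3 (Or.inr (measure_ne_top _ _)))
    intro s t hs ht
    -- The exhaustion reaches only sets that avoid the base points; a set containing its base point
    -- is replaced by its complement.
    by_cases hxs : x₀ ∈ s <;> by_cases hyt : y₀ ∈ t
    · filter_upwards [off sᶜ tᶜ hs.compl ht.compl (by simpa) (by simpa)] with z hz
      rw [← indepSet_fst_snd_iff hs ht]
      exact indepSet_of_compl ((indepSet_fst_snd_iff hs.compl ht.compl z).2 hz)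
    · filter_upwards [off sᶜ t hs.compl ht (by simpa) hyt] with z hz
      rw [← indepSet_fst_snd_iff hs ht]
      have := indepSet_compl_left ((indepSet_fst_snd_iff hs.compl ht z).2 hz)
      rwa [← Set.preimage_compl, compl_compl] at this
    · filter_upwards [off s tᶜ hs ht.compl hxs (by simpa)] with z hz
      rw [← indepSet_fst_snd_iff hs ht]
      have := (indepSet_compl_left ((indepSet_fst_snd_iff hs ht.compl z).2 hz).symm).symm
      rwa [← Set.preimage_compl, compl_compl] at this
    · exact off s t hs ht hxs hyt

end PoissonProjection

/-! ### Existence and uniqueness of disintegrations -/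

section Existence

variable {S α β γ : Type*} [MeasurableSpace S] [MeasurableSpace α] [MeasurableSpace β]
  [MeasurableSpace γ] {Λ : Measure S}
  {X : S → α} {Y : S → β} {Z : S → γ} {z₀ : γ}

/-- Disintegrations only depend on the joint law of the variables off the base point. -/
lemma Disintegrates.of_lintegral_eq {S' : Type*} [MeasurableSpace S'] {Λ' : Measure S'}
    {X' : S' → α} {Y' : S' → β} {Z' : S' → γ} {κ : Kernel γ (α × β)}
    (hD : Disintegrates Λ X Y Z z₀ κ)
    (h : ∀ Φ : γ × α × β → ℝ≥0∞, Measurable Φ →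
      ∫⁻ s in Z ⁻¹' {z₀}ᶜ, Φ (Z s, X s, Y s) ∂Λ = ∫⁻ s in Z' ⁻¹' {z₀}ᶜ, Φ (Z' s, X' s, Y' s) ∂Λ')
    (hm : (Λ.map Z).restrict {z₀}ᶜ = (Λ'.map Z').restrict {z₀}ᶜ) :
    Disintegrates Λ' X' Y' Z' z₀ κ := by
  intro Φ hΦ
  rw [← h Φ hΦ, hD Φ hΦ, hm]

/-- Every measure with σ-finite first marginal has a disintegrating probability kernel. -/
lemma exists_lintegral_eq_of_sigmaFinite_fst [StandardBorelSpace α] [Nonempty α]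
    (ρ : Measure (γ × α)) [SigmaFinite ρ.fst] :
    ∃ κ : Kernel γ α, IsMarkovKernel κ ∧ ∀ Φ : γ × α → ℝ≥0∞, Measurable Φ →
      ∫⁻ p, Φ p ∂ρ = ∫⁻ z, ∫⁻ w, Φ (z, w) ∂(κ z) ∂ρ.fst := by
  -- A positive integrable weight depending on the first coordinate makes the measure finite; its
  -- conditional kernel serves for the original measure once the weight is divided out.
  obtain ⟨g, hg0, hgm, hg⟩ := exists_pos_lintegral_lt_of_sigmaFinite ρ.fst one_ne_zero
  have hgm' : Measurable fun z => (g z : ℝ≥0∞) := hgm.coe_nnreal_ennreal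
  have hgp : Measurable fun p : γ × α => (g p.1 : ℝ≥0∞) := hgm'.comp measurable_fst
  have hfin : IsFiniteMeasure (ρ.withDensity fun p => (g p.1 : ℝ≥0∞)) := by
    refine isFiniteMeasure_withDensity ?_
    rw [Measure.fst, lintegral_map hgm' measurable_fst] at hg
    exact (hg.trans ENNReal.one_lt_top).ne
  set ρ' := ρ.withDensity fun p => (g p.1 : ℝ≥0∞) with hρ'
  have hfst : ρ'.fst = ρ.fst.withDensity fun z => (g z : ℝ≥0∞) := by
    ext u hu
    rw [Measure.fst_apply hu, withDensity_apply _ (measurable_fst hu), withDensity_apply _ hu,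
      Measure.fst, setLIntegral_map hu hgm' measurable_fst]
  refine ⟨ρ'.condKernel, inferInstance, fun Φ hΦ => ?_⟩
  have hΦ' : Measurable fun p : γ × α => Φ p / g p.1 := hΦ.div hgp
  have e1 : ∫⁻ p, Φ p ∂ρ = ∫⁻ p, Φ p / g p.1 ∂ρ' := by
    rw [hρ', lintegral_withDensity_eq_lintegral_mul _ hgp hΦ']
    refine lintegral_congr fun p => ?_
    exact (ENNReal.mul_div_cancel (by exact_mod_cast (hg0 p.1).ne') ENNReal.coe_ne_top).symm
  have e2 : ∫⁻ p, Φ p / g p.1 ∂ρ' =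
      ∫⁻ z, ∫⁻ w, Φ (z, w) / g z ∂(ρ'.condKernel z) ∂ρ'.fst := by
    conv_lhs => rw [← ρ'.disintegrate ρ'.condKernel]
    exact Measure.lintegral_compProd hΦ'
  rw [e1, e2, hfst, lintegral_withDensity_eq_lintegral_mul _ hgm'
      (Measurable.lintegral_kernel_prod_right' hΦ')]
  refine lintegral_congr fun z => ?_
  simp only [Pi.mul_apply]
  rw [← lintegral_const_mul' _ _ ENNReal.coe_ne_top]
  refine lintegral_congr fun w => ?_
  exact ENNReal.mul_div_cancel (by exact_mod_cast (hg0 z).ne') ENNReal.coe_ne_top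

variable [MeasurableSingletonClass γ]

lemma exists_disintegrates [StandardBorelSpace α] [Nonempty α] [StandardBorelSpace β] [Nonempty β]
    (hX : Measurable X) (hY : Measurable Y) (hZ : Measurable Z)
    {T : ℕ → Set γ} (hT : Exhausts T z₀ (Λ.map Z)) :
    ∃ κ : Kernel γ (α × β), IsMarkovKernel κ ∧ Disintegrates Λ X Y Z z₀ κ := by
  have hm : Measurable fun s => (Z s, X s, Y s) := hZ.prodMk (hX.prodMk hY)
  have hfst : ((Λ.restrict (Z ⁻¹' {z₀}ᶜ)).map fun s => (Z s, X s, Y s)).fst =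
      (Λ.map Z).restrict {z₀}ᶜ := by
    rw [Measure.fst, Measure.map_map measurable_fst hm,
      Measure.restrict_map hZ (measurableSet_singleton z₀).compl]
    rfl
  have := hT.sigmaFinite
  have : SigmaFinite ((Λ.restrict (Z ⁻¹' {z₀}ᶜ)).map fun s => (Z s, X s, Y s)).fst := by
    rwa [hfst]
  obtain ⟨κ, hκ, h⟩ := exists_lintegral_eq_of_sigmaFinite_fst
    ((Λ.restrict (Z ⁻¹' {z₀}ᶜ)).map fun s => (Z s, X s, Y s))
  refine ⟨κ, hκ, fun Φ hΦ => ?_⟩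
  rw [← lintegral_map hΦ hm, h Φ hΦ, hfst]

/-- The identity on sets is an equality of measures on the product, which therefore extends to all
nonnegative measurable integrands. -/
lemma disintegrates_of_measure_eq {κ : Kernel γ (α × β)} [IsMarkovKernel κ]
    (hX : Measurable X) (hY : Measurable Y) (hZ : Measurable Z)
    {T : ℕ → Set γ} (hT : Exhausts T z₀ (Λ.map Z))
    (h : ∀ G : Set (γ × α × β), MeasurableSet G →
      Λ {s | Z s ≠ z₀ ∧ (Z s, X s, Y s) ∈ G} =
        ∫⁻ z in {z₀}ᶜ, κ z {w | (z, w) ∈ G} ∂(Λ.map Z)) :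
    Disintegrates Λ X Y Z z₀ κ := by
  have hm : Measurable fun s => (Z s, X s, Y s) := hZ.prodMk (hX.prodMk hY)
  have := hT.sigmaFinite
  have e : (Λ.restrict (Z ⁻¹' {z₀}ᶜ)).map (fun s => (Z s, X s, Y s)) =
      (Λ.map Z).restrict {z₀}ᶜ ⊗ₘ κ := by
    ext G hG
    rw [Measure.compProd_apply hG, Measure.map_apply hm hG,
      Measure.restrict_apply (hm hG), Set.inter_comm]
    exact h G hG
  intro Φ hΦ
  rw [← lintegral_map hΦ hm, e, Measure.lintegral_compProd hΦ]

end Existence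

/-! ### Conditional independence under changes of variables -/

section Transport

variable {Ω α β γ α' β' γ' : Type*} [MeasurableSpace Ω] [MeasurableSpace α] [MeasurableSpace β]
  [MeasurableSpace γ] [MeasurableSpace α'] [MeasurableSpace β'] [MeasurableSpace γ']
  {X : Ω → α} {Y : Ω → β} {Z : Ω → γ} {m : Measure Ω}

/-- Functions of `X` and `Y` only give fewer events. The map on the conditioning variable needs a
measurable left inverse, through which versions are transported. -/
lemma CondIndepUnder.comp (hZ : Measurable Z) (h : CondIndepUnder X Y Z m) {f : α → α'}
    {g : β → β'} {k : γ → γ'}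
    {k' : γ' → γ} (hf : Measurable f) (hg : Measurable g) (hk : Measurable k)
    (hk' : Measurable k') (hkk : Function.LeftInverse k' k) :
    CondIndepUnder (fun ω => f (X ω)) (fun ω => g (Y ω)) (fun ω => k (Z ω)) m := by
  have key : ∀ (a : γ → ℝ≥0∞) (s : Set Ω), Measurable a → IsVersion a s Z m →
      IsVersion (fun z => a (k' z)) s (fun ω => k (Z ω)) m := by
    intro a s ha hv
    have hkZ : Measurable fun ω => k (Z ω) := hk.comp hZ
    rw [isVersion_iff hZ] at hv
    rw [isVersion_iff hkZ]
    intro u hu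
    have e := hv (k ⁻¹' u) (hk hu)
    rw [setLIntegral_map (hk hu) ha hZ] at e
    rw [setLIntegral_map (f := fun z => a (k' z)) hu (ha.comp hk') hkZ]
    refine e.trans ?_
    simp only [hkk _]
    rfl
  intro s t hs ht
  obtain ⟨a, b, ha, hb, hav, hbv, hv⟩ := h _ _ (hf hs) (hg ht)
  exact ⟨fun z => a (k' z), fun z => b (k' z), ha.comp hk', hb.comp hk', key a _ ha hav,
    key b _ hb hbv, key (fun z => a z * b z) _ (ha.mul hb) hv⟩

end Transport

/-! ### Punctured product spaces -/

namespace PuncturedCI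

lemma range_val_punctured {ι : Type*} {E : ι → Type*} (o : ∀ i, E i) :
    Set.range (Subtype.val : Punctured o → ∀ i, E i) = {o}ᶜ := by
  rw [Subtype.range_coe_subtype]
  rfl

section Basic

variable {ι : Type*} {E : ι → Type*} [∀ i, MeasurableSpace (E i)]
  {o : ∀ i, E i} {L : ℕ → ∀ i, Set (E i)} {Λ : Measure (Punctured o)}

lemma measurable_coords (o : ∀ i, E i) (A : Finset ι) : Measurable (coords o A) :=
  A.measurable_restrict.comp measurable_subtype_coe

lemma LocalizedExplosive.monotone_loc (hΛ : LocalizedExplosive o L Λ) (i : ι) :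
    Monotone fun h => L h i :=
  monotone_nat_of_le_succ fun h => hΛ.loc_subset_succ h i

lemma LocalizedExplosive.mass_slab_lt_top (hΛ : LocalizedExplosive o L Λ) (h : ℕ) (i : ι) :
    Λ {y | y.1 i ∈ L h i} < ∞ :=
  hΛ.locallyFinite (slab L h i) (measurable_pi_apply i (hΛ.measurableSet_loc h i))
    ⟨h, fun _ hy => ⟨i, hy⟩⟩

lemma LocalizedExplosive.exists_mem_loc (hΛ : LocalizedExplosive o L Λ) {i : ι} {x : E i} :
    x ≠ o i ↔ ∃ h, x ∈ L h i := by
  rw [← Set.mem_iUnion, hΛ.iUnion_loc]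
  rfl

lemma LocalizedExplosive.exhausts (hΛ : LocalizedExplosive o L Λ) (A : Finset ι) :
    Exhausts (prodLoc fun h => A.restrict (L h)) (A.restrict o) (Λ.map (coords o A)) := by
  have hm : ∀ h, MeasurableSet (prodLoc (fun h => A.restrict (L h)) h) := fun h => by
    have e : prodLoc (fun h => A.restrict (L h)) h =
        ⋃ i : A, (fun y : ∀ i : A, E i => y i) ⁻¹' L h i := by
      ext y
      simp [prodLoc]
    rw [e]
    exact .iUnion fun i => measurable_pi_apply i (hΛ.measurableSet_loc h i)
  refine ⟨hm, fun h k hhk y => ?_, ?_, fun h => ?_⟩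
  · rintro ⟨i, hi⟩
    exact ⟨i, hΛ.monotone_loc i hhk hi⟩
  · ext y
    rw [Set.mem_iUnion]
    constructor
    · rintro ⟨h, i, hi⟩ hy
      exact hΛ.exists_mem_loc.2 ⟨h, hi⟩ (congrFun hy i)
    · intro hy
      obtain ⟨i, hi⟩ := Function.ne_iff.1 hy
      obtain ⟨h, hh⟩ := hΛ.exists_mem_loc.1 hi
      exact ⟨h, i, hh⟩
  · rw [Measure.map_apply (measurable_coords o A) (hm h)]
    exact hΛ.locallyFinite (A.restrict ⁻¹' prodLoc (fun h => A.restrict (L h)) h)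
      (A.measurable_restrict (hm h)) ⟨h, fun y ⟨i, hi⟩ => ⟨i, hi⟩⟩

/-- In the punctured space `y_A = o_A` forces `y ≠ o` off `A`, so explosiveness applies to the pair
`Aᶜ`, `A`; if `Aᶜ` is empty, the event is empty. -/
lemma LocalizedExplosive.measure_preimage_coords [Fintype ι] [DecidableEq ι]
    (hΛ : LocalizedExplosive o L Λ) (A : Finset ι) :
    Λ (coords o A ⁻¹' {A.restrict o}) = 0 ∨ Λ (coords o A ⁻¹' {A.restrict o}) = ∞ := by
  have hne : ∀ y ∈ coords o A ⁻¹' {A.restrict o},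
      coords o Aᶜ y ≠ Aᶜ.restrict o := by
    intro y hy h
    refine y.2 (funext fun i => ?_)
    by_cases hi : i ∈ A
    · exact congrFun hy ⟨i, hi⟩
    · exact congrFun h ⟨i, Finset.mem_compl.2 hi⟩
  have e : coords o A ⁻¹' {A.restrict o} =
      {y | coords o Aᶜ y ≠ Aᶜ.restrict o ∧ coords o A y = A.restrict o} :=
    Set.ext fun y => ⟨fun hy => ⟨hne y hy, hy⟩, fun hy => hy.2⟩
  by_cases hA : (Aᶜ : Finset ι).Nonempty
  · rw [e]
    exact hΛ.explosive _ _ disjoint_compl_left hA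
  · left
    rw [Finset.not_nonempty_iff_eq_empty] at hA
    have : coords o A ⁻¹' {A.restrict o} = ∅ := by
      rw [Set.eq_empty_iff_forall_notMem]
      intro y hy
      refine hne y hy (funext fun i => ?_)
      exact absurd i.2 (by simp [hA])
    rw [this, measure_empty]

end Basic

/-! ### Kernels on punctured spaces and their extensions -/

section Kernels

variable {ι : Type*} {E : ι → Type*} [∀ i, MeasurableSpace (E i)] [∀ i, StandardBorelSpace (E i)]
  {o : ∀ i, E i} {L : ℕ → ∀ i, Set (E i)} {Λ : Measure (Punctured o)} {A B C : Finset ι}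

lemma measurableEmbedding_val (o : ∀ i, E i) [Countable ι] :
    MeasurableEmbedding (Subtype.val : Punctured o → ∀ i, E i) :=
  MeasurableEmbedding.subtype_coe (measurableSet_singleton o).compl

lemma map_marginal (Λ : Measure (Punctured o)) (C : Finset ι) :
    (marginal o Λ C).map Subtype.val = (Λ.map (coords o C)).restrict {C.restrict o}ᶜ := by
  rw [marginal, (measurableEmbedding_val (C.restrict o)).map_comap, range_val_punctured]

/-- A probability kernel on the punctured space extends to the base point. -/
lemma exists_comap_eq {β : Type*} [MeasurableSpace β] [Nonempty β] [Countable ι]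
    (κ : Kernel (Punctured o) β) [IsMarkovKernel κ] :
    ∃ η : Kernel (∀ i, E i) β, IsMarkovKernel η ∧
      η.comap Subtype.val measurable_subtype_coe = κ := by
  obtain ⟨b⟩ := ‹Nonempty β›
  refine ⟨⟨Function.extend Subtype.val κ fun _ => Measure.dirac b,
    (measurableEmbedding_val o).measurable_extend κ.measurable measurable_const⟩, ⟨fun y => ?_⟩, ?_⟩
  · by_cases hy : y = o
    · have : ¬ ∃ z : Punctured o, z.1 = y := fun ⟨z, hz⟩ => z.2 (hz.trans hy)
      rw [Kernel.coe_mk, Function.extend_apply' _ _ _ this]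
      infer_instance
    · have := Subtype.val_injective.extend_apply κ (fun _ => Measure.dirac b) (⟨y, hy⟩ : Punctured o)
      rw [Kernel.coe_mk, this]
      infer_instance
  · ext1 z
    rw [Kernel.comap_apply, Kernel.coe_mk, Subtype.val_injective.extend_apply]

variable {κ : Kernel (∀ i : C, E i) ((∀ i : A, E i) × (∀ i : B, E i))}

lemma factorizes_comap_iff [IsMarkovKernel κ] :
    Factorizes o Λ A B C (κ.comap Subtype.val measurable_subtype_coe) ↔
      ∀ᵐ z ∂(Λ.map (coords o C)).restrict {C.restrict o}ᶜ, κ z = (κ.fst z).prod (κ.snd z) := by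
  rw [← map_marginal, (measurableEmbedding_val (C.restrict o)).ae_map_iff, Factorizes]
  refine Filter.eventually_congr (Filter.Eventually.of_forall fun z => ?_)
  have e1 : (κ.comap Subtype.val measurable_subtype_coe).fst z = κ.fst (z : ∀ i : C, E i) := by
    rw [Kernel.fst_apply, Kernel.fst_apply, Kernel.comap_apply]
  have e2 : (κ.comap Subtype.val measurable_subtype_coe).snd z = κ.snd (z : ∀ i : C, E i) := by
    rw [Kernel.snd_apply, Kernel.snd_apply, Kernel.comap_apply]
  rw [e1, e2, Kernel.comap_apply]

/-- This moves between the punctured space over `C` and the full product, where the general lemmas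
single out the value `z₀`. The value of the kernel at the base point plays no role. -/
lemma isDisintegration_comap_iff [IsMarkovKernel κ] (hΛ : LocalizedExplosive o L Λ) :
    IsDisintegration o Λ A B C (κ.comap Subtype.val measurable_subtype_coe) ↔
      Disintegrates Λ (coords o A) (coords o B) (coords o C) (C.restrict o) κ := by
  have hX := measurable_coords o A
  have hY := measurable_coords o B
  have hZ := measurable_coords o C
  have hemb := measurableEmbedding_val (C.restrict o)
  constructor
  · rintro ⟨-, h⟩
    refine disintegrates_of_measure_eq hX hY hZ (hΛ.exhausts C) fun G hG => ?_
    have := h (Prod.map Subtype.val id ⁻¹' G)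
      ((measurable_subtype_coe.prodMap measurable_id) hG)
    rw [← map_marginal, hemb.lintegral_map]
    refine Eq.trans (congrArg Λ ?_) this
    ext y
    exact ⟨fun hy => ⟨hy.1, hy.2⟩, fun ⟨h1, h2⟩ => ⟨h1, h2⟩⟩
  · intro hD
    refine ⟨inferInstance, fun G hG => ?_⟩
    have hG' : MeasurableSet (Prod.map Subtype.val id '' G) :=
      (hemb.prodMap MeasurableEmbedding.id).measurableSet_image.2 hG
    have hm : Measurable fun y => (coords o C y, coords o A y, coords o B y) :=
      hZ.prodMk (hX.prodMk hY)
    have hinj : Function.Injective (Prod.map (Subtype.val : Punctured (C.restrict o) → _)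
        (id : (∀ i : A, E i) × (∀ i : B, E i) → _)) :=
      Subtype.val_injective.prodMap Function.injective_id
    have key := hD ((Prod.map Subtype.val id '' G).indicator 1) (measurable_one.indicator hG')
    rw [← map_marginal, hemb.lintegral_map] at key
    have e1 : ∀ y, (Prod.map Subtype.val id '' G).indicator (1 : (∀ i : C, E i) × (∀ i : A, E i) × (∀ i : B, E i) → ℝ≥0∞)
        (coords o C y, coords o A y, coords o B y) =
        ((fun y => (coords o C y, coords o A y, coords o B y)) ⁻¹'
          (Prod.map Subtype.val id '' G)).indicator 1 y := fun y => rfl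
    simp_rw [e1] at key
    rw [lintegral_indicator_one (hm hG'), Measure.restrict_apply (hm hG')] at key
    refine Eq.trans (congrArg Λ ?_) (key.trans (lintegral_congr fun z => ?_))
    · ext y
      constructor
      · rintro ⟨h1, h2⟩
        exact ⟨⟨_, h2, rfl⟩, h1⟩
      · rintro ⟨⟨p, hp, he⟩, h1⟩
        refine ⟨h1, ?_⟩
        have : p = (⟨coords o C y, h1⟩, coords o A y, coords o B y) := hinj he
        rwa [← this]
    · rw [Kernel.comap_apply]
      refine Eq.trans (lintegral_congr fun w => ?_)
        (lintegral_indicator_one (measurable_prodMk_left hG))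
      simp only [Set.indicator]
      congr 1
      refine propext ⟨?_, fun h => ⟨_, h, rfl⟩⟩
      rintro ⟨p, hp, he⟩
      have : p = (z, w) := hinj he
      rw [this] at hp
      exact hp

end Kernels

end PuncturedCI

/-! ### The equivalence of the analytic conditions -/

namespace PuncturedCI

section Analytic

variable {ι : Type*} {E : ι → Type*} [∀ i, MeasurableSpace (E i)]
  {o : ∀ i, E i} {L : ℕ → ∀ i, Set (E i)} {Λ : Measure (Punctured o)} {A B C : Finset ι}

omit [∀ i, MeasurableSpace (E i)] in
lemma coords_eq_of_eq_empty (hC : C = ∅) (y : Punctured o) : coords o C y = C.restrict o := by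
  subst hC
  exact Subsingleton.elim _ _

/-- The coordinate map for `C = ∅` is constant, so unconditional independence is the degenerate case
of conditioning and no case distinction is needed afterwards. -/
lemma condIndepOn_iff {Q : Set (∀ i, E i)} (h0 : mass o Λ Q ≠ 0) (hf : mass o Λ Q ≠ ∞) :
    CondIndepOn o Λ A B C Q ↔ CondIndepUnder (coords o A) (coords o B) (coords o C)
      (Λ.restrict (Subtype.val ⁻¹' Q)) := by
  have hp := cond_isProbabilityMeasure_of_finite h0 hf
  rw [CondIndepOn, condIndepIndexed_iff (measurable_coords o A) (measurable_coords o B)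
    (measurable_coords o C)
    (fun hC => ⟨C.restrict o, Filter.Eventually.of_forall (coords_eq_of_eq_empty hC)⟩),
    ← condIndepGiven_cond_iff h0 hf (measurable_coords o A) (measurable_coords o B)
    (measurable_coords o C), condIndepGiven_iff (measurable_coords o A) (measurable_coords o B)
    (measurable_coords o C)]

lemma CondIndepOnSlabs.condIndepUnder (hΛ : LocalizedExplosive o L Λ) {I : Finset ι}
    (hI : CondIndepOnSlabs o L Λ A B C I) {i : ι} (hi : i ∈ I) (h : ℕ) :
    CondIndepUnder (coords o A) (coords o B) (coords o C)
      (Λ.restrict (Subtype.val ⁻¹' slab L h i)) := by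
  by_cases h0 : mass o Λ (slab L h i) = 0
  · rw [Measure.restrict_eq_zero.2 h0]
    exact .of_ae_const_right (y₀ := B.restrict o) (measurable_coords o C) (by simp)
  · exact (condIndepOn_iff h0 (hΛ.mass_slab_lt_top h i).ne).1
      (hI i hi h (pos_iff_ne_zero.2 h0))

omit [∀ i, MeasurableSpace (E i)] in
open Classical in
lemma slab_eq_pi (h : ℕ) (i : ι) :
    slab L h i = Set.univ.pi (Function.update (fun _ => Set.univ) i (L h i)) := by
  ext y
  simp only [slab, Set.mem_ofPred_eq, Set.mem_univ_pi]
  constructor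
  · intro hy j
    by_cases hj : j = i
    · subst hj
      simpa using hy
    · simp [hj]
  · intro hy
    simpa using hy i

open Classical in
lemma AdmitsCondIndep.condIndepOnSlabs (hΛ : LocalizedExplosive o L Λ)
    (h : AdmitsCondIndep o L Λ A B C) (I : Finset ι) : CondIndepOnSlabs o L Λ A B C I := by
  intro i _ n hn
  have hb : IsBdd L (slab L n i) := ⟨n, fun _ hy => ⟨i, hy⟩⟩
  rw [slab_eq_pi] at hn hb ⊢
  refine h _ (fun j => ?_) hn hb
  by_cases hj : j = i
  · subst hj
    simpa using hΛ.measurableSet_loc n j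
  · simp [hj]

variable [∀ i, StandardBorelSpace (E i)]

lemma CondIndepOnSlabs.nullOffC (hΛ : LocalizedExplosive o L Λ) (hAC : Disjoint A C)
    (h : CondIndepOnSlabs o L Λ A B C A) : NullOffC o Λ A B C := by
  have key : ∀ (v : A) (w : B) (k : ℕ),
      Λ {y | y.1 v ≠ o v ∧ y.1 w ∈ L k w ∧ coords o C y = C.restrict o} = 0 := by
    intro v w k
    set T : ℕ → Set (∀ i : A, E i) := fun h => (fun x => x v) ⁻¹' L h v with hT
    have hTm : ∀ h, MeasurableSet (T h) := fun h =>
      measurable_pi_apply v (hΛ.measurableSet_loc h v)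
    have hU : ∀ y : Punctured o, y ∈ coords o A ⁻¹' (⋃ h, T h) ↔ y.1 v ≠ o v := fun y => by
      rw [hΛ.exists_mem_loc, Set.mem_preimage, Set.mem_iUnion]
      rfl
    -- Explosiveness for the single coordinate `v` against `C` is what the exhaustion of `{y_v ≠
    -- o_v}` by the localizing sets requires.
    have hexp := hΛ.explosive {v.1} C
      (Finset.disjoint_singleton_left.2 fun hv => Finset.disjoint_left.1 hAC v.2 hv)
      (Finset.singleton_nonempty _)
    have e : {y | coords o {v.1} y ≠ ({v.1} : Finset ι).restrict o ∧
        coords o C y = C.restrict o} =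
        coords o A ⁻¹' (⋃ h, T h) ∩ coords o C ⁻¹' {C.restrict o} := by
      ext y
      rw [Set.mem_inter_iff, hU]
      refine and_congr (not_congr ⟨fun hy => congrFun hy ⟨v.1, by simp⟩, fun hy => ?_⟩) Iff.rfl
      funext ⟨i, hi⟩
      obtain rfl := Finset.mem_singleton.1 hi
      exact hy
    rw [e] at hexp
    have := measure_eq_zero_of_condIndepUnder (measurable_coords o A) (measurable_coords o B)
      (measurable_coords o C) hTm (fun a b hab x hx => hΛ.monotone_loc _ hab hx)
      (fun n => (hΛ.mass_slab_lt_top n v).ne) (fun n => h.condIndepUnder hΛ v.2 n) hexp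
      (t := (fun x => x w) ⁻¹' L k w) (measurable_pi_apply w (hΛ.measurableSet_loc k w))
      (hΛ.mass_slab_lt_top k w).ne
    refine measure_mono_null (fun y hy => ?_) this
    exact ⟨⟨(hU y).2 hy.1, hy.2.1⟩, hy.2.2⟩
  refine measure_mono_null (t := ⋃ (v : A) (w : B) (k : ℕ),
    {y | y.1 v ≠ o v ∧ y.1 w ∈ L k w ∧ coords o C y = C.restrict o}) ?_
    (by simp only [measure_iUnion_null_iff]; exact key)
  rintro y ⟨hA, hB, hC⟩
  obtain ⟨v, hv⟩ := Function.ne_iff.1 hA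
  obtain ⟨w, hw⟩ := Function.ne_iff.1 hB
  obtain ⟨k, hk⟩ := hΛ.exists_mem_loc.1 hw
  simp only [Set.mem_iUnion]
  exact ⟨v, w, k, hv, hk, hC⟩

variable {κ : Kernel (∀ i : C, E i) ((∀ i : A, E i) × (∀ i : B, E i))} [IsMarkovKernel κ]

/-- Countably many sets `{z_c ∈ L_h}` cover the punctured space over `C`, and the slab over each
lies away from `Z = z₀` and has finite mass. -/
lemma CondIndepOnSlabs.ae_eq_prod (hΛ : LocalizedExplosive o L Λ)
    (h : CondIndepOnSlabs o L Λ A B C C)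
    (hD : Disintegrates Λ (coords o A) (coords o B) (coords o C) (C.restrict o) κ) :
    ∀ᵐ z ∂(Λ.map (coords o C)).restrict {C.restrict o}ᶜ, κ z = (κ.fst z).prod (κ.snd z) := by
  refine ae_eq_prod_of_rectangles (hΛ.exhausts C) fun s t hs ht => ?_
  have e : ({C.restrict o}ᶜ : Set (∀ i : C, E i)) =
      ⋃ p : C × ℕ, (fun z : ∀ i : C, E i => z p.1) ⁻¹' L p.2 p.1 := by
    ext z
    rw [Set.mem_iUnion]
    constructor
    · intro hz
      obtain ⟨i, hi⟩ := Function.ne_iff.1 hz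
      obtain ⟨k, hk⟩ := hΛ.exists_mem_loc.1 hi
      exact ⟨(i, k), hk⟩
    · rintro ⟨p, hp⟩ hz
      exact hΛ.exists_mem_loc.2 ⟨_, hp⟩ (congrFun hz p.1)
  rw [e, ae_restrict_iUnion_iff]
  intro p
  exact hD.ae_prod_of_condIndepUnder (measurable_coords o A) (measurable_coords o B)
    (measurable_coords o C) (measurable_pi_apply p.1 (hΛ.measurableSet_loc p.2 p.1))
    (fun hp => hΛ.exists_mem_loc.2 ⟨_, hp⟩ rfl) (hΛ.mass_slab_lt_top p.2 p.1).ne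
    (h.condIndepUnder hΛ p.1.2 p.2) hs ht

/-- Since `A`, `B`, `C` cover the index set, a product set is an intersection of conditions on `X`,
`Y` and `Z`; boundedness excludes `o` from it. -/
lemma admitsCondIndep_of_factor [DecidableEq ι] [Fintype ι] (hΛ : LocalizedExplosive o L Λ)
    (hABC : A ∪ B ∪ C = Finset.univ)
    (hD : Disintegrates Λ (coords o A) (coords o B) (coords o C) (C.restrict o) κ)
    (hnull : NullOffC o Λ A B C)
    (hfac : ∀ᵐ z ∂(Λ.map (coords o C)).restrict {C.restrict o}ᶜ,
      κ z = (κ.fst z).prod (κ.snd z)) : AdmitsCondIndep o L Λ A B C := by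
  intro R hR h0 hb
  have hf : mass o Λ (Set.univ.pi R) < ∞ := hΛ.locallyFinite _ (.univ_pi hR) hb
  rw [condIndepOn_iff h0.ne' hf.ne]
  have hmem : ∀ y : ∀ i, E i, (∀ i, y i ∈ R i) ↔
      ((∀ i : A, y i ∈ R i) ∧ ∀ i : B, y i ∈ R i) ∧ ∀ i : C, y i ∈ R i := fun y => by
    refine ⟨fun h => ⟨⟨fun i => h i, fun i => h i⟩, fun i => h i⟩, fun h i => ?_⟩
    have hi : i ∈ A ∪ B ∪ C := hABC ▸ Finset.mem_univ i
    rcases Finset.mem_union.1 hi with hi | hi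
    · rcases Finset.mem_union.1 hi with hi | hi
      · exact h.1.1 ⟨i, hi⟩
      · exact h.1.2 ⟨i, hi⟩
    · exact h.2 ⟨i, hi⟩
  have e : (Subtype.val ⁻¹' Set.univ.pi R : Set (Punctured o)) =
      coords o A ⁻¹' Set.univ.pi (fun i : A => R i) ∩
      coords o B ⁻¹' Set.univ.pi (fun i : B => R i) ∩
      coords o C ⁻¹' Set.univ.pi (fun i : C => R i) := by
    ext y
    simp only [Set.mem_preimage, Set.mem_inter_iff, Set.mem_univ_pi]
    exact hmem y.1
  have hf' := hf
  rw [mass, e] at hf'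
  rw [e]
  refine hD.condIndepUnder (measurable_coords o A) (measurable_coords o B)
    (measurable_coords o C) hnull hfac (.univ_pi fun i => hR i) (.univ_pi fun i => hR i)
    (.univ_pi fun i => hR i) ?_ hf'.ne
  simp only [Set.mem_univ_pi]
  intro h
  obtain ⟨n, hn⟩ := hb
  obtain ⟨i, hi⟩ := hn (Set.mem_univ_pi.2 ((hmem o).2 ⟨⟨h.1, h.2.1⟩, h.2.2⟩))
  exact hΛ.exists_mem_loc.2 ⟨n, hi⟩ rfl

omit [∀ i, StandardBorelSpace (E i)] in
lemma factorizes_of_eq_empty (hC : C = ∅)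
    (η : Kernel (Punctured (C.restrict o)) ((∀ i : A, E i) × (∀ i : B, E i))) :
    Factorizes o Λ A B C η := by
  subst hC
  have : IsEmpty (Punctured ((∅ : Finset ι).restrict o)) := ⟨fun z => z.2 (Subsingleton.elim _ _)⟩
  exact Filter.Eventually.of_forall fun z => isEmptyElim z

end Analytic

end PuncturedCI

namespace PuncturedCI

section Equivalence

variable {ι : Type*} [Fintype ι] [DecidableEq ι] {E : ι → Type*} [∀ i, MeasurableSpace (E i)]
  [∀ i, StandardBorelSpace (E i)]
  {o : ∀ i, E i} {L : ℕ → ∀ i, Set (E i)} {Λ : Measure (Punctured o)} {A B C : Finset ι}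

omit [Fintype ι] [DecidableEq ι] in
lemma LocalizedExplosive.exists_disintegrates (hΛ : LocalizedExplosive o L Λ)
    (A B C : Finset ι) : ∃ κ : Kernel (∀ i : C, E i) ((∀ i : A, E i) × (∀ i : B, E i)),
      IsMarkovKernel κ ∧
        Disintegrates Λ (coords o A) (coords o B) (coords o C) (C.restrict o) κ := by
  have : Nonempty (∀ i : A, E i) := ⟨A.restrict o⟩
  have : Nonempty (∀ i : B, E i) := ⟨B.restrict o⟩
  exact _root_.exists_disintegrates (measurable_coords o A) (measurable_coords o B)
    (measurable_coords o C) (hΛ.exhausts C)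

theorem LocalizedExplosive.admitsCondIndep_iff (hΛ : LocalizedExplosive o L Λ)
    (hAC : Disjoint A C) (hABC : A ∪ B ∪ C = Finset.univ)
    {κ : Kernel (∀ i : C, E i) ((∀ i : A, E i) × (∀ i : B, E i))} [IsMarkovKernel κ]
    (hD : Disintegrates Λ (coords o A) (coords o B) (coords o C) (C.restrict o) κ) :
    AdmitsCondIndep o L Λ A B C ↔ NullOffC o Λ A B C ∧
      ∀ᵐ z ∂(Λ.map (coords o C)).restrict {C.restrict o}ᶜ, κ z = (κ.fst z).prod (κ.snd z) :=
  ⟨fun h => ⟨(h.condIndepOnSlabs hΛ A).nullOffC hΛ hAC,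
    (h.condIndepOnSlabs hΛ C).ae_eq_prod hΛ hD⟩,
    fun h => admitsCondIndep_of_factor hΛ hABC hD h.1 h.2⟩

theorem LocalizedExplosive.tfae (hΛ : LocalizedExplosive o L Λ) (hAC : Disjoint A C)
    (hABC : A ∪ B ∪ C = Finset.univ) :
    [AdmitsCondIndep o L Λ A B C,
      CondIndepOnSlabs o L Λ A B C Finset.univ,
      CondIndepOnSlabs o L Λ A B C C ∧ NullOffC o Λ A B C,
      (C.Nonempty → ∃ κ, IsDisintegration o Λ A B C κ ∧ Factorizes o Λ A B C κ) ∧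
        NullOffC o Λ A B C,
      (C.Nonempty → ∀ κ, IsDisintegration o Λ A B C κ → Factorizes o Λ A B C κ) ∧
        NullOffC o Λ A B C].TFAE := by
  have hA : Nonempty (∀ i : A, E i) := ⟨A.restrict o⟩
  have hB : Nonempty (∀ i : B, E i) := ⟨B.restrict o⟩
  obtain ⟨κ, hκ, hD⟩ := hΛ.exists_disintegrates A B C
  tfae_have 1 → 2 := fun h => h.condIndepOnSlabs hΛ _
  tfae_have 2 → 3 := fun h => ⟨fun i _ => h i (Finset.mem_univ i),
    CondIndepOnSlabs.nullOffC hΛ hAC fun i _ => h i (Finset.mem_univ i)⟩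
  tfae_have 3 → 5 := by
    refine fun h => ⟨fun _ κ hκ => ?_, h.2⟩
    -- The kernel is extended to the base point to make it accessible to the lemmas on the full
    -- product.
    have := hκ.1
    obtain ⟨η, hη, rfl⟩ := exists_comap_eq κ
    exact factorizes_comap_iff.2 (h.1.ae_eq_prod hΛ ((isDisintegration_comap_iff hΛ).1 hκ))
  tfae_have 5 → 4 := fun h => ⟨fun hC => ⟨_, (isDisintegration_comap_iff hΛ).2 hD,
    h.1 hC _ ((isDisintegration_comap_iff hΛ).2 hD)⟩, h.2⟩
  tfae_have 4 → 1 := by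
    rintro ⟨h, hnull⟩
    rcases C.eq_empty_or_nonempty with hC | hC
    -- For `C = ∅` the punctured space over `C` is empty, so factorization holds vacuously and only
    -- the null condition matters.
    · exact admitsCondIndep_of_factor hΛ hABC hD hnull
        (factorizes_comap_iff.1 (factorizes_of_eq_empty hC _))
    · obtain ⟨κ, hκ, hf⟩ := h hC
      have := hκ.1
      obtain ⟨η, hη, rfl⟩ := exists_comap_eq κ
      exact admitsCondIndep_of_factor hΛ hABC ((isDisintegration_comap_iff hΛ).1 hκ) hnull
        (factorizes_comap_iff.1 hf)
  tfae_finish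

end Equivalence

/-! ### Marginal measures -/

section Marginal

variable {ι : Type*} {E : ι → Type*} {o : ∀ i, E i}

lemma coords_eq_iff {A : Finset ι} {y : Punctured o} :
    coords o A y = A.restrict o ↔ ∀ i ∈ A, y.1 i = o i :=
  ⟨fun h i hi => congrFun h ⟨i, hi⟩, fun h => funext fun i => h i i.2⟩

lemma restrict_coords_eq_iff {D : Finset ι} {A : Finset D} {y : Punctured o} :
    A.restrict (coords o D y) = A.restrict (D.restrict o) ↔
      coords o (A.map (Function.Embedding.subtype _)) y =
        (A.map (Function.Embedding.subtype _)).restrict o := by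
  rw [coords_eq_iff]
  constructor
  · intro h i hi
    obtain ⟨j, hj, rfl⟩ := Finset.mem_map.1 hi
    exact congrFun h ⟨j, hj⟩
  · intro h
    funext i
    exact h _ (Finset.mem_map_of_mem _ i.2)

variable [∀ i, MeasurableSpace (E i)] [∀ i, StandardBorelSpace (E i)]
  {L : ℕ → ∀ i, Set (E i)} {Λ : Measure (Punctured o)} {D : Finset ι}

/-- The marginal measure discards the points with `y_D = o_D`, hence the condition on `f`. -/
lemma lintegral_marginal {f : (∀ i : D, E i) → ℝ≥0∞} (hf : Measurable f)
    (h0 : f (D.restrict o) = 0) :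
    ∫⁻ z, f z.1 ∂(marginal o Λ D) = ∫⁻ y, f (coords o D y) ∂Λ := by
  rw [← lintegral_map hf measurable_subtype_coe, map_marginal,
    ← lintegral_indicator (measurableSet_singleton _).compl,
    ← lintegral_map hf (measurable_coords o D)]
  refine lintegral_congr fun z => ?_
  by_cases hz : z = D.restrict o
  · simp [hz, h0]
  · exact Set.indicator_of_mem (s := {D.restrict o}ᶜ) hz f

lemma marginal_preimage_val {G : Set (∀ i : D, E i)} (hG : MeasurableSet G)
    (h0 : D.restrict o ∉ G) :
    marginal o Λ D (Subtype.val ⁻¹' G) = Λ (coords o D ⁻¹' G) := by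
  have := lintegral_marginal (Λ := Λ) (f := G.indicator 1) (measurable_one.indicator hG)
    (Set.indicator_of_notMem h0 _)
  rw [← lintegral_indicator_one (measurable_subtype_coe hG),
    ← lintegral_indicator_one (measurable_coords o D hG)]
  exact this

lemma LocalizedExplosive.marginal (hΛ : LocalizedExplosive o L Λ) (D : Finset ι) :
    LocalizedExplosive (D.restrict o) (fun h => D.restrict (L h))
      (PuncturedCI.marginal o Λ D) := by
  refine ⟨fun h i => hΛ.measurableSet_loc h i, fun h i => hΛ.loc_subset_succ h i,
    fun i => hΛ.iUnion_loc i, ?_, ?_⟩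
  · rintro G hG ⟨h, hh⟩
    rw [mass, marginal_preimage_val hG fun ho => (hΛ.exhausts D).notMem h (hh ho)]
    exact hΛ.locallyFinite (D.restrict ⁻¹' G) (D.measurable_restrict hG)
      ⟨h, fun y hy => let ⟨i, hi⟩ := hh hy; ⟨i.1, hi⟩⟩
  · intro A B hAB hA
    have hm : MeasurableSet {x : ∀ i : D, E i | A.restrict x ≠ A.restrict (D.restrict o) ∧
        B.restrict x = B.restrict (D.restrict o)} :=
      (A.measurable_restrict (measurableSet_singleton _)).compl.inter
        (B.measurable_restrict (measurableSet_singleton _))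
    have e := marginal_preimage_val (Λ := Λ) hm fun h => h.1 rfl
    -- Subsets of `D` are regarded as subsets of the whole index set, where explosiveness is
    -- assumed.
    have key := hΛ.explosive (A.map (Function.Embedding.subtype _))
      (B.map (Function.Embedding.subtype _)) ((Finset.disjoint_map _).2 hAB) (hA.map)
    have e' : coords o D ⁻¹' {x : ∀ i : D, E i | A.restrict x ≠ A.restrict (D.restrict o) ∧
        B.restrict x = B.restrict (D.restrict o)} =
        {y | coords o (A.map (Function.Embedding.subtype _)) y ≠
            (A.map (Function.Embedding.subtype _)).restrict o ∧
          coords o (B.map (Function.Embedding.subtype _)) y =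
            (B.map (Function.Embedding.subtype _)).restrict o} := by
      ext y
      exact and_congr (not_congr restrict_coords_eq_iff) restrict_coords_eq_iff
    rw [← e', ← e] at key
    exact key

end Marginal

end PuncturedCI

/-! ### The Poisson process condition -/

section

variable {γ : Type*} [MeasurableSpace γ]

lemma Exhausts.of_restrict_eq {T : ℕ → Set γ} {x₀ : γ} {μ ν : Measure γ} (hT : Exhausts T x₀ μ)
    (h : μ.restrict {x₀}ᶜ = ν.restrict {x₀}ᶜ) : Exhausts T x₀ ν := by
  refine ⟨hT.measurableSet, hT.mono, hT.iUnion, fun n => ?_⟩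
  have e : ∀ ρ : Measure γ, ρ.restrict {x₀}ᶜ (T n) = ρ (T n) := fun ρ => by
    rw [Measure.restrict_apply (hT.measurableSet n), Set.inter_eq_left.2]
    exact Set.subset_compl_singleton_iff.2 (hT.notMem n)
  rw [← e, ← h, e]
  exact hT.lt_top n

end

namespace PuncturedCI

variable {ι : Type*} {E : ι → Type*} [∀ i, MeasurableSpace (E i)] {o : ∀ i, E i}
  {L : ℕ → ∀ i, Set (E i)} {Λ : Measure (Punctured o)} {A B C : Finset ι}
  {Ω : Type*} [MeasurableSpace Ω] {P : Measure Ω} {ξ : Ω → Measure (Punctured o)}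

lemma IsPoissonProcess.measurable_proj (hξ : IsPoissonProcess ξ Λ P) (A : Finset ι) :
    Measurable (proj o ξ A) :=
  hξ.measurable_map (measurable_coords o A)

/-- For `C = ∅` the target is a single point, so the projection is determined by the total mass.
Explosiveness makes the mean total mass `0` or `∞`, so this mass is deterministic. -/
lemma IsPoissonProcess.proj_ae_eq [Fintype ι] [DecidableEq ι] [IsProbabilityMeasure P]
    (hΛ : LocalizedExplosive o L Λ)
    (hξ : IsPoissonProcess ξ Λ P) (hC : C = ∅) :
    ∀ᵐ ω ∂P, proj o ξ C ω = Λ.map (coords o C) := by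
  have huniv : ∀ᵐ ω ∂P, ξ ω Set.univ = Λ Set.univ := by
    have h := hΛ.measure_preimage_coords C
    have e : coords o C ⁻¹' {C.restrict o} = Set.univ :=
      Set.eq_univ_of_forall fun y => coords_eq_of_eq_empty hC y
    rw [e] at h
    rcases h with h | h
    · rw [h]
      exact hξ.ae_eq_zero .univ h
    · rw [h]
      exact hξ.law_of_infinite _ .univ h
  filter_upwards [huniv] with ω hω
  subst hC
  ext s hs
  rw [proj, Measure.map_apply (measurable_coords o ∅) hs,
    Measure.map_apply (measurable_coords o ∅) hs]
  rcases s.eq_empty_or_nonempty with rfl | hne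
  · simp
  · rw [Subsingleton.eq_univ_of_nonempty hne, Set.preimage_univ, hω]

lemma IsPoissonProcess.condIndepIndexed_proj_iff [Fintype ι] [DecidableEq ι]
    [IsProbabilityMeasure P] (hΛ : LocalizedExplosive o L Λ) (hξ : IsPoissonProcess ξ Λ P) :
    CondIndepIndexed C (proj o ξ A) (proj o ξ B) (proj o ξ C) P ↔
      CondIndepUnder (proj o ξ A) (proj o ξ B) (proj o ξ C) P :=
  condIndepIndexed_iff (hξ.measurable_proj A) (hξ.measurable_proj B) (hξ.measurable_proj C)
    fun hC => ⟨_, hξ.proj_ae_eq hΛ hC⟩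

variable [∀ i, StandardBorelSpace (E i)]

theorem LocalizedExplosive.admitsCondIndep_iff_proj [Fintype ι] [DecidableEq ι]
    [IsProbabilityMeasure P] (hΛ : LocalizedExplosive o L Λ) (hξ : IsPoissonProcess ξ Λ P)
    (hAC : Disjoint A C) (hABC : A ∪ B ∪ C = Finset.univ) :
    AdmitsCondIndep o L Λ A B C ↔
      CondIndepIndexed C (proj o ξ A) (proj o ξ B) (proj o ξ C) P := by
  obtain ⟨κ, hκ, hD⟩ := hΛ.exists_disintegrates A B C
  rw [hΛ.admitsCondIndep_iff hAC hABC hD, hξ.condIndepIndexed_proj_iff hΛ]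
  exact ⟨fun h => hξ.condIndepUnder hD (measurable_coords o A) (measurable_coords o B)
      (measurable_coords o C) (hΛ.measure_preimage_coords A) (hΛ.measure_preimage_coords B)
      (hΛ.measure_preimage_coords C) h.1 h.2,
    fun h => hξ.factor_of_condIndepUnder hD (measurable_coords o A) (measurable_coords o B)
      (measurable_coords o C) (hΛ.measure_preimage_coords C) (hΛ.exhausts C) (hΛ.exhausts A)
      (hΛ.exhausts B) h⟩

/-! ### The Poisson condition for marginal measures -/

section Marginal

variable {D : Finset ι}

omit [∀ i, StandardBorelSpace (E i)] in
lemma measurable_restrict_coords (o : ∀ i, E i) (D : Finset ι) (A : Finset D) :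
    Measurable fun y : Punctured o => A.restrict (coords o D y) :=
  A.measurable_restrict.comp (measurable_coords o D)

/-- Passing to the marginal measure only removes points with `y_D = o_D`, all of which lie over the
base point of `A`. -/
lemma map_coords_marginal (A : Finset D) :
    ((marginal o Λ D).map (coords (D.restrict o) A)).restrict {A.restrict (D.restrict o)}ᶜ =
      (Λ.map fun y => A.restrict (coords o D y)).restrict {A.restrict (D.restrict o)}ᶜ := by
  ext s hs
  have hm := hs.inter (measurableSet_singleton (A.restrict (D.restrict o))).compl
  rw [Measure.restrict_apply hs, Measure.restrict_apply hs,
    Measure.map_apply (measurable_coords _ A) hm,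
    Measure.map_apply (measurable_restrict_coords o D A) hm]
  exact marginal_preimage_val (A.measurable_restrict hm) fun h => h.2 rfl

lemma nullOffC_marginal_iff {A B C : Finset D} :
    NullOffC (D.restrict o) (marginal o Λ D) A B C ↔
      Λ {y | A.restrict (coords o D y) ≠ A.restrict (D.restrict o) ∧
        B.restrict (coords o D y) ≠ B.restrict (D.restrict o) ∧
        C.restrict (coords o D y) = C.restrict (D.restrict o)} = 0 := by
  have hm : MeasurableSet {x : ∀ i : D, E i | A.restrict x ≠ A.restrict (D.restrict o) ∧
      B.restrict x ≠ B.restrict (D.restrict o) ∧ C.restrict x = C.restrict (D.restrict o)} :=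
    (A.measurable_restrict (measurableSet_singleton _)).compl.inter
      ((B.measurable_restrict (measurableSet_singleton _)).compl.inter
        (C.measurable_restrict (measurableSet_singleton _)))
  exact Eq.congr_left (marginal_preimage_val (Λ := Λ) hm fun h => h.1 rfl)

lemma disintegrates_of_marginal {A B C : Finset D}
    {κ : Kernel (∀ i : C, E i) ((∀ i : A, E i) × (∀ i : B, E i))}
    (hD : Disintegrates (marginal o Λ D) (coords (D.restrict o) A) (coords (D.restrict o) B)
      (coords (D.restrict o) C) (C.restrict (D.restrict o)) κ) :
    Disintegrates Λ (fun y => A.restrict (coords o D y)) (fun y => B.restrict (coords o D y))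
      (fun y => C.restrict (coords o D y)) (C.restrict (D.restrict o)) κ := by
  refine hD.of_lintegral_eq (fun Φ hΦ => ?_) (map_coords_marginal C)
  have hs : MeasurableSet {x : ∀ i : D, E i | C.restrict x ≠ C.restrict (D.restrict o)} :=
    C.measurable_restrict (measurableSet_singleton _).compl
  have hm : Measurable fun x : ∀ i : D, E i => Φ (C.restrict x, A.restrict x, B.restrict x) :=
    hΦ.comp (C.measurable_restrict.prodMk (A.measurable_restrict.prodMk B.measurable_restrict))
  rw [← lintegral_indicator (measurable_coords _ C (measurableSet_singleton _).compl),
    ← lintegral_indicator (measurable_restrict_coords o D C (measurableSet_singleton _).compl)]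
  refine lintegral_marginal (hm.indicator hs) (Set.indicator_of_notMem ?_ _)
  exact fun h => h rfl

omit [∀ i, StandardBorelSpace (E i)] in
/-- Reindexing of the coordinates in `A` as coordinates in a subset of `D`. -/
lemma restrict_coords_conj (hAD : A ⊆ D) [DecidablePred (· ∈ D)] :
    ∃ (r : (∀ i : A, E i) → ∀ i : A.subtype (· ∈ D), E i)
      (r' : (∀ i : A.subtype (· ∈ D), E i) → ∀ i : A, E i), Measurable r ∧ Measurable r' ∧
      (∀ x, r' (r x) = x) ∧ (∀ x, r (r' x) = x) ∧
      ∀ y : Punctured o, (A.subtype (· ∈ D)).restrict (coords o D y) = r (coords o A y) :=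
  ⟨fun x i => x ⟨i.1.1, Finset.mem_subtype.1 i.2⟩,
    fun x i => x ⟨⟨i.1, hAD i.2⟩, Finset.mem_subtype.2 i.2⟩,
    measurable_pi_lambda _ fun _ => measurable_pi_apply _,
    measurable_pi_lambda _ fun _ => measurable_pi_apply _,
    fun _ => rfl, fun _ => rfl, fun _ => rfl⟩

omit [∀ i, StandardBorelSpace (E i)] in
lemma condIndepUnder_proj_iff [DecidablePred (· ∈ D)] (hξ : IsPoissonProcess ξ Λ P)
    (hA : A ⊆ D) (hB : B ⊆ D) (hC : C ⊆ D) :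
    CondIndepUnder (fun ω => (ξ ω).map fun y => (A.subtype (· ∈ D)).restrict (coords o D y))
      (fun ω => (ξ ω).map fun y => (B.subtype (· ∈ D)).restrict (coords o D y))
      (fun ω => (ξ ω).map fun y => (C.subtype (· ∈ D)).restrict (coords o D y)) P ↔
    CondIndepUnder (proj o ξ A) (proj o ξ B) (proj o ξ C) P := by
  obtain ⟨a, a', ha, ha', haa, haa', ea⟩ := restrict_coords_conj (o := o) hA
  obtain ⟨b, b', hb, hb', hbb, hbb', eb⟩ := restrict_coords_conj (o := o) hB
  obtain ⟨c, c', hc, hc', hcc, hcc', ec⟩ := restrict_coords_conj (o := o) hC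
  have inv : ∀ {α β : Type _} [MeasurableSpace α] [MeasurableSpace β] {r : α → β} {r' : β → α},
      Measurable r → Measurable r' → (∀ x, r' (r x) = x) →
      ∀ μ : Measure α, (μ.map r).map r' = μ := by
    intro α β _ _ r r' hr hr' h μ
    rw [Measure.map_map hr' hr, show r' ∘ r = id from funext h, Measure.map_id]
  have key : ∀ {I : Finset ι} {r : (∀ i : I, E i) → ∀ i : I.subtype (· ∈ D), E i},
      Measurable r → (∀ y, (I.subtype (· ∈ D)).restrict (coords o D y) = r (coords o I y)) →
      (fun ω => (ξ ω).map fun y => (I.subtype (· ∈ D)).restrict (coords o D y)) =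
        fun ω => (proj o ξ I ω).map r := by
    intro I r hr h
    funext ω
    rw [proj, Measure.map_map hr (measurable_coords o I)]
    exact congrArg (ξ ω).map (funext h)
  rw [key ha ea, key hb eb, key hc ec]
  have mZ : Measurable fun ω => (proj o ξ C ω).map c :=
    (Measure.measurable_map _ hc).comp (hξ.measurable_proj C)
  constructor
  · intro h
    have := h.comp mZ (Measure.measurable_map _ ha') (Measure.measurable_map _ hb')
      (Measure.measurable_map _ hc') (Measure.measurable_map _ hc) (inv hc' hc hcc')
    simp only [inv ha ha' haa, inv hb hb' hbb, inv hc hc' hcc] at this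
    exact this
  · intro h
    exact h.comp (hξ.measurable_proj C) (Measure.measurable_map _ ha) (Measure.measurable_map _ hb)
      (Measure.measurable_map _ hc) (Measure.measurable_map _ hc') (inv hc hc' hcc)

theorem LocalizedExplosive.admitsCondIndep_marginal_iff_proj [Fintype ι] [DecidableEq ι]
    [IsProbabilityMeasure P] (hΛ : LocalizedExplosive o L Λ) (hξ : IsPoissonProcess ξ Λ P)
    (hA : A ⊆ D) (hB : B ⊆ D) (hC : C ⊆ D) (hAC : Disjoint A C)
    (hABC : A.subtype (· ∈ D) ∪ B.subtype (· ∈ D) ∪ C.subtype (· ∈ D) = Finset.univ) :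
    AdmitsCondIndep (D.restrict o) (fun h => D.restrict (L h)) (PuncturedCI.marginal o Λ D)
        (A.subtype (· ∈ D)) (B.subtype (· ∈ D)) (C.subtype (· ∈ D)) ↔
      CondIndepIndexed C (proj o ξ A) (proj o ξ B) (proj o ξ C) P := by
  have hΛ' := hΛ.marginal D
  have hAC' : Disjoint (A.subtype (· ∈ D)) (C.subtype (· ∈ D)) :=
    Finset.disjoint_left.2 fun i hi hi' =>
      Finset.disjoint_left.1 hAC (Finset.mem_subtype.1 hi) (Finset.mem_subtype.1 hi')
  -- The Poisson lemmas are applied to the original process with coordinates taken through `D`. The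
  -- masses over base points are those of `Λ`, while the kernel and the exhausting sets come from
  -- the marginal.
  have h01 : ∀ I : Finset D,
      Λ ((fun y => I.restrict (coords o D y)) ⁻¹' {I.restrict (D.restrict o)}) = 0 ∨
      Λ ((fun y => I.restrict (coords o D y)) ⁻¹' {I.restrict (D.restrict o)}) = ∞ := by
    intro I
    have e : (fun y : Punctured o => I.restrict (coords o D y)) ⁻¹' {I.restrict (D.restrict o)} =
        coords o (I.map (Function.Embedding.subtype _)) ⁻¹'
          {(I.map (Function.Embedding.subtype _)).restrict o} :=
      Set.ext fun y => restrict_coords_eq_iff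
    rw [e]
    exact hΛ.measure_preimage_coords _
  have hT : ∀ I : Finset D, _ := fun I =>
    (hΛ'.exhausts I).of_restrict_eq (map_coords_marginal I)
  obtain ⟨κ, hκ, hD'⟩ := hΛ'.exists_disintegrates (A.subtype (· ∈ D)) (B.subtype (· ∈ D))
    (C.subtype (· ∈ D))
  have hD := disintegrates_of_marginal hD'
  rw [hΛ'.admitsCondIndep_iff hAC' hABC hD', hξ.condIndepIndexed_proj_iff hΛ,
    ← condIndepUnder_proj_iff hξ hA hB hC, nullOffC_marginal_iff, map_coords_marginal]
  exact ⟨fun h => hξ.condIndepUnder hD (measurable_restrict_coords o D _)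
      (measurable_restrict_coords o D _) (measurable_restrict_coords o D _) (h01 _) (h01 _)
      (h01 _) h.1 h.2,
    fun h => hξ.factor_of_condIndepUnder hD (measurable_restrict_coords o D _)
      (measurable_restrict_coords o D _) (measurable_restrict_coords o D _) (h01 _) (hT _) (hT _)
      (hT _) h⟩

end Marginal

end PuncturedCI

/-! ### The theorem -/

theorem theorem4 {V : Type*} [Fintype V] [DecidableEq V] {E : V → Type*}
    [∀ v, MeasurableSpace (E v)] [∀ v, StandardBorelSpace (E v)]
    (o : ∀ v, E v) (L : ℕ → ∀ v, Set (E v)) (Λ : Measure (Punctured o))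
    (hΛ : LocalizedExplosive o L Λ)
    (A B C : Finset V) (hAB : Disjoint A B) (hAC : Disjoint A C) (hBC : Disjoint B C)
    (hA : A.Nonempty) (hB : B.Nonempty) :
    -- the case in which `A, B, C` form a partition of `V`
    (A ∪ B ∪ C = Finset.univ →
      [AdmitsCondIndep o L Λ A B C,
        CondIndepOnSlabs o L Λ A B C Finset.univ,
        CondIndepOnSlabs o L Λ A B C C ∧ NullOffC o Λ A B C,
        (C.Nonempty → ∃ κ, IsDisintegration o Λ A B C κ ∧ Factorizes o Λ A B C κ) ∧
          NullOffC o Λ A B C,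
        (C.Nonempty → ∀ κ, IsDisintegration o Λ A B C κ → Factorizes o Λ A B C κ) ∧
          NullOffC o Λ A B C].TFAE ∧
      ∀ {Ω : Type*} [MeasurableSpace Ω] (P : Measure Ω) [IsProbabilityMeasure P]
        (ξ : Ω → Measure (Punctured o)), IsPoissonProcess ξ Λ P →
        (AdmitsCondIndep o L Λ A B C ↔
          CondIndepIndexed C (proj o ξ A) (proj o ξ B) (proj o ξ C) P)) ∧
    -- the general case: the analytic statements concern the marginal measure of `Λ` over
    -- `D = A ∪ B ∪ C`, the Poisson process is still the one on the whole space
    (∀ D : Finset V, D = A ∪ B ∪ C →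
      ∀ (LD : ℕ → ∀ v : D, Set (E v)) (ΛD : Measure (Punctured (D.restrict o)))
        (A' B' C' : Finset D),
      LD = (fun h => D.restrict (L h)) → ΛD = marginal o Λ D →
      A' = A.subtype (· ∈ D) → B' = B.subtype (· ∈ D) → C' = C.subtype (· ∈ D) →
      [AdmitsCondIndep (D.restrict o) LD ΛD A' B' C',
        CondIndepOnSlabs (D.restrict o) LD ΛD A' B' C' Finset.univ,
        CondIndepOnSlabs (D.restrict o) LD ΛD A' B' C' C' ∧ NullOffC (D.restrict o) ΛD A' B' C',
        (C.Nonempty → ∃ κ, IsDisintegration (D.restrict o) ΛD A' B' C' κ ∧ Factorizes (D.restrict o) ΛD A' B' C' κ) ∧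
          NullOffC (D.restrict o) ΛD A' B' C',
        (C.Nonempty → ∀ κ, IsDisintegration (D.restrict o) ΛD A' B' C' κ → Factorizes (D.restrict o) ΛD A' B' C' κ) ∧
          NullOffC (D.restrict o) ΛD A' B' C'].TFAE ∧
      ∀ {Ω : Type*} [MeasurableSpace Ω] (P : Measure Ω) [IsProbabilityMeasure P]
        (ξ : Ω → Measure (Punctured o)), IsPoissonProcess ξ Λ P →
        (AdmitsCondIndep (D.restrict o) LD ΛD A' B' C' ↔
          CondIndepIndexed C (proj o ξ A) (proj o ξ B) (proj o ξ C) P)) := by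
  refine ⟨fun hABC => ⟨hΛ.tfae hAC hABC, fun P _ ξ hξ =>
    hΛ.admitsCondIndep_iff_proj hξ hAC hABC⟩, ?_⟩
  rintro D hD LD ΛD A' B' C' rfl rfl rfl rfl rfl
  have sA : A ⊆ D := hD ▸ (Finset.subset_union_left.trans Finset.subset_union_left)
  have sB : B ⊆ D := hD ▸ (Finset.subset_union_right.trans Finset.subset_union_left)
  have sC : C ⊆ D := hD ▸ Finset.subset_union_right
  have hAC' : Disjoint (A.subtype (· ∈ D)) (C.subtype (· ∈ D)) :=
    Finset.disjoint_left.2 fun i hi hi' =>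
      Finset.disjoint_left.1 hAC (Finset.mem_subtype.1 hi) (Finset.mem_subtype.1 hi')
  have hABC : A.subtype (· ∈ D) ∪ B.subtype (· ∈ D) ∪ C.subtype (· ∈ D) = Finset.univ :=
    Finset.eq_univ_iff_forall.2 fun i => by
      simpa only [Finset.mem_union, Finset.mem_subtype] using
        (show i.1 ∈ A ∪ B ∪ C from hD ▸ i.2)
  have hC : C.Nonempty ↔ (C.subtype (· ∈ D)).Nonempty :=
    ⟨fun ⟨c, hc⟩ => ⟨⟨c, sC hc⟩, Finset.mem_subtype.2 hc⟩,
      fun ⟨c, hc⟩ => ⟨c.1, Finset.mem_subtype.1 hc⟩⟩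
  refine ⟨?_, fun P _ ξ hξ => hΛ.admitsCondIndep_marginal_iff_proj hξ sA sB sC hAC hABC⟩
  rw [hC]
  exact (hΛ.marginal D).tfae hAC' hABC
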